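/- Let $0\le c<1<d\le 2$, $\Omega=(c,d)$, $\Omega_0=(c,1)\cup(1,d)$, and let $a:[c,d]\to\mathbb R$ satisfy: (i) $a(1)=0$, $a>0$ on $[c,d]\setminus\{1\}$, and there are $x_1^*\in[c,1)$, $x_2^*\in(1,d]$ such that $a$ is decreasing on $(x_1^*,1)$, increasing on $(1,x_2^*)$, and $$\sup_{x\in[x_1^*,1)}\frac{(1-x)|a'(x)|}{a(x)}=\lim_{x\nearrow1}\frac{(1-x)|a'(x)|}{a(x)}\in(0,\infty),\qquad \sup_{x\in(1,x_2^*]}\frac{(x-1)|a'(x)|}{a(x)}=\lim_{x\searrow1}\frac{(x-1)|a'(x)|}{a(x)}\in(0,\infty);$$ (ii) $a\in C([c,d])\cap C^1([c,d]\setminus\{1\})$; (iii) $(\sqrt a)_x\notin L^\infty(\Omega)$, while $1/(\sqrt a)_x\in L^\infty(\Omega)$ (in particular $(\sqrt a)_x\neq0$ a.e.). The degeneration is called weak if $1/a\in L^1(\Omega)$ and strong otherwise. Let $W^1_a$ be the set of $u\in L^2(\Omega)$ having a distributional derivative $u_x$ with $\int_\Omega a u_x^2\,dx<\infty$, where the distributional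 derivative is taken on all of $\Omega$ under weak degeneration (then $u_x\in L^1(\Omega)$ automatically) and on $\Omega_0$ under strong degeneration. Elements of $W^1_a$ are continuous on $[c,1)\cup(1,d]$; put $W^1_{a,0}=\{u\in W^1_a: u(c)=u(d)=0\}$ and $W^2_a=\{u\in W^1_a: a u_x\in W^{1,2}(\Omega)\}$. Let $H^1_a$ and $H^1_{a,0}$ be the closures of $C^\infty(\overline\Omega)$ and of $C_c^\infty(\Omega)$ in the norm $\|u\|_a=\big(\int_\Omega (u^2+a u_x^2)\,dx\big)^{1/2}$, and $H^2_a=\{u\in H^1_a: a u_x\in W^{1,2}(\Omega)\}$. Let $V=V^1_{a,0}$ be any linear space with $H^1_{a,0}\subseteq V\subseteq W^1_{a,0}$, and let $\mathcal H_a=V\times L^2(\Omega)$ with the inner product $$\langle (u,v),(\tilde u,\tilde v)\rangle=\int_\Omega v\tilde v\,dx+\int_\Omega a\,u_x\tilde u_x\,dx .$$ Define $\mathcal A(u,v)=(v,(a u_x)_x)$, where $D(\mathcal A)$ is the set of all $(u,v)\in\mathcal H_a$ with $u\in W^2_a$, $v\in V$ (the boundary conditions $u(c)=u(d)=0$ being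 contained in $u\in V$) and, at $x=1$, - under weak degeneration: $\lim_{x\nearrow1}u=\lim_{x\searrow1}u$ and $\lim_{x\nearrow1}a u_x=\lim_{x\searrow1}a u_x$ (all limits finite); - under strong degeneration: $\lim_{x\nearrow1}a\varphi_x u=0=\lim_{x\searrow1}a\varphi_x u$ for all $\varphi\in H^2_a$, and $\lim_{x\nearrow1}a u_x=0=\lim_{x\searrow1}a u_x$. Then $\mathcal H_a$ is a Hilbert space, $\mathcal A$ is densely defined, both $\mathcal A$ and its adjoint $\mathcal A^*$ are dissipative (that is, $\langle\mathcal A U,U\rangle\le0$ for all $U\in D(\mathcal A)$ and $\langle U,\mathcal A^*U\rangle\le0$ for all $U\in D(\mathcal A^*)$), and $\mathcal A$ is the infinitesimal generator of a strongly continuous semigroup of contractions on $\mathcal H_a$. -/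

import Mathlib

open MeasureTheory Set Filter Topology
open scoped ContDiff NNReal ENNReal

noncomputable section

namespace DegenerateWave

/-! ### Weak derivatives on open subsets of the line -/

/-- `g` is the distributional derivative of `u` on the open set `U`. -/
structure HasWeakDerivOn (U : Set ℝ) (u g : ℝ → ℝ) : Prop where
  locInt : LocallyIntegrableOn u U
  locInt_deriv : LocallyIntegrableOn g U
  integral_eq : ∀ φ : ℝ → ℝ, ContDiff ℝ ∞ φ → HasCompactSupport φ → tsupport φ ⊆ U →
    ∫ x in U, u x * deriv φ x = - ∫ x in U, g x * φ x

open Classical in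
/-- The (almost everywhere unique) distributional derivative of `u` on `U`,
and `0` if there is none. -/
def weakDeriv (U : Set ℝ) (u : ℝ → ℝ) : ℝ → ℝ :=
  if h : ∃ g, HasWeakDerivOn U u g then h.choose else 0

theorem hasWeakDerivOn_weakDeriv {U : Set ℝ} {u : ℝ → ℝ} (h : ∃ g, HasWeakDerivOn U u g) :
    HasWeakDerivOn U u (weakDeriv U u) := by
  rw [weakDeriv, dif_pos h]
  exact h.choose_spec

theorem setIntegral_mul_test {U : Set ℝ} {φ : ℝ → ℝ} (h : tsupport φ ⊆ U) (f : ℝ → ℝ) :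
    ∫ x in U, f x * φ x = ∫ x, f x * φ x := by
  apply setIntegral_eq_integral_of_forall_compl_eq_zero
  intro x hx
  rw [image_eq_zero_of_notMem_tsupport (fun hh => hx (h hh)), mul_zero]

theorem integrable_mul_test {U : Set ℝ} {φ f : ℝ → ℝ}
    (hφ : Continuous φ) (hc : HasCompactSupport φ)
    (h : tsupport φ ⊆ U) (hf : LocallyIntegrableOn f U) :
    Integrable (fun x => f x * φ x) (volume.restrict U) := by
  have h1 : IntegrableOn f (tsupport φ) := hf.integrableOn_compact_subset h hc
  have h2 : IntegrableOn (fun x => f x * φ x) (tsupport φ) :=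
    h1.mul_continuousOn hφ.continuousOn hc
  have h3 : Integrable (fun x => f x * φ x) := by
    refine (integrableOn_iff_integrable_of_support_subset ?_).1 h2
    intro x hx
    by_contra hh
    exact hx (by simp [image_eq_zero_of_notMem_tsupport hh])
  exact h3.restrict

theorem HasWeakDerivOn.add {U : Set ℝ} {u v g h : ℝ → ℝ}
    (hu : HasWeakDerivOn U u g) (hv : HasWeakDerivOn U v h) :
    HasWeakDerivOn U (u + v) (g + h) where
  locInt := hu.locInt.add hv.locInt
  locInt_deriv := hu.locInt_deriv.add hv.locInt_deriv
  integral_eq φ h1 h2 h3 := by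
    have h1' : Continuous (deriv φ) := h1.continuous_deriv (by simp)
    have h3' : tsupport (deriv φ) ⊆ U := (tsupport_deriv_subset (f := φ)).trans h3
    simp only [Pi.add_apply, add_mul]
    rw [integral_add (integrable_mul_test h1' h2.deriv h3' hu.locInt)
        (integrable_mul_test h1' h2.deriv h3' hv.locInt),
      integral_add (integrable_mul_test h1.continuous h2 h3 hu.locInt_deriv)
        (integrable_mul_test h1.continuous h2 h3 hv.locInt_deriv),
      hu.integral_eq φ h1 h2 h3, hv.integral_eq φ h1 h2 h3]
    ring

theorem HasWeakDerivOn.smul {U : Set ℝ} {u g : ℝ → ℝ} (r : ℝ)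
    (hu : HasWeakDerivOn U u g) : HasWeakDerivOn U (r • u) (r • g) where
  locInt := hu.locInt.smul r
  locInt_deriv := hu.locInt_deriv.smul r
  integral_eq φ h1 h2 h3 := by
    simp only [Pi.smul_apply, smul_eq_mul, mul_assoc, integral_const_mul]
    rw [hu.integral_eq φ h1 h2 h3]
    ring

theorem HasWeakDerivOn.congr {U : Set ℝ} {u v g h : ℝ → ℝ}
    (hu : HasWeakDerivOn U u g) (huv : u =ᵐ[volume.restrict U] v)
    (hgh : g =ᵐ[volume.restrict U] h) : HasWeakDerivOn U v h where
  locInt := hu.locInt.congr huv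
  locInt_deriv := hu.locInt_deriv.congr hgh
  integral_eq φ h1 h2 h3 := by
    have e1 : ∫ x in U, v x * deriv φ x = ∫ x in U, u x * deriv φ x :=
      integral_congr_ae (by filter_upwards [huv] with x hx; rw [hx])
    have e2 : ∫ x in U, h x * φ x = ∫ x in U, g x * φ x :=
      integral_congr_ae (by filter_upwards [hgh] with x hx; rw [hx])
    rw [e1, e2, hu.integral_eq φ h1 h2 h3]

theorem HasWeakDerivOn.mono {U W : Set ℝ} {u g : ℝ → ℝ}
    (hu : HasWeakDerivOn U u g) (hWU : W ⊆ U) : HasWeakDerivOn W u g where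
  locInt := hu.locInt.mono_set hWU
  locInt_deriv := hu.locInt_deriv.mono_set hWU
  integral_eq φ h1 h2 h3 := by
    have h4 := hu.integral_eq φ h1 h2 (h3.trans hWU)
    have h3' : tsupport (deriv φ) ⊆ W := (tsupport_deriv_subset (f := φ)).trans h3
    rw [setIntegral_mul_test (h3'.trans hWU), setIntegral_mul_test (h3.trans hWU)] at h4
    rw [setIntegral_mul_test h3', setIntegral_mul_test h3, h4]

theorem HasWeakDerivOn.unique {U : Set ℝ} (hU : IsOpen U) {u g h : ℝ → ℝ}
    (hg : HasWeakDerivOn U u g) (hh : HasWeakDerivOn U u h) :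
    g =ᵐ[volume.restrict U] h := by
  have key := hU.ae_eq_zero_of_integral_contDiff_smul_eq_zero (μ := volume)
    (f := fun x => g x - h x) (hg.locInt_deriv.sub hh.locInt_deriv) (by
      intro φ h1 h2 h3
      have e := hg.integral_eq φ h1 h2 h3
      rw [hh.integral_eq φ h1 h2 h3] at e
      have e2 : ∫ x in U, (g x - h x) * φ x = 0 := by
        simp only [sub_mul]
        rw [integral_sub (integrable_mul_test h1.continuous h2 h3 hg.locInt_deriv)
          (integrable_mul_test h1.continuous h2 h3 hh.locInt_deriv)]
        linarith
      rw [setIntegral_mul_test h3] at e2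
      simpa [mul_comm] using e2)
  rw [Filter.EventuallyEq, ae_restrict_iff' hU.measurableSet]
  filter_upwards [key] with x hx hxU
  linarith [hx hxU]

/-- A smooth compactly supported function with zero integral, supported in an interval, has a
smooth primitive supported in that interval. -/
theorem exists_test_primitive {p q : ℝ} (hpq : p < q) {χ : ℝ → ℝ} (h1 : ContDiff ℝ ∞ χ)
    (h2 : HasCompactSupport χ) (h3 : tsupport χ ⊆ Ioo p q) (h0 : ∫ x, χ x = 0) :
    ∃ φ : ℝ → ℝ, ContDiff ℝ ∞ φ ∧ HasCompactSupport φ ∧ tsupport φ ⊆ Ioo p q ∧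
      deriv φ = χ := by
  obtain ⟨α, β, hα, hβ, hK⟩ : ∃ α β, p < α ∧ β < q ∧ tsupport χ ⊆ Icc α β := by
    rcases (tsupport χ).eq_empty_or_nonempty with he | hne
    · exact ⟨(p + q) / 2, (p + q) / 2, by linarith, by linarith, by simp [he]⟩
    · obtain ⟨α, hα⟩ := h2.exists_isLeast hne
      obtain ⟨β, hβ⟩ := h2.exists_isGreatest hne
      exact ⟨α, β, (h3 hα.1).1, (h3 hβ.1).2, fun x hx => ⟨hα.2 hx, hβ.2 hx⟩⟩
  have hint : Integrable χ := h1.continuous.integrable_of_hasCompactSupport h2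
  have hz : ∀ x, x ∉ Icc α β → χ x = 0 := fun x hx =>
    image_eq_zero_of_notMem_tsupport fun h => hx (hK h)
  set φ : ℝ → ℝ := fun x => ∫ t in p..x, χ t with hφ
  have hd : ∀ x, HasDerivAt φ (χ x) x := fun x =>
    intervalIntegral.integral_hasDerivAt_right (h1.continuous.intervalIntegrable _ _)
      (h1.continuous.stronglyMeasurableAtFilter _ _) h1.continuous.continuousAt
  have hderiv : deriv φ = χ := funext fun x => (hd x).deriv
  have hsm : ContDiff ℝ ∞ φ := by
    rw [contDiff_infty_iff_deriv, hderiv]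
    exact ⟨fun x => (hd x).differentiableAt, h1⟩
  have hleft : ∀ x, x < α → φ x = 0 := by
    intro x hx
    have : ∫ t in p..x, χ t = ∫ t in p..x, (0 : ℝ) := by
      apply intervalIntegral.integral_congr
      intro t ht
      apply hz
      rintro ⟨h, -⟩
      have := (ht.2 : t ≤ max p x)
      exact absurd (lt_of_le_of_lt this (max_lt hα hx)) (not_lt.2 h)
    simp [hφ, this]
  have hright : ∀ x, β < x → φ x = 0 := by
    intro x hx
    by_cases hx' : x < α
    · exact hleft x hx'
    have hpx : p ≤ x := by linarith
    have e : ∫ t in p..x, χ t = ∫ t, χ t := by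
      rw [intervalIntegral.integral_of_le hpx]
      apply setIntegral_eq_integral_of_forall_compl_eq_zero
      intro t ht
      apply hz
      rintro ⟨h, h'⟩
      exact ht ⟨by linarith, by linarith⟩
    simp [hφ, e, h0]
  have hsub : tsupport φ ⊆ Icc α β := by
    apply closure_minimal _ isClosed_Icc
    intro x hx
    by_contra hh
    apply hx
    rw [mem_Icc, not_and_or, not_le, not_le] at hh
    exact hh.elim (hleft x) (hright x)
  exact ⟨φ, hsm, HasCompactSupport.of_support_subset_isCompact isCompact_Icc
    ((subset_tsupport _).trans hsub),
    hsub.trans fun x hx => ⟨lt_of_lt_of_le hα hx.1, lt_of_le_of_lt hx.2 hβ⟩, hderiv⟩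

/-- A function with vanishing distributional derivative on an interval is constant. -/
theorem HasWeakDerivOn.ae_const {p q : ℝ} (hpq : p < q) {u g : ℝ → ℝ}
    (hu : HasWeakDerivOn (Ioo p q) u g) (hg : g =ᵐ[volume.restrict (Ioo p q)] 0) :
    ∃ C : ℝ, u =ᵐ[volume.restrict (Ioo p q)] fun _ => C := by
  have hu0 : HasWeakDerivOn (Ioo p q) u 0 := hu.congr (ae_eq_refl _) hg
  -- a normalised bump function
  let b : ContDiffBump ((p + q) / 2) :=
    { rIn := (q - p) / 8, rOut := (q - p) / 4, rIn_pos := by linarith, rIn_lt_rOut := by linarith }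
  set η : ℝ → ℝ := b.normed volume with hη
  have e1 : ContDiff ℝ ∞ η := b.contDiff_normed
  have e2 : HasCompactSupport η := b.hasCompactSupport_normed
  have e3 : tsupport η ⊆ Ioo p q := by
    rw [hη, b.tsupport_normed_eq, Real.closedBall_eq_Icc]
    rintro x ⟨hx1, hx2⟩
    change (p + q) / 2 - (q - p) / 4 ≤ x at hx1
    change x ≤ (p + q) / 2 + (q - p) / 4 at hx2
    exact ⟨by linarith, by linarith⟩
  have e4 : ∫ x, η x = 1 := b.integral_normed
  have hηi : Integrable η := e1.continuous.integrable_of_hasCompactSupport e2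
  set C : ℝ := ∫ x in Ioo p q, u x * η x with hC
  refine ⟨C, ?_⟩
  have key := isOpen_Ioo.ae_eq_zero_of_integral_contDiff_smul_eq_zero (μ := volume)
    (U := Ioo p q) (f := fun x => u x - C) (hu.locInt.sub (locallyIntegrableOn_const C)) (by
      intro ψ h1 h2 h3
      have hψi : Integrable ψ := h1.continuous.integrable_of_hasCompactSupport h2
      set m : ℝ := ∫ x, ψ x with hm
      have hts : tsupport (fun x => ψ x - m * η x) ⊆ tsupport ψ ∪ tsupport η := by
        apply closure_minimal _ ((isClosed_tsupport _).union (isClosed_tsupport _))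
        intro x hx
        by_contra hh
        rw [mem_union, not_or] at hh
        exact hx (by simp [image_eq_zero_of_notMem_tsupport hh.1,
          image_eq_zero_of_notMem_tsupport hh.2])
      obtain ⟨φ, f1, f2, f3, f4⟩ := exists_test_primitive hpq
        (χ := fun x => ψ x - m * η x) (h1.sub (contDiff_const.mul e1))
        (HasCompactSupport.of_support_subset_isCompact (h2.union e2)
          ((subset_tsupport _).trans hts))
        (hts.trans (union_subset h3 e3))
        (by rw [integral_sub hψi (hηi.const_mul m), integral_const_mul, e4]; simp [hm])
      have g1 := hu0.integral_eq φ f1 f2 f3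
      rw [f4] at g1
      have i1 := integrable_mul_test h1.continuous h2 h3 hu.locInt
      have i2 := integrable_mul_test e1.continuous e2 e3 hu.locInt
      have g2 : ∫ x in Ioo p q, u x * (ψ x - m * η x)
          = (∫ x in Ioo p q, u x * ψ x) - m * C := by
        rw [hC, ← integral_const_mul, ← integral_sub i1 (i2.const_mul m)]
        congr 1
        ext x
        ring
      have g3 : ∫ x in Ioo p q, u x * ψ x = m * C := by
        simp only [Pi.zero_apply, zero_mul, integral_zero, neg_zero] at g1
        linarith
      have g4 : ∫ x in Ioo p q, (u x - C) * ψ x = 0 := by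
        simp only [sub_mul]
        rw [integral_sub i1 (integrable_mul_test h1.continuous h2 h3
          (locallyIntegrableOn_const C)), g3, integral_const_mul]
        have : ∫ x in Ioo p q, ψ x = m :=
          setIntegral_eq_integral_of_forall_compl_eq_zero fun x hx =>
            image_eq_zero_of_notMem_tsupport fun hh => hx (h3 hh)
        rw [this]
        ring
      rw [setIntegral_mul_test h3] at g4
      simpa [mul_comm] using g4)
  rw [Filter.EventuallyEq, ae_restrict_iff' measurableSet_Ioo]
  filter_upwards [key] with x hx hxU
  linarith [hx hxU]

/-! ### The degenerate weight -/

/-- The standing assumptions `0 ≤ c < 1 < d ≤ 2` on the interval and (i)-(iii) on the weight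
`a : [c, d] → ℝ`.  (The values of `a` outside `[c, d]` play no role; the derivative at the
endpoints of `[c, d]` is one-sided.) -/
structure IsDegenerateWeight (c d : ℝ) (a : ℝ → ℝ) : Prop where
  c_nonneg : 0 ≤ c
  c_lt : c < 1
  lt_d : 1 < d
  d_le : d ≤ 2
  /-- (i) `a` vanishes exactly at `1` and is positive elsewhere -/
  at_one : a 1 = 0
  pos : ∀ x ∈ Icc c d, x ≠ 1 → 0 < a x
  /-- (i) behaviour to the left of the degeneration point -/
  left : ∃ x₁ ∈ Ico c 1, AntitoneOn a (Ioo x₁ 1) ∧ ∃ m : ℝ, 0 < m ∧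
    IsLUB ((fun x => (1 - x) * |derivWithin a (Icc c d) x| / a x) '' Ico x₁ 1) m ∧
    Tendsto (fun x => (1 - x) * |derivWithin a (Icc c d) x| / a x) (𝓝[<] 1) (𝓝 m)
  /-- (i) behaviour to the right of the degeneration point -/
  right : ∃ x₂ ∈ Ioc 1 d, MonotoneOn a (Ioo 1 x₂) ∧ ∃ m : ℝ, 0 < m ∧
    IsLUB ((fun x => (x - 1) * |derivWithin a (Icc c d) x| / a x) '' Ioc 1 x₂) m ∧
    Tendsto (fun x => (x - 1) * |derivWithin a (Icc c d) x| / a x) (𝓝[>] 1) (𝓝 m)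
  /-- (ii) regularity -/
  cont : ContinuousOn a (Icc c d)
  contDiff : ContDiffOn ℝ 1 a (Icc c d \ {1})
  /-- (iii) `(√a)'` is not essentially bounded, whereas `1 / (√a)'` is defined almost everywhere
  and essentially bounded -/
  sqrt_deriv_not_bdd : ¬ MemLp (deriv fun x => √(a x)) ∞ (volume.restrict (Ioo c d))
  sqrt_deriv_ne_zero : ∀ᵐ x ∂volume.restrict (Ioo c d), deriv (fun x => √(a x)) x ≠ 0
  sqrt_deriv_inv_bdd :
    MemLp (fun x => (deriv (fun x => √(a x)) x)⁻¹) ∞ (volume.restrict (Ioo c d))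

/-- Weak degeneration: `1/a ∈ L¹(c,d)`.  Otherwise the degeneration is strong. -/
def WeaklyDegenerate (c d : ℝ) (a : ℝ → ℝ) : Prop :=
  IntegrableOn (fun x => 1 / a x) (Ioo c d)

/-! ### Function spaces -/

/-- The interval without the degeneration point. -/
abbrev punctured (c d : ℝ) : Set ℝ := Ioo c d \ {1}

/-- The derivative `u_x`, as a function on `(c,1) ∪ (1,d)`. -/
abbrev dx (c d : ℝ) (u : ℝ → ℝ) : ℝ → ℝ := weakDeriv (punctured c d) u

/-- The flux `a u_x`. -/
def flux (c d : ℝ) (a u : ℝ → ℝ) : ℝ → ℝ := fun x => a x * dx c d u x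

open Classical in
/-- The open set on which the distributional derivative of an element of `W¹_a` is taken: all of
`(c,d)` under weak degeneration, `(c,1) ∪ (1,d)` under strong degeneration. -/
def derivDomain (c d : ℝ) (a : ℝ → ℝ) : Set ℝ :=
  if WeaklyDegenerate c d a then Ioo c d else punctured c d

/-- `u ∈ W¹_a(c,d)`: `u ∈ L²` has a distributional derivative `g` with `∫ a g² < ∞`.  (Under weak
degeneration `g ∈ L¹(c,d)` follows, by the Cauchy-Schwarz inequality.) -/
def MemW1a (c d : ℝ) (a u : ℝ → ℝ) : Prop :=
  MemLp u 2 (volume.restrict (Ioo c d)) ∧ ∃ g : ℝ → ℝ, HasWeakDerivOn (derivDomain c d a) u g ∧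
    MemLp (fun x => √(a x) * g x) 2 (volume.restrict (Ioo c d))

/-- `u ∈ W¹_{a,0}(c,d)`: `u ∈ W¹_a(c,d)` and the continuous representative of `u` on
`[c,1) ∪ (1,d]` vanishes at `c` and at `d`. -/
def MemW1a0 (c d : ℝ) (a u : ℝ → ℝ) : Prop :=
  MemW1a c d a u ∧ ∃ f : ℝ → ℝ, f =ᵐ[volume.restrict (Ioo c d)] u ∧
    ContinuousOn f (Icc c d \ {1}) ∧ f c = 0 ∧ f d = 0

/-- `∫ (u² + a g²)`, the square of the norm `‖u‖_a` of a function `u` with derivative `g`. -/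
def normASq (c d : ℝ) (a u g : ℝ → ℝ) : ℝ≥0∞ :=
  ∫⁻ x in Ioo c d, ENNReal.ofReal (u x ^ 2 + a x * g x ^ 2)

/-- `u` belongs to the closure of the set `S` of smooth functions with respect to `‖·‖_a`. -/
def MemClosure (c d : ℝ) (a : ℝ → ℝ) (S : Set (ℝ → ℝ)) (u : ℝ → ℝ) : Prop :=
  MemLp u 2 (volume.restrict (Ioo c d)) ∧ ∃ g : ℝ → ℝ, HasWeakDerivOn (punctured c d) u g ∧
    ∀ ε : ℝ≥0∞, 0 < ε → ∃ φ ∈ S,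
      normASq c d a (fun x => φ x - u x) (fun x => deriv φ x - g x) < ε

/-- `H¹_a(c,d)`, the closure of `C^∞([c,d])`. -/
def MemH1a (c d : ℝ) (a u : ℝ → ℝ) : Prop :=
  MemClosure c d a {φ | ContDiff ℝ ∞ φ} u

/-- `H¹_{a,0}(c,d)`, the closure of `C^∞_c(c,d)`. -/
def MemH1a0 (c d : ℝ) (a u : ℝ → ℝ) : Prop :=
  MemClosure c d a {φ | ContDiff ℝ ∞ φ ∧ HasCompactSupport φ ∧ tsupport φ ⊆ Ioo c d} u

/-- The Sobolev space `W^{1,2}(c,d)` on the whole interval. -/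
def MemW12 (c d : ℝ) (w : ℝ → ℝ) : Prop :=
  MemLp w 2 (volume.restrict (Ioo c d)) ∧
    ∃ g : ℝ → ℝ, HasWeakDerivOn (Ioo c d) w g ∧ MemLp g 2 (volume.restrict (Ioo c d))

/-- `W²_a(c,d) = {u ∈ W¹_a : a u_x ∈ W^{1,2}}`. -/
def MemW2a (c d : ℝ) (a u : ℝ → ℝ) : Prop :=
  MemW1a c d a u ∧ MemW12 c d (flux c d a u)

/-- `H²_a(c,d) = {u ∈ H¹_a : a u_x ∈ W^{1,2}}`. -/
def MemH2a (c d : ℝ) (a u : ℝ → ℝ) : Prop :=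
  MemH1a c d a u ∧ MemW12 c d (flux c d a u)

/-! ### Transmission conditions -/

/-- The representative of `f` that is continuous on `(c,1) ∪ (1,d)` exists and has the limit `L`
along `l`, where `l` is `𝓝[<] 1` or `𝓝[>] 1`. -/
def HasLim (c d : ℝ) (l : Filter ℝ) (f : ℝ → ℝ) (L : ℝ) : Prop :=
  ∃ f' : ℝ → ℝ, f' =ᵐ[volume.restrict (Ioo c d)] f ∧ ContinuousOn f' (punctured c d) ∧
    Tendsto f' l (𝓝 L)

/-- The transmission conditions at `1` under weak degeneration. -/
def WeakTransmission (c d : ℝ) (a u : ℝ → ℝ) : Prop :=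
  (∃ L, HasLim c d (𝓝[<] 1) u L ∧ HasLim c d (𝓝[>] 1) u L) ∧
  (∃ L, HasLim c d (𝓝[<] 1) (flux c d a u) L ∧ HasLim c d (𝓝[>] 1) (flux c d a u) L)

/-- The transmission conditions at `1` under strong degeneration. -/
def StrongTransmission (c d : ℝ) (a u : ℝ → ℝ) : Prop :=
  (∀ φ : ℝ → ℝ, MemH2a c d a φ →
    HasLim c d (𝓝[<] 1) (fun x => flux c d a φ x * u x) 0 ∧
    HasLim c d (𝓝[>] 1) (fun x => flux c d a φ x * u x) 0) ∧
  HasLim c d (𝓝[<] 1) (flux c d a u) 0 ∧ HasLim c d (𝓝[>] 1) (flux c d a u) 0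

/-- The conditions on the first component in the domain of the operator. -/
def MemDom (c d : ℝ) (a u : ℝ → ℝ) : Prop :=
  MemW2a c d a u ∧ (WeaklyDegenerate c d a → WeakTransmission c d a u) ∧
    (¬ WeaklyDegenerate c d a → StrongTransmission c d a u)

/-! ### Linearity of these conditions -/

theorem isOpen_punctured (c d : ℝ) : IsOpen (punctured c d) :=
  isOpen_Ioo.sdiff isClosed_singleton

theorem restrict_punctured (c d : ℝ) :
    volume.restrict (punctured c d) = volume.restrict (Ioo c d) :=
  Measure.restrict_congr_set (sdiff_null_ae_eq_self (by simp))

theorem isOpen_derivDomain (c d : ℝ) (a : ℝ → ℝ) : IsOpen (derivDomain c d a) := by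
  unfold derivDomain
  split_ifs
  exacts [isOpen_Ioo, isOpen_punctured c d]

theorem restrict_derivDomain (c d : ℝ) (a : ℝ → ℝ) :
    volume.restrict (derivDomain c d a) = volume.restrict (Ioo c d) := by
  unfold derivDomain
  split_ifs
  exacts [rfl, restrict_punctured c d]

theorem punctured_subset_derivDomain (c d : ℝ) (a : ℝ → ℝ) :
    punctured c d ⊆ derivDomain c d a := by
  unfold derivDomain
  split_ifs
  exacts [sdiff_subset, subset_rfl]

section

variable {c d : ℝ} {a u v w : ℝ → ℝ}

theorem dx_eq {g : ℝ → ℝ} (h : HasWeakDerivOn (punctured c d) u g) :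
    dx c d u =ᵐ[volume.restrict (Ioo c d)] g := by
  have := (hasWeakDerivOn_weakDeriv ⟨g, h⟩).unique (isOpen_punctured c d) h
  rwa [restrict_punctured] at this

theorem MemW1a.hasWeakDerivOn (h : MemW1a c d a u) :
    HasWeakDerivOn (punctured c d) u (dx c d u) := by
  obtain ⟨g, hg, -⟩ := h.2
  exact hasWeakDerivOn_weakDeriv ⟨g, hg.mono (punctured_subset_derivDomain c d a)⟩

theorem MemW1a.memLp_dx (h : MemW1a c d a u) :
    MemLp (fun x => √(a x) * dx c d u x) 2 (volume.restrict (Ioo c d)) := by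
  obtain ⟨g, hg, hg'⟩ := h.2
  refine hg'.ae_eq ?_
  filter_upwards [dx_eq (hg.mono (punctured_subset_derivDomain c d a))] with x hx
  rw [hx]

theorem MemW1a.add (hu : MemW1a c d a u) (hv : MemW1a c d a v) : MemW1a c d a (u + v) := by
  obtain ⟨g, hg, hg'⟩ := hu.2
  obtain ⟨h, hh, hh'⟩ := hv.2
  refine ⟨hu.1.add hv.1, g + h, hg.add hh, ?_⟩
  refine (hg'.add hh').ae_eq (Eventually.of_forall fun x => ?_)
  simp only [Pi.add_apply]
  ring

theorem MemW1a.smul (r : ℝ) (hu : MemW1a c d a u) : MemW1a c d a (r • u) := by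
  obtain ⟨g, hg, hg'⟩ := hu.2
  refine ⟨hu.1.const_smul r, r • g, hg.smul r, ?_⟩
  refine (hg'.const_smul r).ae_eq (Eventually.of_forall fun x => ?_)
  simp only [Pi.smul_apply, smul_eq_mul]
  ring

theorem MemW1a.congr (hu : MemW1a c d a u) (h : u =ᵐ[volume.restrict (Ioo c d)] v) :
    MemW1a c d a v := by
  obtain ⟨g, hg, hg'⟩ := hu.2
  exact ⟨hu.1.ae_eq h, g, hg.congr (by rwa [restrict_derivDomain]) (ae_eq_refl _), hg'⟩

theorem dx_add (hu : MemW1a c d a u) (hv : MemW1a c d a v) :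
    dx c d (u + v) =ᵐ[volume.restrict (Ioo c d)] dx c d u + dx c d v :=
  dx_eq (hu.hasWeakDerivOn.add hv.hasWeakDerivOn)

theorem dx_smul (r : ℝ) (hu : MemW1a c d a u) :
    dx c d (r • u) =ᵐ[volume.restrict (Ioo c d)] r • dx c d u :=
  dx_eq (hu.hasWeakDerivOn.smul r)

theorem dx_congr (hu : MemW1a c d a u) (h : u =ᵐ[volume.restrict (Ioo c d)] v) :
    dx c d v =ᵐ[volume.restrict (Ioo c d)] dx c d u :=
  dx_eq (hu.hasWeakDerivOn.congr (by rwa [restrict_punctured]) (ae_eq_refl _))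

theorem flux_add (hu : MemW1a c d a u) (hv : MemW1a c d a v) :
    flux c d a (u + v) =ᵐ[volume.restrict (Ioo c d)] flux c d a u + flux c d a v := by
  filter_upwards [dx_add hu hv] with x hx
  simp only [flux, hx, Pi.add_apply, mul_add]

theorem flux_smul (r : ℝ) (hu : MemW1a c d a u) :
    flux c d a (r • u) =ᵐ[volume.restrict (Ioo c d)] r • flux c d a u := by
  filter_upwards [dx_smul r hu] with x hx
  simp only [flux, hx, Pi.smul_apply, smul_eq_mul]
  ring

theorem flux_congr (hu : MemW1a c d a u) (h : u =ᵐ[volume.restrict (Ioo c d)] v) :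
    flux c d a u =ᵐ[volume.restrict (Ioo c d)] flux c d a v := by
  filter_upwards [dx_congr hu h] with x hx
  simp only [flux, hx]

theorem MemW12.add (hu : MemW12 c d u) (hv : MemW12 c d v) : MemW12 c d (u + v) := by
  obtain ⟨g, hg, hg'⟩ := hu.2
  obtain ⟨h, hh, hh'⟩ := hv.2
  exact ⟨hu.1.add hv.1, g + h, hg.add hh, hg'.add hh'⟩

theorem MemW12.smul (r : ℝ) (hu : MemW12 c d u) : MemW12 c d (r • u) := by
  obtain ⟨g, hg, hg'⟩ := hu.2
  exact ⟨hu.1.const_smul r, r • g, hg.smul r, hg'.const_smul r⟩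

theorem MemW12.congr (hu : MemW12 c d u) (h : u =ᵐ[volume.restrict (Ioo c d)] v) :
    MemW12 c d v := by
  obtain ⟨g, hg, hg'⟩ := hu.2
  exact ⟨hu.1.ae_eq h, g, hg.congr h (ae_eq_refl _), hg'⟩

theorem MemW12.hasWeakDerivOn (hu : MemW12 c d u) :
    HasWeakDerivOn (Ioo c d) u (weakDeriv (Ioo c d) u) := by
  obtain ⟨g, hg, -⟩ := hu.2
  exact hasWeakDerivOn_weakDeriv ⟨g, hg⟩

theorem MemW12.memLp_weakDeriv (hu : MemW12 c d u) :
    MemLp (weakDeriv (Ioo c d) u) 2 (volume.restrict (Ioo c d)) := by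
  obtain ⟨g, hg, hg'⟩ := hu.2
  exact hg'.ae_eq (hg.unique isOpen_Ioo hu.hasWeakDerivOn)

theorem HasLim.congr {l : Filter ℝ} {L : ℝ} (hu : HasLim c d l u L)
    (h : u =ᵐ[volume.restrict (Ioo c d)] v) : HasLim c d l v L := by
  obtain ⟨f, h1, h2, h3⟩ := hu
  exact ⟨f, h1.trans h, h2, h3⟩

theorem HasLim.add {l : Filter ℝ} {L M : ℝ} (hu : HasLim c d l u L) (hv : HasLim c d l v M) :
    HasLim c d l (u + v) (L + M) := by
  obtain ⟨f, h1, h2, h3⟩ := hu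
  obtain ⟨g, h4, h5, h6⟩ := hv
  exact ⟨f + g, h1.add h4, h2.add h5, h3.add h6⟩

theorem HasLim.smul {l : Filter ℝ} {L : ℝ} (r : ℝ) (hu : HasLim c d l u L) :
    HasLim c d l (r • u) (r * L) := by
  obtain ⟨f, h1, h2, h3⟩ := hu
  exact ⟨r • f, h1.const_smul r, h2.const_smul r, h3.const_mul r⟩

theorem hasWeakDerivOn_zero (U : Set ℝ) : HasWeakDerivOn U 0 0 where
  locInt := locallyIntegrableOn_zero
  locInt_deriv := locallyIntegrableOn_zero
  integral_eq φ _ _ _ := by simp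

theorem HasLim.zero {l : Filter ℝ} : HasLim c d l 0 0 :=
  ⟨0, ae_eq_refl _, continuousOn_const, tendsto_const_nhds⟩

theorem MemDom.zero : MemDom c d a 0 := by
  have hf : (0 : ℝ → ℝ) =ᵐ[volume.restrict (Ioo c d)] flux c d a 0 := by
    filter_upwards [dx_eq (c := c) (d := d) (hasWeakDerivOn_zero _)] with x hx
    simp [flux, hx]
  refine ⟨⟨⟨MemLp.zero, 0, hasWeakDerivOn_zero _, by simp⟩,
    MemW12.congr ⟨MemLp.zero, 0, hasWeakDerivOn_zero _, MemLp.zero⟩ hf⟩, fun _ => ?_, fun _ => ?_⟩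
  · exact ⟨⟨0, HasLim.zero, HasLim.zero⟩, 0, HasLim.zero.congr hf, HasLim.zero.congr hf⟩
  · refine ⟨fun φ _ => ?_, HasLim.zero.congr hf, HasLim.zero.congr hf⟩
    have e : (fun x => flux c d a φ x * (0 : ℝ → ℝ) x) = 0 := by
      ext x
      simp
    rw [e]
    exact ⟨HasLim.zero, HasLim.zero⟩

theorem MemDom.add (hu : MemDom c d a u) (hv : MemDom c d a v) : MemDom c d a (u + v) := by
  have hf := (flux_add hu.1.1 hv.1.1).symm
  refine ⟨⟨hu.1.1.add hv.1.1, (hu.1.2.add hv.1.2).congr hf⟩, fun hw => ?_, fun hs => ?_⟩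
  · obtain ⟨⟨L, h1, h2⟩, M, h3, h4⟩ := hu.2.1 hw
    obtain ⟨⟨L', h1', h2'⟩, M', h3', h4'⟩ := hv.2.1 hw
    exact ⟨⟨L + L', h1.add h1', h2.add h2'⟩, M + M', (h3.add h3').congr hf,
      (h4.add h4').congr hf⟩
  · obtain ⟨h1, h2, h3⟩ := hu.2.2 hs
    obtain ⟨h1', h2', h3'⟩ := hv.2.2 hs
    refine ⟨fun φ hφ => ?_, by simpa using (h2.add h2').congr hf,
      by simpa using (h3.add h3').congr hf⟩
    have e : (fun x => flux c d a φ x * (u + v) x)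
        = (fun x => flux c d a φ x * u x) + fun x => flux c d a φ x * v x := by
      ext x
      simp [mul_add]
    rw [e]
    exact ⟨by simpa using (h1 φ hφ).1.add (h1' φ hφ).1,
      by simpa using (h1 φ hφ).2.add (h1' φ hφ).2⟩

theorem MemDom.smul (r : ℝ) (hu : MemDom c d a u) : MemDom c d a (r • u) := by
  have hf := (flux_smul r hu.1.1).symm
  refine ⟨⟨hu.1.1.smul r, (hu.1.2.smul r).congr hf⟩, fun hw => ?_, fun hs => ?_⟩
  · obtain ⟨⟨L, h1, h2⟩, M, h3, h4⟩ := hu.2.1 hw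
    exact ⟨⟨r * L, h1.smul r, h2.smul r⟩, r * M, (h3.smul r).congr hf, (h4.smul r).congr hf⟩
  · obtain ⟨h1, h2, h3⟩ := hu.2.2 hs
    refine ⟨fun φ hφ => ?_, by simpa using (h2.smul r).congr hf,
      by simpa using (h3.smul r).congr hf⟩
    have e : (fun x => flux c d a φ x * (r • u) x)
        = r • fun x => flux c d a φ x * u x := by
      ext x
      simp only [Pi.smul_apply, smul_eq_mul]
      ring
    rw [e]
    exact ⟨by simpa using (h1 φ hφ).1.smul r, by simpa using (h1 φ hφ).2.smul r⟩

theorem MemDom.congr (hu : MemDom c d a u) (h : u =ᵐ[volume.restrict (Ioo c d)] v) :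
    MemDom c d a v := by
  have hf := flux_congr hu.1.1 h
  refine ⟨⟨hu.1.1.congr h, hu.1.2.congr hf⟩, fun hw => ?_, fun hs => ?_⟩
  · obtain ⟨⟨L, h1, h2⟩, M, h3, h4⟩ := hu.2.1 hw
    exact ⟨⟨L, h1.congr h, h2.congr h⟩, M, h3.congr hf, h4.congr hf⟩
  · obtain ⟨h1, h2, h3⟩ := hu.2.2 hs
    have e : ∀ φ : ℝ → ℝ, (fun x => flux c d a φ x * u x) =ᵐ[volume.restrict (Ioo c d)]
        fun x => flux c d a φ x * v x := fun φ => by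
      filter_upwards [h] with x hx
      rw [hx]
    exact ⟨fun φ hφ => ⟨(h1 φ hφ).1.congr (e φ), (h1 φ hφ).2.congr (e φ)⟩,
      h2.congr hf, h3.congr hf⟩

/-- An element of `W¹_{a,0}` whose derivative vanishes is zero. -/
theorem MemW1a0.ae_zero (ha : IsDegenerateWeight c d a) (hu : MemW1a0 c d a u)
    (h0 : dx c d u =ᵐ[volume.restrict (Ioo c d)] 0) : u =ᵐ[volume.restrict (Ioo c d)] 0 := by
  obtain ⟨f, hf, hcont, hfc, hfd⟩ := hu.2
  have hc := ha.c_lt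
  have hd := ha.lt_d
  have hsub1 : Ioo c 1 ⊆ punctured c d := fun x hx =>
    ⟨⟨hx.1, hx.2.trans hd⟩, fun h => hx.2.ne h⟩
  have hsub2 : Ioo 1 d ⊆ punctured c d := fun x hx =>
    ⟨⟨hc.trans hx.1, hx.2⟩, fun h => hx.1.ne' h⟩
  have h0' : dx c d u =ᵐ[volume.restrict (punctured c d)] 0 := by rwa [restrict_punctured]
  have hf' : f =ᵐ[volume.restrict (punctured c d)] u := by rwa [restrict_punctured]
  have hD := hu.1.hasWeakDerivOn
  obtain ⟨C₁, hC₁⟩ := (hD.mono hsub1).ae_const hc (ae_restrict_of_ae_restrict_of_subset hsub1 h0')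
  obtain ⟨C₂, hC₂⟩ := (hD.mono hsub2).ae_const hd (ae_restrict_of_ae_restrict_of_subset hsub2 h0')
  have e1 : EqOn f (fun _ => C₁) (Ico c 1) := by
    refine Measure.eqOn_Ico_of_ae_eq (μ := volume) ?_
      (hcont.mono fun x hx => ⟨⟨hx.1, (hx.2.trans hd).le⟩, fun h => hx.2.ne h⟩)
      continuousOn_const
    have := (ae_restrict_of_ae_restrict_of_subset hsub1 hf')
    rw [Measure.restrict_congr_set (Ioo_ae_eq_Ico (μ := volume)).symm]
    exact EventuallyEq.trans this hC₁
  have e2 : EqOn f (fun _ => C₂) (Ioc 1 d) := by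
    refine Measure.eqOn_Ioc_of_ae_eq (μ := volume) ?_
      (hcont.mono fun x hx => ⟨⟨(hc.trans hx.1).le, hx.2⟩, fun h => hx.1.ne' h⟩)
      continuousOn_const
    have := (ae_restrict_of_ae_restrict_of_subset hsub2 hf')
    rw [Measure.restrict_congr_set (Ioo_ae_eq_Ioc (μ := volume)).symm]
    exact EventuallyEq.trans this hC₂
  have z1 : C₁ = 0 := (e1 ⟨le_rfl, hc⟩).symm.trans hfc
  have z2 : C₂ = 0 := (e2 ⟨hd, le_rfl⟩).symm.trans hfd
  rw [← restrict_punctured]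
  refine hf'.symm.trans ?_
  rw [Filter.EventuallyEq, ae_restrict_iff' (isOpen_punctured c d).measurableSet]
  refine Eventually.of_forall fun x hx => ?_
  rcases lt_or_gt_of_ne (show x ≠ 1 from hx.2) with h | h
  · exact (e1 ⟨hx.1.1.le, h⟩).trans z1
  · exact (e2 ⟨h, hx.1.2.le⟩).trans z2

end

/-! ### The energy space -/

/-- `L²(c,d)`. -/
abbrev L2 (c d : ℝ) : Type := Lp ℝ 2 (volume.restrict (Ioo c d))

/-- A subspace `V ⊆ W¹_{a,0}` of `L²(c,d)`, to be endowed with the inner product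
`∫ a u_x v_x`. -/
def EnergySpace {c d : ℝ} {a : ℝ → ℝ} (_ha : IsDegenerateWeight c d a)
    (V : Submodule ℝ (L2 c d)) (_hV : ∀ u ∈ V, MemW1a0 c d a u) : Type := V

section

variable {c d : ℝ} {a : ℝ → ℝ} (ha : IsDegenerateWeight c d a)
  (V : Submodule ℝ (L2 c d)) (hV : ∀ u ∈ V, MemW1a0 c d a u)

instance : AddCommGroup (EnergySpace ha V hV) := inferInstanceAs (AddCommGroup V)

instance : Module ℝ (EnergySpace ha V hV) := inferInstanceAs (Module ℝ V)

/-- The inclusion of the energy space into `L²(c,d)`. -/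
def EnergySpace.toL2 : EnergySpace ha V hV →ₗ[ℝ] L2 c d := V.subtype

/-- An element of `V` as an element of the energy space. -/
def EnergySpace.mk (v : L2 c d) (hv : v ∈ V) : EnergySpace ha V hV := (⟨v, hv⟩ : V)

variable {ha V hV}

theorem EnergySpace.memW1a0 (u : EnergySpace ha V hV) :
    MemW1a0 c d a (EnergySpace.toL2 ha V hV u) :=
  hV _ u.2

theorem EnergySpace.dx_add (u v : EnergySpace ha V hV) :
    dx c d (EnergySpace.toL2 ha V hV (u + v)) =ᵐ[volume.restrict (Ioo c d)]
      dx c d (EnergySpace.toL2 ha V hV u) + dx c d (EnergySpace.toL2 ha V hV v) := by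
  rw [map_add]
  exact (dx_congr (u.memW1a0.1.add v.memW1a0.1) (Lp.coeFn_add _ _).symm).trans
    (DegenerateWave.dx_add u.memW1a0.1 v.memW1a0.1)

theorem EnergySpace.dx_smul (r : ℝ) (u : EnergySpace ha V hV) :
    dx c d (EnergySpace.toL2 ha V hV (r • u)) =ᵐ[volume.restrict (Ioo c d)]
      r • dx c d (EnergySpace.toL2 ha V hV u) := by
  rw [map_smul]
  exact (dx_congr (u.memW1a0.1.smul r) (Lp.coeFn_smul _ _).symm).trans
    (DegenerateWave.dx_smul r u.memW1a0.1)

theorem ae_weight_pos (ha : IsDegenerateWeight c d a) :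
    ∀ᵐ x ∂volume.restrict (Ioo c d), 0 < a x := by
  rw [← restrict_punctured, ae_restrict_iff' (isOpen_punctured c d).measurableSet]
  exact Eventually.of_forall fun x hx => ha.pos x (Ioo_subset_Icc_self hx.1) hx.2

theorem EnergySpace.integrable (u v : EnergySpace ha V hV) :
    Integrable (fun x => a x * dx c d (EnergySpace.toL2 ha V hV u) x *
      dx c d (EnergySpace.toL2 ha V hV v) x) (volume.restrict (Ioo c d)) := by
  refine (u.memW1a0.1.memLp_dx.integrable_mul v.memW1a0.1.memLp_dx).congr ?_
  filter_upwards [ae_weight_pos ha] with x hx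
  have := Real.mul_self_sqrt hx.le
  simp only [Pi.mul_apply]
  linear_combination (dx c d (EnergySpace.toL2 ha V hV u) x *
    dx c d (EnergySpace.toL2 ha V hV v) x) * this

variable (ha V hV)

/-- The inner product `⟪u, v⟫ = ∫ a u_x v_x`. -/
@[reducible]
def energyCore : InnerProductSpace.Core ℝ (EnergySpace ha V hV) where
  inner u v := ∫ x in Ioo c d, a x * dx c d (EnergySpace.toL2 ha V hV u) x *
    dx c d (EnergySpace.toL2 ha V hV v) x
  conj_inner_symm u v := by
    simp only [conj_trivial]
    congr 1
    ext x
    ring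
  re_inner_nonneg u := by
    refine integral_nonneg_of_ae ?_
    filter_upwards [ae_weight_pos ha] with x hx
    simp only [Pi.zero_apply, mul_assoc]
    exact mul_nonneg hx.le (mul_self_nonneg _)
  add_left u v w := by
    rw [← integral_add (u.integrable w) (v.integrable w)]
    refine integral_congr_ae ?_
    filter_upwards [EnergySpace.dx_add u v] with x hx
    rw [hx, Pi.add_apply]
    ring
  smul_left u v r := by
    rw [conj_trivial, ← integral_const_mul]
    refine integral_congr_ae ?_
    filter_upwards [EnergySpace.dx_smul r u] with x hx
    rw [hx, Pi.smul_apply, smul_eq_mul]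
    ring
  definite u hu := by
    have h1 := (integral_eq_zero_iff_of_nonneg_ae (by
      filter_upwards [ae_weight_pos ha] with x hx
      simp only [Pi.zero_apply, mul_assoc]
      exact mul_nonneg hx.le (mul_self_nonneg _)) (u.integrable u)).1 hu
    have h2 : dx c d (EnergySpace.toL2 ha V hV u) =ᵐ[volume.restrict (Ioo c d)] 0 := by
      filter_upwards [h1, ae_weight_pos ha] with x hx hax
      simpa [hax.ne'] using hx
    have h3 := u.memW1a0.ae_zero ha h2
    have h4 : EnergySpace.toL2 ha V hV u = 0 := Lp.ext (h3.trans (Lp.coeFn_zero _ _ _).symm)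
    exact Subtype.ext h4

instance : NormedAddCommGroup (EnergySpace ha V hV) :=
  (energyCore ha V hV).toNormedAddCommGroup

instance : InnerProductSpace ℝ (EnergySpace ha V hV) :=
  InnerProductSpace.ofCore (energyCore ha V hV).toCore

/-- `H_a = V × L²(c,d)`, with the inner product
`⟪(u,v), (u',v')⟫ = ∫ a u_x u'_x + ∫ v v'`. -/
abbrev StateSpace : Type := WithLp 2 (EnergySpace ha V hV × L2 c d)

/-! ### The wave operator -/

/-- `D(A)`: the pairs `(u, v)` in `H_a` with `u ∈ W²_a`, `v ∈ V` and the transmission conditions.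
The boundary conditions `u(c) = u(d) = 0` are part of `u ∈ V`. -/
def waveDomain : Submodule ℝ (StateSpace ha V hV) where
  carrier := {U | MemDom c d a (EnergySpace.toL2 ha V hV U.fst) ∧ U.snd ∈ V}
  add_mem' {U W} hU hW := by
    refine ⟨?_, V.add_mem hU.2 hW.2⟩
    rw [WithLp.add_fst, map_add]
    exact (hU.1.add hW.1).congr (Lp.coeFn_add _ _).symm
  smul_mem' r U hU := by
    refine ⟨?_, V.smul_mem r hU.2⟩
    rw [WithLp.smul_fst, map_smul]
    exact (hU.1.smul r).congr (Lp.coeFn_smul _ _).symm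
  zero_mem' := by
    refine ⟨?_, V.zero_mem⟩
    rw [WithLp.zero_fst, map_zero]
    exact MemDom.zero.congr (Lp.coeFn_zero _ _ _).symm

variable {ha V hV}

/-- The second component `(a u_x)_x` of `A (u, v)`, an element of `L²(c,d)`. -/
def divFlux (U : waveDomain ha V hV) : L2 c d :=
  (U.2.1.1.2.memLp_weakDeriv).toLp
    (weakDeriv (Ioo c d) (flux c d a (EnergySpace.toL2 ha V hV U.1.fst)))

theorem divFlux_eq (U : waveDomain ha V hV) {g : ℝ → ℝ}
    (h : HasWeakDerivOn (Ioo c d) (flux c d a (EnergySpace.toL2 ha V hV U.1.fst)) g) :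
    divFlux U =ᵐ[volume.restrict (Ioo c d)] g :=
  (MemLp.coeFn_toLp _).trans ((U.2.1.1.2.hasWeakDerivOn).unique isOpen_Ioo h)

theorem hasWeakDerivOn_divFlux (U : waveDomain ha V hV) :
    HasWeakDerivOn (Ioo c d) (flux c d a (EnergySpace.toL2 ha V hV U.1.fst)) (divFlux U) :=
  (U.2.1.1.2.hasWeakDerivOn).congr (ae_eq_refl _) (MemLp.coeFn_toLp _).symm

variable (ha V hV)

theorem flux_add_coe (U W : waveDomain ha V hV) :
    flux c d a (EnergySpace.toL2 ha V hV U.1.fst) + flux c d a (EnergySpace.toL2 ha V hV W.1.fst)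
      =ᵐ[volume.restrict (Ioo c d)] flux c d a (EnergySpace.toL2 ha V hV (U + W).1.fst) := by
  refine (flux_add U.2.1.1.1 W.2.1.1.1).symm.trans ?_
  refine flux_congr (U.2.1.1.1.add W.2.1.1.1) ?_
  rw [Submodule.coe_add, WithLp.add_fst, map_add]
  exact (Lp.coeFn_add _ _).symm

theorem flux_smul_coe (r : ℝ) (U : waveDomain ha V hV) :
    r • flux c d a (EnergySpace.toL2 ha V hV U.1.fst)
      =ᵐ[volume.restrict (Ioo c d)] flux c d a (EnergySpace.toL2 ha V hV (r • U).1.fst) := by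
  refine (flux_smul r U.2.1.1.1).symm.trans ?_
  refine flux_congr (U.2.1.1.1.smul r) ?_
  rw [Submodule.coe_smul, WithLp.smul_fst, map_smul]
  exact (Lp.coeFn_smul _ _).symm

theorem divFlux_add (U W : waveDomain ha V hV) : divFlux (U + W) = divFlux U + divFlux W :=
  Lp.ext ((divFlux_eq (U + W) (((hasWeakDerivOn_divFlux U).add (hasWeakDerivOn_divFlux W)).congr
    (flux_add_coe ha V hV U W) (ae_eq_refl _))).trans (Lp.coeFn_add _ _).symm)

theorem divFlux_smul (r : ℝ) (U : waveDomain ha V hV) : divFlux (r • U) = r • divFlux U :=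
  Lp.ext ((divFlux_eq (r • U) (((hasWeakDerivOn_divFlux U).smul r).congr
    (flux_smul_coe ha V hV r U) (ae_eq_refl _))).trans (Lp.coeFn_smul _ _).symm)

/-- The operator `A (u, v) = (v, (a u_x)_x)` on `H_a` with domain `D(A)`. -/
def waveOperator : StateSpace ha V hV →ₗ.[ℝ] StateSpace ha V hV where
  domain := waveDomain ha V hV
  toFun :=
    { toFun := fun U => WithLp.toLp 2 (EnergySpace.mk ha V hV U.1.snd U.2.2, divFlux U)
      map_add' := fun U W => by
        rw [divFlux_add]
        rfl
      map_smul' := fun r U => by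
        rw [divFlux_smul]
        rfl }

end

/-! ### Semigroups -/

section

variable {H : Type*} [NormedAddCommGroup H] [InnerProductSpace ℝ H]

/-- `T` is a strongly continuous semigroup of contractions on `H`. -/
structure IsContractionSemigroup (T : ℝ≥0 → H →L[ℝ] H) : Prop where
  zero : T 0 = 1
  add : ∀ s t, T (s + t) = T s * T t
  cont : ∀ x, Continuous fun t => T t x
  contr : ∀ t, ‖T t‖ ≤ 1

/-- `A` is the infinitesimal generator of `T`: `x` is in the domain of `A` and `A x = y` if and
only if `(T(t) x - x) / t` converges to `y` as `t ↓ 0`. -/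
def IsGenerator (A : H →ₗ.[ℝ] H) (T : ℝ≥0 → H →L[ℝ] H) : Prop :=
  ∀ x y : H, (∃ hx : x ∈ A.domain, A ⟨x, hx⟩ = y) ↔
    Tendsto (fun t : ℝ≥0 => (t : ℝ)⁻¹ • (T t x - x)) (𝓝[>] 0) (𝓝 y)

/-- `⟪A x, x⟫ ≤ 0` on the domain of `A`. -/
def Dissipative (A : H →ₗ.[ℝ] H) : Prop :=
  ∀ x : A.domain, inner ℝ (A x) (x : H) ≤ 0

/-- The adjoint of (the densely defined operator) `A` is dissipative: `⟪x, y⟫ ≤ 0` whenever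
`x ∈ D(A*)` and `A* x = y`, that is, `⟪A z, x⟫ = ⟪z, y⟫` for all `z ∈ D(A)`. -/
def AdjointDissipative (A : H →ₗ.[ℝ] H) : Prop :=
  ∀ x y : H, (∀ z : A.domain, inner ℝ (A z) x = inner ℝ (z : H) y) → inner ℝ x y ≤ 0

end

end DegenerateWave

end

open DegenerateWave

/-!
The proof rests on one fact about the spaces and one fact about operators.

The sets `W¹_{a,0}` and `H¹_{a,0}` coincide, so that `V` is both of them. An element `u` of
`W¹_{a,0}` is recovered from `G = √a u_x ∈ L²` as the primitive of `G / √a` that vanishes at `c` and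
at `d` (`biPrimitive`). Since `1 / (√a)'` is bounded, the mean value theorem gives
`a x ≥ κ (x - 1)²` (`IsDegenerateWeight.exists_sq_le`), and Hardy's inequality makes `G ↦ u` a
bounded operator `primitiveL` on `L²`. The functions `G` that occur are exactly those orthogonal to
the space `constFlux` of all `K ∈ L²` with `√a K` constant: under weak degeneration this expresses
`∫ u_x = 0`, under strong degeneration `constFlux` is trivial. By the lemma of du Bois-Reymond,
whatever is orthogonal to `√a φ_x` for all test functions `φ` on `(c,d)` that are constant near `1`
lies in `constFlux`. Hence these `√a φ_x` are dense in `constFluxᗮ` (`orthogonal_constFlux_le`).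
It follows that `V` is isometric to the closed subspace `constFluxᗮ` of `L²`, hence complete, that
it embeds in `L²` by a bounded map `ι`, and that Green's formula `∫ a u_x v_x = -∫ (a u_x)_x v`
holds for all `v ∈ V` without boundary terms (`EnergySpace.inner_eq_neg_inner`).

The wave operator is the inverse of the bounded operator `(f, h) ↦ (-ι* h, ι f)`, which is visibly
skew-symmetric (`waveOperator_eq_iff`). One direction is Green's formula. The other needs that the
transmission conditions hold automatically (`MemW1a0.memDom`): the flux `a u_x ∈ W^{1,2}` is
continuous at `1`; under strong degeneration its value there is `0`, as otherwise
`1/a ≲ (√a u_x)²` would be integrable; a flux vanishing at `1` is `o(|x - 1|^(1/2))`, while `u` is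
`O(|x - 1|^(-1/2))`.

Finally, the inverse of a bounded skew-symmetric operator `B` on a Hilbert space is densely defined
and skew-adjoint, and it generates a contraction semigroup (`generates_of_inverse_skew`). The
semigroup is the limit of the exponentials of the Yosida approximations `(B - ε)⁻¹`.
-/

namespace DegenerateWave

section Abstract

variable {H : Type*} [NormedAddCommGroup H] [InnerProductSpace ℝ H] [CompleteSpace H]

/-! ### Exponentials of bounded dissipative operators -/

theorem hasDerivAt_exp_apply (J : H →L[ℝ] H) (x : H) (t : ℝ) :
    HasDerivAt (fun s : ℝ => NormedSpace.exp (s • J) x) (NormedSpace.exp (t • J) (J x)) t := by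
  have h := hasDerivAt_exp_smul_const (𝕂 := ℝ) J t
  exact ((ContinuousLinearMap.apply ℝ H x).hasFDerivAt.comp_hasDerivAt t h)

omit [CompleteSpace H] in
theorem exp_apply_comm (J K : H →L[ℝ] H) (h : Commute J K) (x : H) (t : ℝ) :
    NormedSpace.exp (t • J) (K x) = K (NormedSpace.exp (t • J) x) := by
  have h1 : Commute (NormedSpace.exp (t • J)) K := (h.smul_left t).exp_left
  exact congrArg (fun L : H →L[ℝ] H => L x) h1.eq

theorem norm_exp_apply_le {J : H →L[ℝ] H} (hJ : ∀ x, inner ℝ (J x) x ≤ 0) {t : ℝ} (ht : 0 ≤ t)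
    (x : H) : ‖NormedSpace.exp (t • J) x‖ ≤ ‖x‖ := by
  have hd : ∀ s, HasDerivAt (fun s : ℝ => ‖NormedSpace.exp (s • J) x‖ ^ 2)
      (2 * inner ℝ (NormedSpace.exp (s • J) x) (NormedSpace.exp (s • J) (J x))) s :=
    fun s => (hasDerivAt_exp_apply J x s).norm_sq
  have hanti : Antitone fun s : ℝ => ‖NormedSpace.exp (s • J) x‖ ^ 2 := by
    apply antitone_of_deriv_nonpos (fun s => (hd s).differentiableAt)
    intro s
    rw [(hd s).deriv, exp_apply_comm J J (Commute.refl J), real_inner_comm]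
    have := hJ (NormedSpace.exp (s • J) x)
    linarith
  have h := hanti ht
  simp only [zero_smul, NormedSpace.exp_zero, one_apply_eq_self] at h
  exact (sq_le_sq₀ (norm_nonneg _) (norm_nonneg _)).1 h

theorem exp_add_apply (J : H →L[ℝ] H) (s t : ℝ) (x : H) :
    NormedSpace.exp ((s + t) • J) x = NormedSpace.exp (s • J) (NormedSpace.exp (t • J) x) := by
  let _ : NormedAlgebra ℚ (H →L[ℝ] H) := NormedAlgebra.restrictScalars ℚ ℝ _
  rw [add_smul, NormedSpace.exp_add_of_commute (((Commute.refl J).smul_left s).smul_right t)]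
  rfl

theorem norm_exp_apply_sub_self_le {J : H →L[ℝ] H} (hJ : ∀ x, inner ℝ (J x) x ≤ 0) {t : ℝ}
    (ht : 0 ≤ t) (x : H) : ‖NormedSpace.exp (t • J) x - x‖ ≤ t * ‖J x‖ := by
  have h := norm_image_sub_le_of_norm_deriv_le_segment' (a := 0) (b := t) (C := ‖J x‖)
    (f := fun s : ℝ => NormedSpace.exp (s • J) x)
    (f' := fun s => NormedSpace.exp (s • J) (J x))
    (fun s _ => (hasDerivAt_exp_apply J x s).hasDerivWithinAt)
    (fun s hs => norm_exp_apply_le hJ hs.1 _) t (right_mem_Icc.2 ht)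
  simpa [mul_comm] using h

/-- The exponentials of two commuting dissipative operators differ on `x` by at most
`t ‖J x - K x‖`. -/
theorem norm_exp_apply_sub_exp_apply_le {J K : H →L[ℝ] H} (hJ : ∀ x, inner ℝ (J x) x ≤ 0)
    (hK : ∀ x, inner ℝ (K x) x ≤ 0) (hJK : Commute J K) {t : ℝ} (ht : 0 ≤ t) (x : H) :
    ‖NormedSpace.exp (t • J) x - NormedSpace.exp (t • K) x‖ ≤ t * ‖J x - K x‖ := by
  -- differentiate the path `s ↦ exp ((t - s) K) exp (s J) x` from `exp (t K) x` to `exp (t J) x`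
  have hd : ∀ s, HasDerivAt
      (fun s : ℝ => NormedSpace.exp ((t - s) • K) (NormedSpace.exp (s • J) x))
      (NormedSpace.exp ((t - s) • K) (NormedSpace.exp (s • J) (J x - K x))) s := by
    intro s
    have h1 : HasDerivAt (fun s : ℝ => NormedSpace.exp ((t - s) • K))
        (-(NormedSpace.exp ((t - s) • K) * K)) s := by
      have := (hasDerivAt_exp_smul_const (𝕂 := ℝ) K (t - s)).scomp s
        ((hasDerivAt_id s).const_sub t)
      simpa [Function.comp_def] using this
    have h2 := h1.clm_apply (hasDerivAt_exp_apply J x s)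
    convert h2 using 1
    have e := exp_apply_comm J K hJK x s
    simp only [neg_apply, mul_apply_eq_comp, map_sub, e]
    abel
  have h := norm_image_sub_le_of_norm_deriv_le_segment' (a := 0) (b := t) (C := ‖J x - K x‖)
    (fun s _ => (hd s).hasDerivWithinAt)
    (fun s hs => (norm_exp_apply_le hK (sub_nonneg.2 hs.2.le) _).trans
      (norm_exp_apply_le hJ hs.1 _)) t (right_mem_Icc.2 ht)
  simpa [mul_comm] using h

/-! ### Limits of exponentials -/

/-- If the commuting bounded dissipative operators `J n` converge pointwise on a dense set, then
their exponentials converge pointwise to a contraction semigroup. -/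
theorem exists_limit_semigroup {J : ℕ → H →L[ℝ] H} (hJ : ∀ n x, inner ℝ (J n x) x ≤ 0)
    (hcomm : ∀ m n, Commute (J m) (J n)) {D : Set H} (hD : Dense D)
    (hlim : ∀ x ∈ D, ∃ z, Tendsto (fun n => J n x) atTop (𝓝 z)) :
    ∃ T : ℝ≥0 → H →L[ℝ] H, IsContractionSemigroup T ∧
      ∀ (t : ℝ≥0) x, Tendsto (fun n => NormedSpace.exp ((t : ℝ) • J n) x) atTop (𝓝 (T t x)) := by
  have hcauchy : ∀ (t : ℝ≥0) x, CauchySeq fun n => NormedSpace.exp ((t : ℝ) • J n) x := by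
    intro t x
    rw [Metric.cauchySeq_iff]
    intro ε hε
    obtain ⟨y, hy, hxy⟩ := hD.exists_dist_lt x (show 0 < ε / 3 by positivity)
    obtain ⟨z, hz⟩ := hlim y hy
    obtain ⟨N, hN⟩ := Metric.cauchySeq_iff.1 hz.cauchySeq (ε / 3 / (t + 1)) (by positivity)
    refine ⟨N, fun m hm n hn => ?_⟩
    have h1 := norm_exp_apply_sub_exp_apply_le (hJ m) (hJ n) (hcomm m n) t.coe_nonneg y
    have h2 : ‖J m y - J n y‖ < ε / 3 / (t + 1) := by simpa [dist_eq_norm] using hN m hm n hn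
    have h3 : (t : ℝ) * ‖J m y - J n y‖ ≤ ε / 3 := by
      have h4 : (t : ℝ) * ‖J m y - J n y‖ ≤ (t + 1) * (ε / 3 / (t + 1)) :=
        mul_le_mul (by linarith) h2.le (norm_nonneg _) (by positivity)
      rwa [mul_div_cancel₀ _ (by positivity)] at h4
    have h5 := norm_exp_apply_le (hJ m) t.coe_nonneg (x - y)
    have h6 := norm_exp_apply_le (hJ n) t.coe_nonneg (x - y)
    rw [map_sub] at h5 h6
    rw [dist_eq_norm] at hxy ⊢
    calc ‖NormedSpace.exp ((t : ℝ) • J m) x - NormedSpace.exp ((t : ℝ) • J n) x‖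
        = ‖(NormedSpace.exp ((t : ℝ) • J m) x - NormedSpace.exp ((t : ℝ) • J m) y)
          + (NormedSpace.exp ((t : ℝ) • J m) y - NormedSpace.exp ((t : ℝ) • J n) y)
          - (NormedSpace.exp ((t : ℝ) • J n) x - NormedSpace.exp ((t : ℝ) • J n) y)‖ := by
          congr 1; abel
      _ ≤ _ := norm_sub_le _ _
      _ ≤ _ := add_le_add (norm_add_le _ _) le_rfl
      _ < ε := by linarith
  choose T0 hT0 using fun t x => cauchySeq_tendsto_of_complete (hcauchy t x)
  have hnorm : ∀ t x, ‖T0 t x‖ ≤ ‖x‖ := fun t x =>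
    le_of_tendsto (hT0 t x).norm (Eventually.of_forall fun n =>
      norm_exp_apply_le (hJ n) t.coe_nonneg x)
  let T : ℝ≥0 → H →L[ℝ] H := fun t => LinearMap.mkContinuous
    { toFun := T0 t
      map_add' := fun x y => tendsto_nhds_unique (hT0 t (x + y))
        (((hT0 t x).add (hT0 t y)).congr fun n => by rw [map_add])
      map_smul' := fun r x => tendsto_nhds_unique (hT0 t (r • x))
        (((hT0 t x).const_smul r).congr fun n => by rw [map_smul]) } 1
      fun x => by simpa using hnorm t x
  have hT : ∀ (t : ℝ≥0) x, Tendsto (fun n => NormedSpace.exp ((t : ℝ) • J n) x) atTop (𝓝 (T t x)) :=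
    hT0
  have hTn : ∀ t x, ‖T t x‖ ≤ ‖x‖ := hnorm
  have hadd : ∀ s t x, T (s + t) x = T s (T t x) := by
    intro s t x
    refine tendsto_nhds_unique (hT (s + t) x) ?_
    -- `exp (s J n)` is contractive, so it may be applied to a convergent sequence
    have h0 : Tendsto (fun n => NormedSpace.exp ((s : ℝ) • J n)
        (NormedSpace.exp ((t : ℝ) • J n) x - T t x)) atTop (𝓝 0) := by
      refine squeeze_zero_norm (fun n => norm_exp_apply_le (hJ n) s.coe_nonneg _) ?_
      simpa using ((hT t x).sub_const (T t x)).norm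
    have h1 := h0.add (hT s (T t x))
    rw [zero_add] at h1
    refine h1.congr fun n => ?_
    rw [map_sub, sub_add_cancel, NNReal.coe_add, exp_add_apply]
  refine ⟨T, ⟨?_, fun s t => ContinuousLinearMap.ext (hadd s t), fun x => ?_, fun t =>
    ContinuousLinearMap.opNorm_le_bound _ zero_le_one fun x => by simpa using hTn t x⟩, hT⟩
  · ext x
    refine tendsto_nhds_unique (hT 0 x) ?_
    simp
  · -- right increments control all increments, because `T s` is a contraction
    have hincr : ∀ s t : ℝ≥0, s ≤ t → ∀ x, ‖T t x - T s x‖ ≤ ‖T (t - s) x - x‖ := by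
      intro s t hst x
      rw [← add_tsub_cancel_of_le hst, hadd, ← map_sub, add_tsub_cancel_left]
      exact hTn _ _
    have hlip : ∀ y ∈ D, ∃ K : ℝ≥0, ∀ s t, dist (T s y) (T t y) ≤ K * dist s t := by
      intro y hy
      obtain ⟨z, hz⟩ := hlim y hy
      have h1 : ∀ t : ℝ≥0, ‖T t y - y‖ ≤ t * ‖z‖ := fun t =>
        le_of_tendsto_of_tendsto ((hT t y).sub_const y).norm (hz.norm.const_mul _)
          (Eventually.of_forall fun n => norm_exp_apply_sub_self_le (hJ n) t.coe_nonneg y)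
      have h2 : ∀ s t : ℝ≥0, s ≤ t → dist (T s y) (T t y) ≤ ‖z‖₊ * dist s t := by
        intro s t hst
        rw [dist_comm, dist_eq_norm, dist_comm, NNReal.dist_eq,
          abs_of_nonneg (sub_nonneg.2 (NNReal.coe_le_coe.2 hst))]
        refine ((hincr s t hst y).trans (h1 _)).trans (le_of_eq ?_)
        rw [NNReal.coe_sub hst, mul_comm, coe_nnnorm]
      refine ⟨‖z‖₊, fun s t => ?_⟩
      rcases le_total s t with h | h
      · exact h2 s t h
      · rw [dist_comm, dist_comm s]
        exact h2 t s h
    refine continuous_of_uniform_approx_of_continuous (f := fun t => T t x) fun u hu => ?_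
    obtain ⟨ε, hε, hu⟩ := Metric.mem_uniformity_dist.1 hu
    obtain ⟨y, hy, hxy⟩ := hD.exists_dist_lt x hε
    obtain ⟨K, hK⟩ := hlip y hy
    refine ⟨fun t => T t y, (LipschitzWith.of_dist_le_mul hK).continuous, fun t => hu ?_⟩
    rw [dist_eq_norm, ← map_sub]
    exact (hTn t _).trans_lt (by rwa [dist_eq_norm] at hxy)

/-- If `J n x → z`, then the limit semigroup of `exp (t J n)` has the right derivative `z` at `0`
along the orbit of `x`. -/
theorem tendsto_slope_limit_semigroup {J : ℕ → H →L[ℝ] H} (hJ : ∀ n x, inner ℝ (J n x) x ≤ 0)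
    {D : Set H} (hD : Dense D) (hconv : ∀ x ∈ D, ∃ z, Tendsto (fun n => J n x) atTop (𝓝 z))
    {T : ℝ≥0 → H →L[ℝ] H}
    (hlim : ∀ (t : ℝ≥0) x, Tendsto (fun n => NormedSpace.exp ((t : ℝ) • J n) x) atTop (𝓝 (T t x)))
    {x z : H} (hx : Tendsto (fun n => J n x) atTop (𝓝 z)) :
    Tendsto (fun t : ℝ≥0 => (t : ℝ)⁻¹ • (T t x - x)) (𝓝[>] 0) (𝓝 z) := by
  have key : ∀ ε > 0, ∃ δ : ℝ, 0 < δ ∧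
      ∀ t : ℝ≥0, (t : ℝ) < δ → ‖T t x - x - (t : ℝ) • z‖ ≤ t * ε := by
    intro ε hε
    obtain ⟨y, hy, hzy⟩ := hD.exists_dist_lt z (show 0 < ε / 4 by positivity)
    obtain ⟨w, hw⟩ := hconv y hy
    refine ⟨ε / 2 / (‖w‖ + 1), by positivity, fun t ht => ?_⟩
    have h1 : ∀ n, ‖NormedSpace.exp ((t : ℝ) • J n) x - x - (t : ℝ) • z‖ ≤
        t * (‖J n x - z‖ + 2 * ‖z - y‖ + t * ‖J n y‖) := by
      intro n
      have hd : ∀ s : ℝ, HasDerivAt (fun s : ℝ => NormedSpace.exp (s • J n) x - x - s • z)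
          (NormedSpace.exp (s • J n) (J n x) - z) s := by
        intro s
        have := ((hasDerivAt_exp_apply (J n) x s).sub_const x).sub
          ((hasDerivAt_id s).smul_const z)
        rw [one_smul] at this
        exact this
      have h := norm_image_sub_le_of_norm_deriv_le_segment' (a := 0) (b := (t : ℝ))
        (C := ‖J n x - z‖ + 2 * ‖z - y‖ + t * ‖J n y‖)
        (fun s _ => (hd s).hasDerivWithinAt) (fun s hs => ?_) t (right_mem_Icc.2 t.coe_nonneg)
      · simpa [mul_comm] using h
      · have e1 := norm_exp_apply_le (hJ n) hs.1 (J n x - z)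
        have e2 := norm_exp_apply_le (hJ n) hs.1 (z - y)
        have e3 := norm_exp_apply_sub_self_le (hJ n) hs.1 y
        have e4 : s * ‖J n y‖ ≤ t * ‖J n y‖ :=
          mul_le_mul_of_nonneg_right hs.2.le (norm_nonneg _)
        have e5 : NormedSpace.exp (s • J n) (J n x) - z = NormedSpace.exp (s • J n) (J n x - z)
            + NormedSpace.exp (s • J n) (z - y) + (NormedSpace.exp (s • J n) y - y)
            - (z - y) := by
          simp only [map_sub]; abel
        rw [e5]
        refine (norm_sub_le _ _).trans ?_
        have e6 := norm_add₃_le (a := NormedSpace.exp (s • J n) (J n x - z))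
          (b := NormedSpace.exp (s • J n) (z - y)) (c := NormedSpace.exp (s • J n) y - y)
        linarith
    have h2 : ‖T t x - x - (t : ℝ) • z‖ ≤ t * (0 + 2 * ‖z - y‖ + t * ‖w‖) := by
      refine le_of_tendsto_of_tendsto (((hlim t x).sub_const x).sub_const _).norm ?_
        (Eventually.of_forall h1)
      have h3 := (hx.sub_const z).norm
      rw [sub_self, norm_zero] at h3
      exact ((h3.add_const _).add (hw.norm.const_mul _)).const_mul _
    refine h2.trans (mul_le_mul_of_nonneg_left ?_ t.coe_nonneg)
    rw [dist_eq_norm] at hzy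
    rw [lt_div_iff₀ (by positivity)] at ht
    nlinarith [norm_nonneg w, t.coe_nonneg]
  rw [Metric.tendsto_nhdsWithin_nhds]
  intro ε hε
  obtain ⟨δ, hδ, h⟩ := key (ε / 2) (by positivity)
  refine ⟨δ, hδ, fun t ht htδ => ?_⟩
  have ht' : (0 : ℝ) < t := NNReal.coe_pos.2 ht
  have h1 := h t (by rwa [NNReal.dist_eq, NNReal.coe_zero, sub_zero, abs_of_pos ht'] at htδ)
  rw [dist_eq_norm]
  have e : (t : ℝ)⁻¹ • (T t x - x) - z = (t : ℝ)⁻¹ • (T t x - x - (t : ℝ) • z) := by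
    rw [smul_sub _ (T t x - x), smul_smul, inv_mul_cancel₀ ht'.ne', one_smul]
  rw [e, norm_smul, norm_inv, Real.norm_of_nonneg ht'.le, inv_mul_lt_iff₀ ht']
  exact h1.trans_lt (by nlinarith)

/-! ### Generation by the inverse of a bounded skew-symmetric operator -/

variable {B : H →L[ℝ] H}

omit [CompleteSpace H] in
theorem inner_apply_self_of_skew (hB : ∀ x y, inner ℝ (B x) y = -inner ℝ x (B y)) (x : H) :
    inner ℝ (B x) x = 0 := by
  have := hB x x
  rw [real_inner_comm (B x) x] at this
  linarith

/-- For skew-symmetric `B` and `ε > 0` the operator `B - ε` is invertible (Lax-Milgram). -/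
theorem exists_inverse_sub_smul (hB : ∀ x y, inner ℝ (B x) y = -inner ℝ x (B y)) {ε : ℝ}
    (hε : 0 < ε) : ∃ J : H →L[ℝ] H, (∀ x, B (J x) - ε • J x = x) ∧ ∀ x, J (B x - ε • x) = x := by
  let L : H →L[ℝ] H := ε • 1 - B
  let b : H →L[ℝ] H →L[ℝ] ℝ := (innerSL ℝ).comp L
  have hb : IsCoercive b := by
    refine ⟨ε, hε, fun u => ?_⟩
    have : b u u = inner ℝ (ε • u - B u) u := rfl
    rw [this, inner_sub_left, inner_apply_self_of_skew hB, inner_smul_left,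
      real_inner_self_eq_norm_sq]
    simp only [conj_trivial, sub_zero]
    exact le_of_eq (by ring)
  let e := hb.continuousLinearEquivOfBilin
  have he : ∀ x, e x = ε • x - B x := fun x => by
    refine ext_inner_right ℝ fun w => ?_
    exact hb.continuousLinearEquivOfBilin_apply x w
  refine ⟨-(e.symm : H →L[ℝ] H), fun x => ?_, fun x => ?_⟩
  · have := he (e.symm x)
    rw [ContinuousLinearEquiv.apply_symm_apply] at this
    simp only [neg_apply, ContinuousLinearEquiv.coe_coe, map_neg, smul_neg]
    rw [sub_neg_eq_add, neg_add_eq_sub]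
    exact this.symm
  · have := he x
    simp only [neg_apply, ContinuousLinearEquiv.coe_coe]
    rw [← map_neg, neg_sub, ← this, ContinuousLinearEquiv.symm_apply_apply]

/-- The inverse `A` of a bounded skew-symmetric operator `B` generates a contraction semigroup, the
limit of the exponentials of the Yosida approximations `J ε = (B - ε)⁻¹` as `ε → 0`. -/
theorem exists_semigroup_of_skew (hB : ∀ x y, inner ℝ (B x) y = -inner ℝ x (B y))
    (hrange : DenseRange B) (A : H →ₗ.[ℝ] H)
    (hA : ∀ x y, (∃ hx : x ∈ A.domain, A ⟨x, hx⟩ = y) ↔ B y = x) :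
    ∃ T : ℝ≥0 → H →L[ℝ] H, IsContractionSemigroup T ∧ IsGenerator A T := by
  choose! J hJ1 hJ2 using fun (ε : ℝ) (hε : 0 < ε) => exists_inverse_sub_smul hB hε
  have hJi : ∀ ε > 0, ∀ x, inner ℝ (J ε x) x = -(ε * ‖J ε x‖ ^ 2) := by
    intro ε hε x
    have h := inner_apply_self_of_skew hB (J ε x)
    rw [real_inner_comm] at h
    calc inner ℝ (J ε x) x = inner ℝ (J ε x) (B (J ε x) - ε • J ε x) := by rw [hJ1 ε hε x]
      _ = _ := by
        rw [inner_sub_right, h, inner_smul_right, real_inner_self_eq_norm_sq, zero_sub]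
  have hJn : ∀ ε > 0, ∀ x, ε * ‖J ε x‖ ≤ ‖x‖ := by
    intro ε hε x
    have h1 := hJi ε hε x
    have h2 := abs_real_inner_le_norm (J ε x) x
    rw [h1, abs_neg, abs_of_nonneg (by positivity)] at h2
    rcases (norm_nonneg (J ε x)).eq_or_lt with h | h
    · rw [← h]; simp
    · nlinarith
  have hJd : ∀ ε > 0, ∀ x, inner ℝ (J ε x) x ≤ 0 := fun ε hε x => by
    rw [hJi ε hε x, neg_nonpos]; positivity
  have hJB : ∀ ε > 0, ∀ z, J ε (B z) = z + ε • J ε z := by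
    intro ε hε z
    have := hJ2 ε hε z
    rw [map_sub, map_smul] at this
    rwa [sub_eq_iff_eq_add] at this
  have hJB' : ∀ ε > 0, ∀ z, J ε (B z) = B (J ε z) := fun ε hε z => by
    rw [hJB ε hε, ← sub_eq_iff_eq_add.1 (hJ1 ε hε z)]
  have hJc : ∀ ε > 0, ∀ δ > 0, Commute (J ε) (J δ) := by
    intro ε hε δ hδ
    ext x
    change J ε (J δ x) = J δ (J ε x)
    conv_rhs => rw [← hJ1 δ hδ x, map_sub, map_smul, hJB' ε hε, hJ2 δ hδ]
  let e : ℕ → ℝ := fun n => 1 / ((n : ℝ) + 1)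
  have he : ∀ n, 0 < e n := fun n => Nat.one_div_pos_of_nat
  have he0 : Tendsto e atTop (𝓝 0) := tendsto_one_div_add_atTop_nhds_zero_nat
  have hlim : ∀ z, Tendsto (fun n => J (e n) (B z)) atTop (𝓝 z) := by
    intro z
    rw [Metric.tendsto_atTop]
    intro η hη
    obtain ⟨y, hy⟩ := hrange.exists_dist_lt z (show 0 < η / 2 by positivity)
    have h0 : Tendsto (fun n => e n * (2 * ‖y‖)) atTop (𝓝 0) := by
      simpa using he0.mul_const (2 * ‖y‖)
    obtain ⟨N, hN⟩ := eventually_atTop.1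
      (h0.eventually (gt_mem_nhds (show 0 < η / 2 by positivity)))
    refine ⟨N, fun n hn => ?_⟩
    have h1 : ‖J (e n) (B y)‖ ≤ 2 * ‖y‖ := by
      rw [hJB _ (he n)]
      refine (norm_add_le _ _).trans ?_
      rw [norm_smul, Real.norm_of_nonneg (he n).le]
      linarith [hJn _ (he n) y]
    have h2 : J (e n) (B z) - z = e n • J (e n) (z - B y) + e n • J (e n) (B y) := by
      rw [hJB _ (he n), add_sub_cancel_left, ← smul_add, ← map_add, sub_add_cancel]
    have h3 := hJn _ (he n) (z - B y)
    have h4 := mul_le_mul_of_nonneg_left h1 (he n).le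
    rw [dist_eq_norm] at hy ⊢
    rw [h2]
    refine (norm_add_le _ _).trans_lt ?_
    rw [norm_smul, norm_smul, Real.norm_of_nonneg (he n).le]
    linarith [hN n hn]
  have hconv : ∀ x ∈ range B, ∃ z, Tendsto (fun n => J (e n) x) atTop (𝓝 z) := by
    rintro _ ⟨z, rfl⟩
    exact ⟨z, hlim z⟩
  obtain ⟨T, hT, hTl⟩ := exists_limit_semigroup (J := fun n => J (e n))
    (fun n x => hJd _ (he n) x) (fun m n => hJc _ (he m) _ (he n)) hrange hconv
  have hgen : ∀ z, Tendsto (fun t : ℝ≥0 => (t : ℝ)⁻¹ • (T t (B z) - B z)) (𝓝[>] 0) (𝓝 z) :=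
    fun z => tendsto_slope_limit_semigroup (fun n x => hJd _ (he n) x) hrange hconv hTl (hlim z)
  refine ⟨T, hT, fun x y => ?_⟩
  rw [hA]
  constructor
  · rintro rfl
    exact hgen y
  · intro h
    -- compare `x` with the solution `B z` of `B z - z = x - y`
    set z := J 1 (x - y) with hz
    have h1 : B z - z = x - y := by
      have := hJ1 1 one_pos (x - y)
      rwa [one_smul] at this
    have h2 : Tendsto (fun t : ℝ≥0 => (t : ℝ)⁻¹ • (T t (x - B z) - (x - B z))) (𝓝[>] 0)
        (𝓝 (y - z)) := by
      refine (h.sub (hgen z)).congr fun t => ?_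
      rw [← smul_sub, map_sub]
      congr 1; abel
    have h3 : y - z = x - B z := by
      rw [sub_eq_sub_iff_add_eq_add] at h1 ⊢
      rw [add_comm, h1]
    have h4 : inner ℝ (y - z) (x - B z) ≤ 0 := by
      refine le_of_tendsto (h2.inner tendsto_const_nhds) (Eventually.of_forall fun t => ?_)
      rw [inner_smul_left, inner_sub_left, real_inner_self_eq_norm_sq]
      have h5 := real_inner_le_norm (T t (x - B z)) (x - B z)
      have h6 := (T t).le_of_opNorm_le (hT.contr t) (x - B z)
      refine mul_nonpos_of_nonneg_of_nonpos (by simp) ?_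
      nlinarith [norm_nonneg (x - B z)]
    rw [h3, real_inner_self_nonpos] at h4
    rw [h4, sub_eq_zero] at h3
    rw [sub_eq_zero] at h4
    rw [h3, h4]

theorem denseRange_of_skew (hB : ∀ x y, inner ℝ (B x) y = -inner ℝ x (B y))
    (hinj : ∀ x, B x = 0 → x = 0) : DenseRange B := by
  have h : (LinearMap.range (B : H →ₗ[ℝ] H)).topologicalClosure = ⊤ := by
    rw [Submodule.topologicalClosure_eq_top_iff, Submodule.eq_bot_iff]
    intro y hy
    refine hinj y (ext_inner_left ℝ fun x => ?_)
    have := hy (B x) ⟨x, rfl⟩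
    rw [hB, neg_eq_zero] at this
    rw [this, inner_zero_right]
  have h2 := Submodule.dense_iff_topologicalClosure_eq_top.2 h
  rwa [LinearMap.coe_range] at h2

/-- The inverse of a bounded skew-symmetric operator is densely defined and, like its adjoint,
dissipative, and it generates a contraction semigroup. -/
theorem generates_of_inverse_skew (hB : ∀ x y, inner ℝ (B x) y = -inner ℝ x (B y))
    (A : H →ₗ.[ℝ] H) (hA : ∀ x y, (∃ hx : x ∈ A.domain, A ⟨x, hx⟩ = y) ↔ B y = x) :
    Dense (A.domain : Set H) ∧ Dissipative A ∧ AdjointDissipative A ∧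
      ∃ T : ℝ≥0 → H →L[ℝ] H, IsContractionSemigroup T ∧ IsGenerator A T := by
  have hinj : ∀ y, B y = 0 → y = 0 := by
    intro y hy
    obtain ⟨hx, h⟩ := (hA 0 y).2 hy
    rw [← h]
    exact map_zero A.toFun
  have hrange := denseRange_of_skew hB hinj
  have hdom : ∀ z, ∃ h : B z ∈ A.domain, A ⟨B z, h⟩ = z := fun z => (hA (B z) z).2 rfl
  refine ⟨hrange.mono ?_, fun x => ?_, fun x y h => ?_, exists_semigroup_of_skew hB hrange A hA⟩
  · rintro _ ⟨z, rfl⟩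
    exact (hdom z).1
  · have h := (hA x (A x)).1 ⟨x.2, rfl⟩
    conv_lhs => rw [← h]
    rw [real_inner_comm, inner_apply_self_of_skew hB]
  · -- testing with `z = B w` shows that `x = -B y`
    have hx : x = -B y := by
      refine ext_inner_left ℝ fun w => ?_
      obtain ⟨hw, e⟩ := hdom w
      have := h ⟨B w, hw⟩
      rw [e] at this
      rw [this, inner_neg_right]
      exact hB w y
    rw [hx, inner_neg_left, inner_apply_self_of_skew hB, neg_zero]

end Abstract

/-! ### Primitives and weak derivatives on intervals -/

theorem integral_primitive_mul_deriv {p q e : ℝ} (he : e ∈ uIcc p q) {g φ : ℝ → ℝ}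
    (hg : IntervalIntegrable g volume p q) (hφ : ContDiff ℝ 1 φ) :
    ∫ x in p..q, (∫ t in e..x, g t) * deriv φ x =
      (∫ t in e..q, g t) * φ q - (∫ t in e..p, g t) * φ p - ∫ x in p..q, g x * φ x := by
  rw [(hg.absolutelyContinuousOnInterval_intervalIntegral he).integral_mul_deriv_eq_deriv_mul
    (hφ.contDiffOn.absolutelyContinuousOnInterval)]
  congr 1
  refine intervalIntegral.integral_congr_ae ?_
  filter_upwards [hg.ae_hasDerivAt_integral] with x hx hx'
  rw [(hx (uIoc_subset_uIcc hx') e he).deriv]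

theorem setIntegral_Ioo_eq_intervalIntegral {p q : ℝ} (hpq : p ≤ q) (f : ℝ → ℝ) :
    ∫ x in Ioo p q, f x = ∫ x in p..q, f x := by
  rw [intervalIntegral.integral_of_le hpq, integral_Ioc_eq_integral_Ioo]

theorem intervalIntegrable_iff_Ioo {p q : ℝ} (hpq : p ≤ q) {g : ℝ → ℝ} :
    IntervalIntegrable g volume p q ↔ IntegrableOn g (Ioo p q) := by
  rw [intervalIntegrable_iff_integrableOn_Ioo_of_le hpq]

theorem continuousOn_primitive_Icc {p q e : ℝ} (he : e ∈ Icc p q) {g : ℝ → ℝ}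
    (hg : IntervalIntegrable g volume p q) :
    ContinuousOn (fun x => ∫ t in e..x, g t) (Icc p q) := by
  have hpq : p ≤ q := he.1.trans he.2
  have := (hg.absolutelyContinuousOnInterval_intervalIntegral
    (by rwa [uIcc_of_le hpq])).continuousOn
  rwa [uIcc_of_le hpq] at this

theorem test_eq_zero {U : Set ℝ} {φ : ℝ → ℝ} (h : tsupport φ ⊆ U) {x : ℝ} (hx : x ∉ U) : φ x = 0 :=
  image_eq_zero_of_notMem_tsupport fun hh => hx (h hh)

theorem hasWeakDerivOn_primitive {p q e : ℝ} (hpq : p < q) (he : e ∈ Icc p q) {g : ℝ → ℝ}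
    (hg : IntervalIntegrable g volume p q) :
    HasWeakDerivOn (Ioo p q) (fun x => ∫ t in e..x, g t) g where
  locInt := ((continuousOn_primitive_Icc he hg).mono Ioo_subset_Icc_self).locallyIntegrableOn
    measurableSet_Ioo
  locInt_deriv := ((intervalIntegrable_iff_Ioo hpq.le).1 hg).locallyIntegrableOn
  integral_eq φ h1 h2 h3 := by
    rw [setIntegral_Ioo_eq_intervalIntegral hpq.le, setIntegral_Ioo_eq_intervalIntegral hpq.le,
      integral_primitive_mul_deriv (by rwa [uIcc_of_le hpq.le]) hg (h1.of_le (by simp)),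
      test_eq_zero h3 right_notMem_Ioo, test_eq_zero h3 left_notMem_Ioo]
    simp

theorem HasWeakDerivOn.sub {U : Set ℝ} {u v g h : ℝ → ℝ}
    (hu : HasWeakDerivOn U u g) (hv : HasWeakDerivOn U v h) :
    HasWeakDerivOn U (u - v) (g - h) := by
  simpa [sub_eq_add_neg] using hu.add (hv.smul (-1))

/-- A function with an integrable weak derivative is, up to a constant, a primitive of it. -/
theorem HasWeakDerivOn.exists_ae_eq_primitive {p q : ℝ} (hpq : p < q) {u g : ℝ → ℝ}
    (hu : HasWeakDerivOn (Ioo p q) u g) (hg : IntervalIntegrable g volume p q) :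
    ∃ C : ℝ, u =ᵐ[volume.restrict (Ioo p q)] fun x => C + ∫ t in p..x, g t := by
  obtain ⟨C, hC⟩ := (hu.sub (hasWeakDerivOn_primitive hpq (left_mem_Icc.2 hpq.le) hg)).ae_const hpq
    (by rw [sub_self])
  refine ⟨C, ?_⟩
  filter_upwards [hC] with x hx
  simp only [Pi.sub_apply] at hx
  linarith

theorem eqOn_Icc_of_ae_eq_Ioo {p q : ℝ} (hpq : p < q) {f h : ℝ → ℝ}
    (hfh : f =ᵐ[volume.restrict (Ioo p q)] h) (hf : ContinuousOn f (Icc p q))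
    (hh : ContinuousOn h (Icc p q)) : EqOn f h (Icc p q) := by
  refine Measure.eqOn_Icc_of_ae_eq (μ := volume) hpq.ne ?_ hf hh
  rwa [Measure.restrict_congr_set (Ioo_ae_eq_Icc (μ := volume)).symm]

theorem HasWeakDerivOn.eq_add_primitive {p q : ℝ} (hpq : p < q) {u g f : ℝ → ℝ}
    (hu : HasWeakDerivOn (Ioo p q) u g) (hg : IntervalIntegrable g volume p q)
    (hf : f =ᵐ[volume.restrict (Ioo p q)] u) (hfc : ContinuousOn f (Icc p q)) :
    ∀ x ∈ Icc p q, f x = f p + ∫ t in p..x, g t := by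
  obtain ⟨C, hC⟩ := hu.exists_ae_eq_primitive hpq hg
  have h := eqOn_Icc_of_ae_eq_Ioo hpq (hf.trans hC) hfc
    (continuousOn_const.add (continuousOn_primitive_Icc (left_mem_Icc.2 hpq.le) hg))
  intro x hx
  rw [h hx, h (left_mem_Icc.2 hpq.le)]
  simp

/-! ### The primitive vanishing at both ends of the punctured interval -/

/-- The primitive of `g` on `[c,1) ∪ (1,d]` that vanishes at `c` and at `d`. -/
noncomputable def biPrimitive (c d : ℝ) (g : ℝ → ℝ) (x : ℝ) : ℝ :=
  if x < 1 then ∫ t in c..x, g t else ∫ t in d..x, g t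

/-- `g` is integrable up to the endpoints `c` and `d`, away from `1`. -/
structure IntegrableAwayFromOne (c d : ℝ) (g : ℝ → ℝ) : Prop where
  left : ∀ r ∈ Ico c 1, IntervalIntegrable g volume c r
  right : ∀ s ∈ Ioc 1 d, IntervalIntegrable g volume s d

section

variable {c d : ℝ} {g : ℝ → ℝ}

theorem biPrimitive_of_lt {x : ℝ} (hx : x < 1) : biPrimitive c d g x = ∫ t in c..x, g t :=
  if_pos hx

theorem biPrimitive_of_ge {x : ℝ} (hx : 1 ≤ x) : biPrimitive c d g x = ∫ t in d..x, g t :=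
  if_neg (not_lt.2 hx)

theorem biPrimitive_left (hc : c < 1) : biPrimitive c d g c = 0 := by
  rw [biPrimitive_of_lt hc, intervalIntegral.integral_same]

theorem biPrimitive_right (hd : 1 < d) : biPrimitive c d g d = 0 := by
  rw [biPrimitive_of_ge hd.le, intervalIntegral.integral_same]

/-- If the integral of `g` vanishes, then `biPrimitive c d g` is the primitive from `c` on. -/
theorem biPrimitive_eq_of_integral_eq_zero (hc : c < 1) (hd : 1 < d)
    (hg : IntervalIntegrable g volume c d) (h0 : ∫ t in c..d, g t = 0) {x : ℝ} (hx : x ∈ Icc c d) :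
    biPrimitive c d g x = ∫ t in c..x, g t := by
  rcases lt_or_ge x 1 with h | h
  · exact biPrimitive_of_lt h
  · have hcd : c ≤ d := (hc.trans hd).le
    have h1 : IntervalIntegrable g volume c x := hg.mono_set (by
      rw [uIcc_of_le hcd, uIcc_of_le hx.1]; exact Icc_subset_Icc_right hx.2)
    have h2 : IntervalIntegrable g volume d x := (hg.mono_set (by
      rw [uIcc_of_le hcd, uIcc_of_ge hx.2]; exact Icc_subset_Icc_left hx.1))
    rw [biPrimitive_of_ge h, ← intervalIntegral.integral_add_adjacent_intervals hg h2, h0, zero_add]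

theorem continuousOn_biPrimitive (hg : IntegrableAwayFromOne c d g) :
    ContinuousOn (biPrimitive c d g) (Icc c d \ {1}) := by
  intro x hx
  rcases lt_or_gt_of_ne (show x ≠ 1 from hx.2) with h | h
  · obtain ⟨r, hxr, hr⟩ := exists_between h
    have h1 := continuousOn_primitive_Icc (left_mem_Icc.2 (hx.1.1.trans hxr.le))
      (hg.left r ⟨hx.1.1.trans hxr.le, hr⟩) x ⟨hx.1.1, hxr.le⟩
    have h2 : ContinuousWithinAt (biPrimitive c d g) (Icc c r) x := h1.congr
      (fun y hy => biPrimitive_of_lt (hy.2.trans_lt hr)) (biPrimitive_of_lt h)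
    refine h2.mono_of_mem_nhdsWithin ?_
    filter_upwards [self_mem_nhdsWithin, mem_nhdsWithin_of_mem_nhds (Iio_mem_nhds hxr)] with y h3 h4
    exact ⟨h3.1.1, h4.le⟩
  · obtain ⟨s, hs, hsx⟩ := exists_between h
    have h1 := continuousOn_primitive_Icc (right_mem_Icc.2 (hsx.le.trans hx.1.2))
      (hg.right s ⟨hs, hsx.le.trans hx.1.2⟩) x ⟨hsx.le, hx.1.2⟩
    have h2 : ContinuousWithinAt (biPrimitive c d g) (Icc s d) x := h1.congr
      (fun y hy => biPrimitive_of_ge (hs.trans_le hy.1).le) (biPrimitive_of_ge h.le)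
    refine h2.mono_of_mem_nhdsWithin ?_
    filter_upwards [self_mem_nhdsWithin, mem_nhdsWithin_of_mem_nhds (Ioi_mem_nhds hsx)] with y h3 h4
    exact ⟨h4.le, h3.1.2⟩

theorem locallyIntegrableOn_punctured (hg : IntegrableAwayFromOne c d g) :
    LocallyIntegrableOn g (punctured c d) := by
  intro x hx
  rcases lt_or_gt_of_ne (show x ≠ 1 from hx.2) with h | h
  · obtain ⟨r, hxr, hr⟩ := exists_between h
    refine ⟨Ioo c r, mem_nhdsWithin_of_mem_nhds (Ioo_mem_nhds hx.1.1 hxr), ?_⟩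
    exact (intervalIntegrable_iff_Ioo (hx.1.1.trans hxr).le).1
      (hg.left r ⟨(hx.1.1.trans hxr).le, hr⟩)
  · obtain ⟨s, hs, hsx⟩ := exists_between h
    refine ⟨Ioo s d, mem_nhdsWithin_of_mem_nhds (Ioo_mem_nhds hsx hx.1.2), ?_⟩
    exact (intervalIntegrable_iff_Ioo (hsx.trans hx.1.2).le).1
      (hg.right s ⟨hs, (hsx.trans hx.1.2).le⟩)

/-- The integral over `(c,d)` of an integrable function vanishing on `[r,s]`. -/
theorem setIntegral_eq_of_zero_between {r s : ℝ} (hcr : c ≤ r) (hrs : r ≤ s) (hsd : s ≤ d)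
    {f : ℝ → ℝ} (hf : IntegrableOn f (Ioo c d)) (h0 : ∀ x ∈ Icc r s, f x = 0) :
    ∫ x in Ioo c d, f x = (∫ x in c..r, f x) + ∫ x in s..d, f x := by
  have hcd : c ≤ d := hcr.trans (hrs.trans hsd)
  have hi := (intervalIntegrable_iff_Ioo hcd).2 hf
  have h1 : IntervalIntegrable f volume c r := hi.mono_set (by
    rw [uIcc_of_le hcd, uIcc_of_le hcr]; exact Icc_subset_Icc_right (hrs.trans hsd))
  have h2 : IntervalIntegrable f volume r s := hi.mono_set (by
    rw [uIcc_of_le hcd, uIcc_of_le hrs]; exact Icc_subset_Icc hcr hsd)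
  have h3 : IntervalIntegrable f volume s d := hi.mono_set (by
    rw [uIcc_of_le hcd, uIcc_of_le hsd]; exact Icc_subset_Icc_left (hcr.trans hrs))
  have h4 : ∫ x in r..s, f x = 0 := by
    rw [intervalIntegral.integral_congr (g := fun _ => (0 : ℝ)) (fun x hx => h0 x (by
      rwa [uIcc_of_le hrs] at hx))]
    simp
  rw [setIntegral_Ioo_eq_intervalIntegral hcd,
    ← intervalIntegral.integral_add_adjacent_intervals h1 (h2.trans h3),
    ← intervalIntegral.integral_add_adjacent_intervals h2 h3, h4, zero_add]

/-- A test function on the punctured interval vanishes near `1`. -/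
theorem exists_test_eq_zero_near_one (hc : c < 1) (hd : 1 < d) {φ : ℝ → ℝ}
    (h : tsupport φ ⊆ punctured c d) :
    ∃ r s, c ≤ r ∧ r < 1 ∧ 1 < s ∧ s ≤ d ∧ ∀ x ∈ Icc r s, x ∉ tsupport φ := by
  have h1 : (tsupport φ)ᶜ ∈ 𝓝 (1 : ℝ) :=
    (isClosed_tsupport φ).isOpen_compl.mem_nhds fun hh => (h hh).2 rfl
  obtain ⟨ε, hε, hs⟩ := Metric.nhds_basis_closedBall.mem_iff.1 h1
  rw [Real.closedBall_eq_Icc] at hs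
  refine ⟨max c (1 - ε), min d (1 + ε), le_max_left _ _, max_lt hc (by linarith),
    lt_min hd (by linarith), min_le_left _ _, fun x hx => hs ⟨?_, ?_⟩⟩
  · exact (le_max_right _ _).trans hx.1
  · exact hx.2.trans (min_le_right _ _)

theorem hasWeakDerivOn_biPrimitive (hc : c < 1) (hd : 1 < d) (hg : IntegrableAwayFromOne c d g) :
    HasWeakDerivOn (punctured c d) (biPrimitive c d g) g where
  locInt := ((continuousOn_biPrimitive hg).mono
    (sdiff_subset_sdiff_left Ioo_subset_Icc_self)).locallyIntegrableOn
    (isOpen_punctured c d).measurableSet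
  locInt_deriv := locallyIntegrableOn_punctured hg
  integral_eq φ h1 h2 h3 := by
    obtain ⟨r, s, hcr, hr, hs, hsd, hz⟩ := exists_test_eq_zero_near_one hc hd h3
    have h1' : Continuous (deriv φ) := h1.continuous_deriv (by simp)
    have h3' : tsupport (deriv φ) ⊆ tsupport φ := tsupport_deriv_subset (f := φ)
    have i1 := integrable_mul_test h1' h2.deriv (h3'.trans h3)
      (((continuousOn_biPrimitive hg).mono
      (sdiff_subset_sdiff_left Ioo_subset_Icc_self)).locallyIntegrableOn
      (isOpen_punctured c d).measurableSet)
    have i2 := integrable_mul_test h1.continuous h2 h3 (locallyIntegrableOn_punctured hg)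
    have hφ : ∀ x ∈ Icc r s, φ x = 0 := fun x hx => image_eq_zero_of_notMem_tsupport (hz x hx)
    have hφ' : ∀ x ∈ Icc r s, deriv φ x = 0 := fun x hx =>
      image_eq_zero_of_notMem_tsupport fun hh => hz x hx (h3' hh)
    rw [restrict_punctured] at i1 i2 ⊢
    have hrs : r ≤ s := (hr.trans hs).le
    rw [setIntegral_eq_of_zero_between hcr hrs hsd i1 (fun x hx => by rw [hφ' x hx, mul_zero]),
      setIntegral_eq_of_zero_between hcr hrs hsd i2 (fun x hx => by rw [hφ x hx, mul_zero])]
    have hφc : φ c = 0 := test_eq_zero h3 fun h => lt_irrefl _ h.1.1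
    have hφd : φ d = 0 := test_eq_zero h3 fun h => lt_irrefl _ h.1.2
    have e1 := integral_primitive_mul_deriv (e := c) left_mem_uIcc (hg.left r ⟨hcr, hr⟩)
      (h1.of_le (m := 1) (by simp))
    have e2 := integral_primitive_mul_deriv (e := d) right_mem_uIcc (hg.right s ⟨hs, hsd⟩)
      (h1.of_le (m := 1) (by simp))
    rw [hφ r ⟨le_rfl, hrs⟩, hφc] at e1
    rw [hφ s ⟨hrs, le_rfl⟩, hφd] at e2
    have e3 : ∫ x in c..r, biPrimitive c d g x * deriv φ x =
        ∫ x in c..r, (∫ t in c..x, g t) * deriv φ x := by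
      refine intervalIntegral.integral_congr fun x hx => ?_
      rw [uIcc_of_le hcr] at hx
      simp only [biPrimitive_of_lt (hx.2.trans_lt hr)]
    have e4 : ∫ x in s..d, biPrimitive c d g x * deriv φ x =
        ∫ x in s..d, (∫ t in d..x, g t) * deriv φ x := by
      refine intervalIntegral.integral_congr fun x hx => ?_
      rw [uIcc_of_le hsd] at hx
      simp only [biPrimitive_of_ge (hs.trans_le hx.1).le]
    rw [e3, e4, e1, e2]
    ring

/-- A vanishing integral makes both branches agree at `1`, so that the weak derivative exists across
`1`. -/
theorem hasWeakDerivOn_biPrimitive_of_integral_eq_zero (hc : c < 1) (hd : 1 < d)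
    (hg : IntervalIntegrable g volume c d) (h0 : ∫ t in c..d, g t = 0) :
    HasWeakDerivOn (Ioo c d) (biPrimitive c d g) g := by
  refine (hasWeakDerivOn_primitive (hc.trans hd) (left_mem_Icc.2 (hc.trans hd).le) hg).congr ?_
    (ae_eq_refl _)
  rw [Filter.EventuallyEq, ae_restrict_iff' measurableSet_Ioo]
  exact Eventually.of_forall fun x hx =>
    (biPrimitive_eq_of_integral_eq_zero hc hd hg h0 (Ioo_subset_Icc_self hx)).symm

variable {u f : ℝ → ℝ}

theorem HasWeakDerivOn.eqOn_biPrimitive (hc : c < 1) (hd : 1 < d)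
    (hg : IntegrableAwayFromOne c d g) (hu : HasWeakDerivOn (punctured c d) u g)
    (hf : f =ᵐ[volume.restrict (Ioo c d)] u) (hcont : ContinuousOn f (Icc c d \ {1}))
    (hfc : f c = 0) (hfd : f d = 0) : EqOn f (biPrimitive c d g) (Icc c d \ {1}) := by
  intro x hx
  rcases lt_or_gt_of_ne (show x ≠ 1 from hx.2) with h | h
  · obtain ⟨r, hxr, hr⟩ := exists_between h
    have hcr : c < r := hx.1.1.trans_lt hxr
    have hsub : Ioo c r ⊆ Ioo c d := Ioo_subset_Ioo_right (hr.trans hd).le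
    have h1 := (hu.mono (W := Ioo c r) fun y hy =>
      ⟨hsub hy, (hy.2.trans hr).ne⟩).eq_add_primitive hcr (hg.left r ⟨hcr.le, hr⟩)
      (ae_restrict_of_ae_restrict_of_subset hsub hf)
      (hcont.mono fun y hy => ⟨⟨hy.1, hy.2.trans (hr.trans hd).le⟩, (hy.2.trans_lt hr).ne⟩)
      x ⟨hx.1.1, hxr.le⟩
    rw [h1, hfc, zero_add, biPrimitive_of_lt h]
  · obtain ⟨s, hs, hsx⟩ := exists_between h
    have hsd : s < d := hsx.trans_le hx.1.2
    have hsub : Ioo s d ⊆ Ioo c d := Ioo_subset_Ioo_left (hc.trans hs).le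
    have h1 := (hu.mono (W := Ioo s d) fun y hy =>
      ⟨hsub hy, (hs.trans hy.1).ne'⟩).eq_add_primitive hsd (hg.right s ⟨hs, hsd.le⟩)
      (ae_restrict_of_ae_restrict_of_subset hsub hf)
      (hcont.mono fun y hy => ⟨⟨(hc.trans hs).le.trans hy.1, hy.2⟩, (hs.trans_le hy.1).ne'⟩)
    have h2 := h1 x ⟨hsx.le, hx.1.2⟩
    have h3 := h1 d (right_mem_Icc.2 hsd.le)
    have hi := hg.right s ⟨hs, hsd.le⟩
    have h4 := intervalIntegral.integral_interval_sub_left (a := s) (b := x) (c := d)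
      (hi.mono_set (by
        rw [uIcc_of_le hsd.le, uIcc_of_le hsx.le]; exact Icc_subset_Icc_right hx.1.2)) hi
    rw [biPrimitive_of_ge h.le, ← h4]
    linarith

theorem HasWeakDerivOn.ae_eq_biPrimitive (hc : c < 1) (hd : 1 < d)
    (hg : IntegrableAwayFromOne c d g) (hu : HasWeakDerivOn (punctured c d) u g)
    (hf : f =ᵐ[volume.restrict (Ioo c d)] u) (hcont : ContinuousOn f (Icc c d \ {1}))
    (hfc : f c = 0) (hfd : f d = 0) :
    u =ᵐ[volume.restrict (Ioo c d)] biPrimitive c d g := by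
  refine hf.symm.trans ?_
  rw [← restrict_punctured, Filter.EventuallyEq,
    ae_restrict_iff' (isOpen_punctured c d).measurableSet]
  exact Eventually.of_forall fun x hx => hu.eqOn_biPrimitive hc hd hg hf hcont hfc hfd
    ⟨Ioo_subset_Icc_self hx.1, hx.2⟩

/-- If the weak derivative is integrable across `1`, then the boundary values determine its
integral. -/
theorem HasWeakDerivOn.integral_eq_zero (hc : c < 1) (hd : 1 < d)
    (hg : IntervalIntegrable g volume c d) (hu : HasWeakDerivOn (Ioo c d) u g)
    (hf : f =ᵐ[volume.restrict (Ioo c d)] u) (hcont : ContinuousOn f (Icc c d \ {1}))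
    (hfc : f c = 0) (hfd : f d = 0) : ∫ t in c..d, g t = 0 := by
  have hcd : c < d := hc.trans hd
  obtain ⟨C, hC⟩ := hu.exists_ae_eq_primitive hcd hg
  have hF : ContinuousOn (fun x => C + ∫ t in c..x, g t) (Icc c d) :=
    continuousOn_const.add (continuousOn_primitive_Icc (left_mem_Icc.2 hcd.le) hg)
  have hfF := hf.trans hC
  obtain ⟨r, hcr, hr⟩ := exists_between hc
  obtain ⟨s, hs, hsd⟩ := exists_between hd
  have h1 := eqOn_Icc_of_ae_eq_Ioo hcr
    (ae_restrict_of_ae_restrict_of_subset (Ioo_subset_Ioo_right (hr.trans hd).le) hfF)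
    (hcont.mono fun y hy => ⟨⟨hy.1, hy.2.trans (hr.trans hd).le⟩, (hy.2.trans_lt hr).ne⟩)
    (hF.mono (Icc_subset_Icc_right (hr.trans hd).le)) (left_mem_Icc.2 hcr.le)
  have h2 := eqOn_Icc_of_ae_eq_Ioo hsd
    (ae_restrict_of_ae_restrict_of_subset (Ioo_subset_Ioo_left (hc.trans hs).le) hfF)
    (hcont.mono fun y hy => ⟨⟨(hc.trans hs).le.trans hy.1, hy.2⟩, (hs.trans_le hy.1).ne'⟩)
    (hF.mono (Icc_subset_Icc_left (hc.trans hs).le)) (right_mem_Icc.2 hsd.le)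
  simp only [hfc, hfd, intervalIntegral.integral_same, add_zero] at h1 h2
  rw [← h1, zero_add] at h2
  exact h2.symm

end

/-! ### Hardy's inequality -/

/-- The Cauchy-Schwarz inequality with a weight `w` and its inverse. -/
theorem sq_setLIntegral_le {s : Set ℝ} (hs : MeasurableSet s) {w h : ℝ → ℝ≥0∞} (hw : Measurable w)
    (hh : Measurable h) (h0 : ∀ t ∈ s, w t ≠ 0) (h1 : ∀ t ∈ s, w t ≠ ⊤) :
    (∫⁻ t in s, h t) ^ 2 ≤ (∫⁻ t in s, (w t)⁻¹) * ∫⁻ t in s, w t * h t ^ 2 := by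
  have e : ∫⁻ t in s, h t = ∫⁻ t in s, ((w t)⁻¹ ^ (1 / 2 : ℝ)) * (w t ^ (1 / 2 : ℝ) * h t) := by
    refine setLIntegral_congr_fun hs fun t ht => ?_
    rw [← mul_assoc, ← ENNReal.mul_rpow_of_nonneg _ _ (by norm_num),
      ENNReal.inv_mul_cancel (h0 t ht) (h1 t ht), ENNReal.one_rpow, one_mul]
  have key := ENNReal.lintegral_mul_le_Lp_mul_Lq (volume.restrict s)
    (Real.HolderConjugate.two_two) (f := fun t => (w t)⁻¹ ^ (1 / 2 : ℝ))
    (g := fun t => w t ^ (1 / 2 : ℝ) * h t) (hw.inv.pow_const _).aemeasurable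
    ((hw.pow_const _).mul hh).aemeasurable
  have e1 : ∀ t, ((w t)⁻¹ ^ (1 / 2 : ℝ)) ^ (2 : ℝ) = (w t)⁻¹ := fun t => by
    rw [← ENNReal.rpow_mul]; norm_num
  have e2 : ∀ t, (w t ^ (1 / 2 : ℝ) * h t) ^ (2 : ℝ) = w t * h t ^ 2 := fun t => by
    rw [ENNReal.mul_rpow_of_nonneg _ _ (by norm_num), ← ENNReal.rpow_mul]
    norm_num
  simp only [Pi.mul_apply, e1, e2] at key
  rw [e]
  refine (pow_le_pow_left' key 2).trans (le_of_eq ?_)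
  rw [mul_pow]
  congr 1 <;>
  · rw [← ENNReal.rpow_natCast, ← ENNReal.rpow_mul]
    norm_num

theorem lintegral_Ioi_rpow {s x : ℝ} (hs : s < -1) (hx : 0 < x) :
    ∫⁻ t in Ioi x, ENNReal.ofReal (t ^ s) = ENNReal.ofReal (-x ^ (s + 1) / (s + 1)) := by
  rw [← integral_Ioi_rpow_of_lt hs hx, ofReal_integral_eq_lintegral_ofReal
    (integrableOn_Ioi_rpow_of_lt hs hx)]
  filter_upwards [ae_restrict_mem measurableSet_Ioi] with t ht
  exact Real.rpow_nonneg (hx.trans ht).le _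

theorem lintegral_Ioo_rpow {s x : ℝ} (hs : -1 < s) (hx : 0 < x) :
    ∫⁻ t in Ioo 0 x, ENNReal.ofReal (t ^ s) = ENNReal.ofReal (x ^ (s + 1) / (s + 1)) := by
  have h := integral_rpow (a := 0) (b := x) (r := s) (Or.inl hs)
  rw [Real.zero_rpow (by linarith), sub_zero] at h
  rw [← h, ← setIntegral_Ioo_eq_intervalIntegral hx.le, ofReal_integral_eq_lintegral_ofReal]
  · exact (intervalIntegrable_iff_Ioo hx.le).1 (intervalIntegral.intervalIntegrable_rpow' hs)
  · filter_upwards [ae_restrict_mem measurableSet_Ioo] with t ht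
    exact Real.rpow_nonneg ht.1.le _

theorem ofReal_rpow_inv {t s : ℝ} (ht : 0 < t) :
    (ENNReal.ofReal (t ^ s))⁻¹ = ENNReal.ofReal (t ^ (-s)) := by
  rw [Real.rpow_neg ht.le, ENNReal.ofReal_inv_of_pos (Real.rpow_pos_of_pos ht _)]

/-- A pointwise bound for primitives from infinity in terms of the weight `t²`. -/
theorem sq_lintegral_Ioi_le {h : ℝ → ℝ≥0∞} (hh : Measurable h) {x : ℝ} (hx : 0 < x) :
    (∫⁻ t in Ioi x, h t) ^ 2 ≤
      ENNReal.ofReal x⁻¹ * ∫⁻ t in Ioi 0, ENNReal.ofReal (t ^ 2) * h t ^ 2 := by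
  have h1 := sq_setLIntegral_le (s := Ioi x) measurableSet_Ioi
    (w := fun t => ENNReal.ofReal (t ^ (2 : ℝ))) (by fun_prop) hh
    (fun t ht => (ENNReal.ofReal_pos.2 (Real.rpow_pos_of_pos (hx.trans ht) _)).ne')
    (fun t _ => ENNReal.ofReal_ne_top)
  have h2 : ∫⁻ t in Ioi x, (ENNReal.ofReal (t ^ (2 : ℝ)))⁻¹ = ENNReal.ofReal x⁻¹ := by
    rw [setLIntegral_congr_fun measurableSet_Ioi fun t ht => ofReal_rpow_inv (hx.trans ht),
      lintegral_Ioi_rpow (by norm_num) hx]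
    congr 1
    norm_num [Real.rpow_neg_one]
  rw [h2] at h1
  refine h1.trans (mul_le_mul_right ?_ _)
  simp only [Real.rpow_two]
  exact lintegral_mono_set (Ioi_subset_Ioi hx.le)

/-- Hardy's inequality on the half-line, by the Schur test with the weight `t^(3/2)`. -/
theorem hardy_Ioi {h : ℝ → ℝ≥0∞} (hh : Measurable h) :
    ∫⁻ x in Ioi (0 : ℝ), (∫⁻ t in Ioi x, h t) ^ 2 ≤
      4 * ∫⁻ t in Ioi 0, ENNReal.ofReal (t ^ 2) * h t ^ 2 := by
  let w : ℝ → ℝ≥0∞ := fun t => ENNReal.ofReal (t ^ (3 / 2 : ℝ)) * h t ^ 2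
  have hw : Measurable w := by fun_prop
  let v : ℝ → ℝ≥0∞ := fun x => ENNReal.ofReal (2 * x ^ (-(1 / 2) : ℝ))
  have hv : Measurable v := by fun_prop
  have h1 : ∀ x ∈ Ioi (0 : ℝ), (∫⁻ t in Ioi x, h t) ^ 2 ≤ v x * ∫⁻ t in Ioi x, w t := by
    intro x hx
    have h1 := sq_setLIntegral_le (s := Ioi x) measurableSet_Ioi
      (w := fun t => ENNReal.ofReal (t ^ (3 / 2 : ℝ))) (by fun_prop) hh
      (fun t ht => (ENNReal.ofReal_pos.2 (Real.rpow_pos_of_pos (lt_trans hx ht) _)).ne')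
      (fun t _ => ENNReal.ofReal_ne_top)
    refine h1.trans (le_of_eq ?_)
    congr 1
    rw [setLIntegral_congr_fun measurableSet_Ioi fun t ht => ofReal_rpow_inv (lt_trans hx ht),
      lintegral_Ioi_rpow (by norm_num) hx]
    change _ = ENNReal.ofReal _
    congr 1
    norm_num
    ring
  calc ∫⁻ x in Ioi (0 : ℝ), (∫⁻ t in Ioi x, h t) ^ 2
      ≤ ∫⁻ x in Ioi (0 : ℝ), v x * ∫⁻ t in Ioi x, w t :=
        setLIntegral_mono' measurableSet_Ioi h1
    _ = ∫⁻ x in Ioi (0 : ℝ), ∫⁻ t in Ioi (0 : ℝ), (Ioi x).indicator (fun t => v x * w t) t := by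
        refine setLIntegral_congr_fun measurableSet_Ioi fun x hx => ?_
        rw [lintegral_indicator measurableSet_Ioi, Measure.restrict_restrict measurableSet_Ioi,
          inter_eq_left.2 (Ioi_subset_Ioi (le_of_lt hx)), lintegral_const_mul _ hw]
    _ = ∫⁻ t in Ioi (0 : ℝ), ∫⁻ x in Ioi (0 : ℝ), (Ioi x).indicator (fun t => v x * w t) t := by
        refine lintegral_lintegral_swap (Measurable.aemeasurable ?_)
        have : (Function.uncurry fun x t : ℝ => (Ioi x).indicator (fun t => v x * w t) t) =
            {p : ℝ × ℝ | p.1 < p.2}.indicator fun p => v p.1 * w p.2 := by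
          ext ⟨x, t⟩
          simp [Function.uncurry, indicator]
        rw [this]
        exact ((hv.comp measurable_fst).mul (hw.comp measurable_snd)).indicator
          (measurableSet_lt measurable_fst measurable_snd)
    _ = ∫⁻ t in Ioi (0 : ℝ), 4 * (ENNReal.ofReal (t ^ 2) * h t ^ 2) := by
        refine setLIntegral_congr_fun measurableSet_Ioi fun t ht => ?_
        have ht' : (0 : ℝ) < t := ht
        have e : ∀ x, (Ioi x).indicator (fun t => v x * w t) t =
            (Iio t).indicator (fun x => v x * w t) x := fun x => by simp [indicator]
        simp only [e]
        rw [lintegral_indicator measurableSet_Iio, Measure.restrict_restrict measurableSet_Iio,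
          inter_comm, Ioi_inter_Iio, lintegral_mul_const _ hv]
        have e2 : ∫⁻ x in Ioo 0 t, v x = ENNReal.ofReal (4 * t ^ (1 / 2 : ℝ)) := by
          simp only [v, ENNReal.ofReal_mul zero_le_two]
          rw [lintegral_const_mul _ (by fun_prop), lintegral_Ioo_rpow (by norm_num) ht',
            ← ENNReal.ofReal_mul zero_le_two]
          congr 1
          norm_num
          ring
        rw [e2]
        simp only [w]
        rw [← mul_assoc, ← mul_assoc, ← ENNReal.ofReal_mul (by positivity), mul_assoc 4,
          ← Real.rpow_add ht', ENNReal.ofReal_mul (by norm_num)]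
        norm_num
    _ = _ := lintegral_const_mul _ (by fun_prop)

theorem setLIntegral_one_add (F : ℝ → ℝ≥0∞) (x : ℝ) :
    ∫⁻ y in Ioi x, F (1 + y) = ∫⁻ t in Ioi (1 + x), F t := by
  have := (measurePreserving_add_left volume (1 : ℝ)).setLIntegral_comp_preimage_emb
    (measurableEmbedding_addLeft 1) F (Ioi (1 + x))
  rw [← this]
  congr 2
  ext y
  simp

theorem setLIntegral_one_sub (F : ℝ → ℝ≥0∞) (x : ℝ) :
    ∫⁻ y in Ioi x, F (1 - y) = ∫⁻ t in Iio (1 - x), F t := by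
  have := (Measure.measurePreserving_sub_left volume (1 : ℝ)).setLIntegral_comp_preimage_emb
    (MeasurableEquiv.subLeft (1 : ℝ)).measurableEmbedding F (Iio (1 - x))
  rw [← this]
  congr 2
  ext y
  simp

/-- The integral of `h` over the half-line that begins at `x` and points away from `1`. -/
noncomputable def outerIntegral (h : ℝ → ℝ≥0∞) (x : ℝ) : ℝ≥0∞ :=
  if x < 1 then ∫⁻ t in Iio x, h t else ∫⁻ t in Ioi x, h t

theorem sq_outerIntegral_le {h : ℝ → ℝ≥0∞} (hh : Measurable h) {x : ℝ} (hx : x ≠ 1) :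
    outerIntegral h x ^ 2 ≤
      ENNReal.ofReal |x - 1|⁻¹ * ∫⁻ t, ENNReal.ofReal ((t - 1) ^ 2) * h t ^ 2 := by
  rcases lt_or_gt_of_ne hx with hx | hx
  · have h1 := sq_lintegral_Ioi_le (h := fun y => h (1 - y)) (by fun_prop) (sub_pos.2 hx)
    rw [setLIntegral_one_sub h, sub_sub_cancel] at h1
    have h2 := setLIntegral_one_sub (fun t => ENNReal.ofReal ((t - 1) ^ 2) * h t ^ 2) 0
    simp only [sub_sub_cancel_left, neg_sq, sub_zero] at h2
    rw [h2] at h1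
    rw [outerIntegral, if_pos hx, abs_sub_comm, abs_of_pos (sub_pos.2 hx)]
    exact h1.trans (mul_le_mul_right (setLIntegral_le_lintegral _ _) _)
  · have h1 := sq_lintegral_Ioi_le (h := fun y => h (1 + y)) (by fun_prop) (sub_pos.2 hx)
    rw [setLIntegral_one_add h, add_sub_cancel] at h1
    have h2 := setLIntegral_one_add (fun t => ENNReal.ofReal ((t - 1) ^ 2) * h t ^ 2) 0
    simp only [add_sub_cancel_left, add_zero] at h2
    rw [h2] at h1
    rw [outerIntegral, if_neg hx.not_gt, abs_of_pos (sub_pos.2 hx)]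
    exact h1.trans (mul_le_mul_right (setLIntegral_le_lintegral _ _) _)

/-- Hardy's inequality on both sides of `1`. -/
theorem hardy_outerIntegral {h : ℝ → ℝ≥0∞} (hh : Measurable h) :
    ∫⁻ x, outerIntegral h x ^ 2 ≤ 8 * ∫⁻ t, ENNReal.ofReal ((t - 1) ^ 2) * h t ^ 2 := by
  have hR := hardy_Ioi (h := fun y => h (1 + y)) (by fun_prop)
  have hL := hardy_Ioi (h := fun y => h (1 - y)) (by fun_prop)
  simp only [setLIntegral_one_add h] at hR
  simp only [setLIntegral_one_sub h] at hL
  have r1 := setLIntegral_one_add (fun x => (∫⁻ t in Ioi x, h t) ^ 2) 0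
  have r2 := setLIntegral_one_add (fun t => ENNReal.ofReal ((t - 1) ^ 2) * h t ^ 2) 0
  have l1 := setLIntegral_one_sub (fun x => (∫⁻ t in Iio x, h t) ^ 2) 0
  have l2 := setLIntegral_one_sub (fun t => ENNReal.ofReal ((t - 1) ^ 2) * h t ^ 2) 0
  simp only [sub_sub_cancel_left, neg_sq, sub_zero, add_sub_cancel_left, add_zero] at r1 r2 l1 l2
  rw [r1, r2] at hR
  rw [l1, l2] at hL
  rw [← lintegral_add_compl _ (measurableSet_Iio (a := (1 : ℝ))), compl_Iio,
    setLIntegral_congr (Ioi_ae_eq_Ici (μ := volume) (a := (1 : ℝ))).symm]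
  have eL : ∫⁻ x in Iio 1, outerIntegral h x ^ 2 = ∫⁻ x in Iio 1, (∫⁻ t in Iio x, h t) ^ 2 :=
    setLIntegral_congr_fun measurableSet_Iio fun x hx => by
      simp only [outerIntegral]; rw [if_pos (show x < 1 from hx)]
  have eR : ∫⁻ x in Ioi 1, outerIntegral h x ^ 2 = ∫⁻ x in Ioi 1, (∫⁻ t in Ioi x, h t) ^ 2 :=
    setLIntegral_congr_fun measurableSet_Ioi fun x hx => by
      simp only [outerIntegral]; rw [if_neg (not_lt.2 (le_of_lt (show 1 < x from hx)))]
  rw [eL, eR]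
  calc _ ≤ _ := add_le_add hL hR
    _ ≤ 4 * (∫⁻ t, ENNReal.ofReal ((t - 1) ^ 2) * h t ^ 2) +
        4 * ∫⁻ t, ENNReal.ofReal ((t - 1) ^ 2) * h t ^ 2 :=
      add_le_add (mul_le_mul_right (setLIntegral_le_lintegral _ _) _)
        (mul_le_mul_right (setLIntegral_le_lintegral _ _) _)
    _ = _ := by rw [← add_mul]; norm_num

/-! ### Bounds for the weight -/

section

variable {c d : ℝ} {a : ℝ → ℝ}

theorem IsDegenerateWeight.nonneg (ha : IsDegenerateWeight c d a) {x : ℝ} (hx : x ∈ Icc c d) :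
    0 ≤ a x := by
  rcases eq_or_ne x 1 with rfl | h
  · exact ha.at_one.ge
  · exact (ha.pos x hx h).le

theorem IsDegenerateWeight.contDiffOn_sqrt (ha : IsDegenerateWeight c d a) :
    ContDiffOn ℝ 1 (fun x => √(a x)) (punctured c d) :=
  (ha.contDiff.mono (sdiff_subset_sdiff_left Ioo_subset_Icc_self)).sqrt fun x hx =>
    (ha.pos x (Ioo_subset_Icc_self hx.1) hx.2).ne'

/-- The essential bound on `1 / (√a)'` holds everywhere, by continuity. -/
theorem IsDegenerateWeight.exists_le_abs_deriv_sqrt (ha : IsDegenerateWeight c d a) :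
    ∃ δ > 0, ∀ x ∈ punctured c d, δ ≤ |deriv (fun x => √(a x)) x| := by
  set D : ℝ → ℝ := deriv fun x => √(a x) with hD
  have hcont : ContinuousOn D (punctured c d) :=
    ha.contDiffOn_sqrt.continuousOn_deriv_of_isOpen (isOpen_punctured c d) le_rfl
  obtain ⟨K, hK⟩ : ∃ K : ℝ, ∀ᵐ x ∂volume.restrict (Ioo c d), ‖(D x)⁻¹‖ ≤ K := by
    have h1 := ha.sqrt_deriv_inv_bdd.2
    rw [eLpNorm_exponent_top] at h1
    refine ⟨(eLpNormEssSup (fun x => (D x)⁻¹) (volume.restrict (Ioo c d))).toReal, ?_⟩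
    filter_upwards [enorm_ae_le_eLpNormEssSup (fun x => (D x)⁻¹) (volume.restrict (Ioo c d))]
      with x hx
    rw [← toReal_enorm]
    exact ENNReal.toReal_mono h1.ne hx
  have hpos : 0 < max K 1 := by positivity
  refine ⟨(max K 1)⁻¹, by positivity, fun x hx => ?_⟩
  by_contra! hlt
  -- the set where the bound fails is open and null, hence empty
  have hopen : IsOpen (punctured c d ∩ (fun y => |D y|) ⁻¹' Iio (max K 1)⁻¹) :=
    hcont.abs.isOpen_inter_preimage (isOpen_punctured c d) isOpen_Iio
  have hnull : volume (punctured c d ∩ (fun y => |D y|) ⁻¹' Iio (max K 1)⁻¹) = 0 := by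
    have h2 : ∀ᵐ y ∂volume.restrict (punctured c d), (max K 1)⁻¹ ≤ |D y| := by
      rw [restrict_punctured]
      filter_upwards [hK, ha.sqrt_deriv_ne_zero] with y h3 h4
      rw [norm_inv, Real.norm_eq_abs] at h3
      exact inv_le_of_inv_le₀ (abs_pos.2 h4) (h3.trans (le_max_left _ _))
    rw [ae_restrict_iff' (isOpen_punctured c d).measurableSet] at h2
    refine measure_mono_null (fun y hy => ?_) h2
    simp only [mem_compl_iff, mem_ofPred_eq, Classical.not_imp, not_le]
    exact ⟨hy.1, hy.2⟩
  exact (hopen.measure_ne_zero volume ⟨x, hx, hlt⟩) hnull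

/-- The weight degenerates at most quadratically. -/
theorem IsDegenerateWeight.exists_sq_le (ha : IsDegenerateWeight c d a) :
    ∃ κ > 0, ∀ x ∈ Icc c d, κ * (x - 1) ^ 2 ≤ a x := by
  obtain ⟨δ, hδ, h⟩ := ha.exists_le_abs_deriv_sqrt
  have hcont : ContinuousOn (fun x => √(a x)) (Icc c d) := ha.cont.sqrt
  have hdiff : ∀ x ∈ punctured c d, DifferentiableAt ℝ (fun x => √(a x)) x := fun x hx =>
    (ha.contDiffOn_sqrt.differentiableOn one_ne_zero).differentiableAt
      ((isOpen_punctured c d).mem_nhds hx)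
  have key : ∀ x ∈ Icc c d, δ * |x - 1| ≤ √(a x) := by
    intro x hx
    rcases lt_trichotomy x 1 with h1 | rfl | h1
    · obtain ⟨ξ, hξ, e⟩ := exists_deriv_eq_slope (fun x => √(a x)) h1
        (hcont.mono (Icc_subset_Icc hx.1 ha.lt_d.le)) fun y hy =>
          (hdiff y ⟨⟨hx.1.trans_lt hy.1, hy.2.trans ha.lt_d⟩, hy.2.ne⟩).differentiableWithinAt
      have h2 := h ξ ⟨⟨hx.1.trans_lt hξ.1, hξ.2.trans ha.lt_d⟩, hξ.2.ne⟩
      rw [e, ha.at_one, Real.sqrt_zero, zero_sub, abs_div, abs_neg,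
        abs_of_nonneg (Real.sqrt_nonneg _), abs_sub_comm,
        le_div_iff₀ (abs_pos.2 (sub_ne_zero.2 h1.ne))] at h2
      exact h2
    · simp
    · obtain ⟨ξ, hξ, e⟩ := exists_deriv_eq_slope (fun x => √(a x)) h1
        (hcont.mono (Icc_subset_Icc ha.c_lt.le hx.2)) fun y hy =>
          (hdiff y ⟨⟨ha.c_lt.trans hy.1, hy.2.trans_le hx.2⟩, hy.1.ne'⟩).differentiableWithinAt
      have h2 := h ξ ⟨⟨ha.c_lt.trans hξ.1, hξ.2.trans_le hx.2⟩, hξ.1.ne'⟩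
      rw [e, ha.at_one, Real.sqrt_zero, sub_zero, abs_div, abs_of_nonneg (Real.sqrt_nonneg _),
        le_div_iff₀ (abs_pos.2 (sub_ne_zero.2 h1.ne'))] at h2
      exact h2
  refine ⟨δ ^ 2, by positivity, fun x hx => ?_⟩
  rw [← Real.sq_sqrt (ha.nonneg hx), ← sq_abs (x - 1), ← mul_pow]
  exact pow_le_pow_left₀ (by positivity) (key x hx) 2

theorem IsDegenerateWeight.exists_le (ha : IsDegenerateWeight c d a) :
    ∃ M > 0, ∀ x ∈ Icc c d, a x ≤ M := by
  obtain ⟨M, hM⟩ := isCompact_Icc.bddAbove_image ha.cont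
  exact ⟨max M 1, by positivity, fun x hx => (hM ⟨x, hx, rfl⟩).trans (le_max_left _ _)⟩

theorem IsDegenerateWeight.aestronglyMeasurable_sqrt (ha : IsDegenerateWeight c d a) :
    AEStronglyMeasurable (fun x => √(a x)) (volume.restrict (Ioo c d)) :=
  (ha.cont.sqrt.mono Ioo_subset_Icc_self).aestronglyMeasurable measurableSet_Ioo

theorem IsDegenerateWeight.aestronglyMeasurable_of_sqrt_mul (ha : IsDegenerateWeight c d a)
    {g : ℝ → ℝ} (hg : AEStronglyMeasurable (fun x => √(a x) * g x) (volume.restrict (Ioo c d))) :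
    AEStronglyMeasurable g (volume.restrict (Ioo c d)) := by
  refine (((ha.aestronglyMeasurable_sqrt.aemeasurable.inv).mul
    hg.aemeasurable).aestronglyMeasurable).congr ?_
  filter_upwards [ae_weight_pos ha] with x hx
  simp only [Pi.mul_apply, Pi.inv_apply]
  rw [← mul_assoc, inv_mul_cancel₀ (Real.sqrt_pos.2 hx).ne', one_mul]

/-- Away from `1` the weight is bounded below, so that `√a g ∈ L²` controls `g` there. -/
theorem IsDegenerateWeight.integrableAwayFromOne (ha : IsDegenerateWeight c d a) {g : ℝ → ℝ}
    (hg : MemLp (fun x => √(a x) * g x) 2 (volume.restrict (Ioo c d))) :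
    IntegrableAwayFromOne c d g := by
  obtain ⟨κ, hκ, hle⟩ := ha.exists_sq_le
  have key : ∀ p q η : ℝ, p ≤ q → c ≤ p → q ≤ d → 0 < η → (∀ x ∈ Ioo p q, η ≤ |x - 1|) →
      IntervalIntegrable g volume p q := by
    intro p q η hpq hcp hqd hη h
    rw [intervalIntegrable_iff_Ioo hpq]
    have hsub : Ioo p q ⊆ Ioo c d := Ioo_subset_Ioo hcp hqd
    have h1 : MemLp g 2 (volume.restrict (Ioo p q)) := by
      refine (hg.mono_measure (Measure.restrict_mono_set _ hsub)).of_le_mul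
        (c := (√(κ * η ^ 2))⁻¹) ((ha.aestronglyMeasurable_of_sqrt_mul hg.1).mono_measure
          (Measure.restrict_mono_set _ hsub)) ?_
      filter_upwards [ae_restrict_mem measurableSet_Ioo] with x hx
      have h2 : √(κ * η ^ 2) ≤ √(a x) := Real.sqrt_le_sqrt <|
        le_trans (by rw [← sq_abs (x - 1)]; gcongr; exact h x hx)
          (hle x (Ioo_subset_Icc_self (hsub hx)))
      have h3 : 0 < √(κ * η ^ 2) := Real.sqrt_pos.2 (by positivity)
      rw [norm_mul, Real.norm_of_nonneg (Real.sqrt_nonneg (a x)), ← div_eq_inv_mul,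
        le_div_iff₀ h3, mul_comm]
      exact mul_le_mul_of_nonneg_right h2 (norm_nonneg _)
    exact h1.integrable one_le_two
  refine ⟨fun r hr => ?_, fun s hs => ?_⟩
  · refine key c r (1 - r) hr.1 le_rfl (hr.2.trans ha.lt_d).le (sub_pos.2 hr.2) fun x hx => ?_
    rw [abs_sub_comm]
    exact le_trans (by linarith [hx.2]) (le_abs_self _)
  · refine key s d (s - 1) hs.2 (ha.c_lt.trans hs.1).le le_rfl (sub_pos.2 hs.1) fun x hx => ?_
    exact le_trans (by linarith [hx.1]) (le_abs_self _)

theorem enorm_biPrimitive_le {g : ℝ → ℝ} {h : ℝ → ℝ≥0∞}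
    (hgh : ∀ᵐ x ∂volume.restrict (Ioo c d), ‖g x‖ₑ = h x) {x : ℝ} (hx : x ∈ Icc c d) :
    ‖biPrimitive c d g x‖ₑ ≤ outerIntegral h x := by
  rcases lt_or_ge x 1 with h1 | h1
  · rw [biPrimitive_of_lt h1, outerIntegral, if_pos h1,
      ← setIntegral_Ioo_eq_intervalIntegral hx.1]
    refine (enorm_integral_le_lintegral_enorm _).trans ?_
    rw [lintegral_congr_ae (ae_restrict_of_ae_restrict_of_subset (Ioo_subset_Ioo_right hx.2) hgh)]
    exact lintegral_mono_set fun y hy => hy.2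
  · rw [biPrimitive_of_ge h1, outerIntegral, if_neg (not_lt.2 h1),
      intervalIntegral.integral_symm, enorm_neg, ← setIntegral_Ioo_eq_intervalIntegral hx.2]
    refine (enorm_integral_le_lintegral_enorm _).trans ?_
    rw [lintegral_congr_ae (ae_restrict_of_ae_restrict_of_subset (Ioo_subset_Ioo_left hx.1) hgh)]
    exact lintegral_mono_set fun y hy => hy.1

theorem eLpNorm_two_sq (f : ℝ → ℝ) (μ : Measure ℝ) :
    eLpNorm f 2 μ ^ 2 = ∫⁻ x, ‖f x‖ₑ ^ 2 ∂μ := by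
  have := eLpNorm_nnreal_pow_eq_lintegral (f := f) (μ := μ) (p := 2) two_ne_zero
  simpa using this

/-- A measurable majorant of `|g|` whose energy with weight `(t - 1)²` is controlled by that of `g`
with weight `a`. -/
theorem IsDegenerateWeight.exists_majorant (ha : IsDegenerateWeight c d a) :
    ∃ C : ℝ≥0, ∀ g : ℝ → ℝ, MemLp (fun x => √(a x) * g x) 2 (volume.restrict (Ioo c d)) →
      ∃ h : ℝ → ℝ≥0∞, Measurable h ∧ (∀ᵐ x ∂volume.restrict (Ioo c d), ‖g x‖ₑ = h x) ∧
        ∫⁻ t, ENNReal.ofReal ((t - 1) ^ 2) * h t ^ 2 ≤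
          C * eLpNorm (fun x => √(a x) * g x) 2 (volume.restrict (Ioo c d)) ^ 2 := by
  obtain ⟨κ, hκ, hle⟩ := ha.exists_sq_le
  -- `(t - 1)² ≤ a t / κ`
  refine ⟨κ⁻¹.toNNReal, fun g hg => ?_⟩
  have hgm := (ha.aestronglyMeasurable_of_sqrt_mul hg.1).enorm
  refine ⟨(Ioo c d).indicator (hgm.mk _), hgm.measurable_mk.indicator measurableSet_Ioo, ?_, ?_⟩
  · filter_upwards [hgm.ae_eq_mk, ae_restrict_mem measurableSet_Ioo] with x hx hx'
    rw [hx, indicator_of_mem hx']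
  · have e : ∀ t, ENNReal.ofReal ((t - 1) ^ 2) * (Ioo c d).indicator (hgm.mk _) t ^ 2 =
        (Ioo c d).indicator (fun t => ENNReal.ofReal ((t - 1) ^ 2) * hgm.mk _ t ^ 2) t := by
      intro t
      by_cases ht : t ∈ Ioo c d <;> simp [ht]
    simp only [e]
    rw [lintegral_indicator measurableSet_Ioo, eLpNorm_two_sq,
      ← lintegral_const_mul' _ _ ENNReal.coe_ne_top]
    refine lintegral_mono_ae ?_
    filter_upwards [hgm.ae_eq_mk, ae_restrict_mem measurableSet_Ioo] with x hx hx'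
    have h1 := hle x (Ioo_subset_Icc_self hx')
    have h2 := ha.nonneg (Ioo_subset_Icc_self hx')
    rw [← hx, enorm_mul, mul_pow, ← mul_assoc]
    refine mul_le_mul_left ?_ _
    rw [Real.enorm_of_nonneg (Real.sqrt_nonneg _), ← ENNReal.ofReal_pow (Real.sqrt_nonneg _),
      Real.sq_sqrt h2]
    change _ ≤ ENNReal.ofReal κ⁻¹ * _
    rw [← ENNReal.ofReal_mul (by positivity)]
    refine ENNReal.ofReal_le_ofReal ?_
    rwa [← div_eq_inv_mul, le_div_iff₀ hκ, mul_comm]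

/-- The Poincaré-Hardy inequality for `biPrimitive`. -/
theorem IsDegenerateWeight.exists_eLpNorm_biPrimitive_le (ha : IsDegenerateWeight c d a) :
    ∃ C : ℝ≥0, ∀ g : ℝ → ℝ, MemLp (fun x => √(a x) * g x) 2 (volume.restrict (Ioo c d)) →
      eLpNorm (biPrimitive c d g) 2 (volume.restrict (Ioo c d)) ≤
        C * eLpNorm (fun x => √(a x) * g x) 2 (volume.restrict (Ioo c d)) := by
  obtain ⟨C, hC⟩ := ha.exists_majorant
  refine ⟨NNReal.sqrt (8 * C), fun g hg => ?_⟩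
  obtain ⟨h, hm, hgh, hle⟩ := hC g hg
  rw [← ENNReal.pow_le_pow_left_iff two_ne_zero, eLpNorm_two_sq, mul_pow, ← ENNReal.coe_pow,
    NNReal.sq_sqrt, ENNReal.coe_mul, mul_assoc]
  calc ∫⁻ x in Ioo c d, ‖biPrimitive c d g x‖ₑ ^ 2
      ≤ ∫⁻ x in Ioo c d, outerIntegral h x ^ 2 :=
        setLIntegral_mono' measurableSet_Ioo fun x hx =>
          pow_le_pow_left' (enorm_biPrimitive_le hgh (Ioo_subset_Icc_self hx)) 2
    _ ≤ ∫⁻ x, outerIntegral h x ^ 2 := setLIntegral_le_lintegral _ _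
    _ ≤ 8 * ∫⁻ t, ENNReal.ofReal ((t - 1) ^ 2) * h t ^ 2 := hardy_outerIntegral hm
    _ ≤ _ := mul_le_mul_right hle _

/-- Near `1` the function `biPrimitive c d g` grows at most like `|x - 1|^(-1/2)`. -/
theorem IsDegenerateWeight.exists_sq_biPrimitive_le (ha : IsDegenerateWeight c d a) {g : ℝ → ℝ}
    (hg : MemLp (fun x => √(a x) * g x) 2 (volume.restrict (Ioo c d))) :
    ∃ K : ℝ, ∀ x ∈ Icc c d \ {1}, |x - 1| * biPrimitive c d g x ^ 2 ≤ K := by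
  obtain ⟨C, hC⟩ := ha.exists_majorant
  obtain ⟨h, hm, hgh, hle⟩ := hC g hg
  set E : ℝ≥0∞ := ∫⁻ t, ENNReal.ofReal ((t - 1) ^ 2) * h t ^ 2 with hE
  have hEt : E ≠ ⊤ := (hle.trans_lt (ENNReal.mul_lt_top ENNReal.coe_lt_top
    (ENNReal.pow_lt_top hg.2))).ne
  refine ⟨E.toReal, fun x hx => ?_⟩
  have hx1 : x ≠ 1 := hx.2
  have h0 : 0 < |x - 1| := abs_pos.2 (sub_ne_zero.2 hx1)
  have h1 := (pow_le_pow_left' (enorm_biPrimitive_le hgh hx.1) 2).trans (sq_outerIntegral_le hm hx1)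
  rw [← hE] at h1
  have h2 := ENNReal.toReal_mono (ENNReal.mul_ne_top ENNReal.ofReal_ne_top hEt) h1
  rw [ENNReal.toReal_pow, toReal_enorm, Real.norm_eq_abs, sq_abs, ENNReal.toReal_mul,
    ENNReal.toReal_ofReal (by positivity), ← div_eq_inv_mul, le_div_iff₀ h0] at h2
  linarith

theorem IsDegenerateWeight.memLp_biPrimitive (ha : IsDegenerateWeight c d a) {g : ℝ → ℝ}
    (hg : MemLp (fun x => √(a x) * g x) 2 (volume.restrict (Ioo c d))) :
    MemLp (biPrimitive c d g) 2 (volume.restrict (Ioo c d)) := by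
  obtain ⟨C, hC⟩ := ha.exists_eLpNorm_biPrimitive_le
  refine ⟨?_, (hC g hg).trans_lt (ENNReal.mul_lt_top ENNReal.coe_lt_top hg.2)⟩
  rw [← restrict_punctured]
  exact ((continuousOn_biPrimitive (ha.integrableAwayFromOne hg)).mono
    (sdiff_subset_sdiff_left Ioo_subset_Icc_self)).aestronglyMeasurable
    (isOpen_punctured c d).measurableSet

end

section

variable {c d : ℝ} {a : ℝ → ℝ}

/-! ### The primitive as a bounded operator on `L²` -/

theorem biPrimitive_congr {g h : ℝ → ℝ} (hgh : g =ᵐ[volume.restrict (Ioo c d)] h) {x : ℝ}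
    (hx : x ∈ Icc c d) : biPrimitive c d g x = biPrimitive c d h x := by
  rcases lt_or_ge x 1 with h1 | h1
  · rw [biPrimitive_of_lt h1, biPrimitive_of_lt h1, ← setIntegral_Ioo_eq_intervalIntegral hx.1,
      ← setIntegral_Ioo_eq_intervalIntegral hx.1]
    exact integral_congr_ae
      (ae_restrict_of_ae_restrict_of_subset (Ioo_subset_Ioo_right hx.2) hgh)
  · rw [biPrimitive_of_ge h1, biPrimitive_of_ge h1, intervalIntegral.integral_symm,
      intervalIntegral.integral_symm x, ← setIntegral_Ioo_eq_intervalIntegral hx.2,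
      ← setIntegral_Ioo_eq_intervalIntegral hx.2]
    exact congrArg Neg.neg (integral_congr_ae
      (ae_restrict_of_ae_restrict_of_subset (Ioo_subset_Ioo_left hx.1) hgh))

theorem biPrimitive_add {g h : ℝ → ℝ} (hg : IntegrableAwayFromOne c d g)
    (hh : IntegrableAwayFromOne c d h) {x : ℝ} (hx : x ∈ Icc c d \ {1}) :
    biPrimitive c d (g + h) x = biPrimitive c d g x + biPrimitive c d h x := by
  rcases lt_or_gt_of_ne (show x ≠ 1 from hx.2) with h1 | h1
  · simp only [biPrimitive_of_lt h1]
    exact intervalIntegral.integral_add (hg.left x ⟨hx.1.1, h1⟩) (hh.left x ⟨hx.1.1, h1⟩)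
  · simp only [biPrimitive_of_ge h1.le]
    exact intervalIntegral.integral_add (hg.right x ⟨h1, hx.1.2⟩).symm
      (hh.right x ⟨h1, hx.1.2⟩).symm

theorem biPrimitive_smul (r : ℝ) (g : ℝ → ℝ) (x : ℝ) :
    biPrimitive c d (r • g) x = r * biPrimitive c d g x := by
  unfold biPrimitive
  split_ifs <;> exact intervalIntegral.integral_const_mul _ _

theorem ae_mem_punctured : ∀ᵐ x ∂volume.restrict (Ioo c d), x ∈ punctured c d := by
  rw [← restrict_punctured]
  exact ae_restrict_mem (isOpen_punctured c d).measurableSet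

theorem Icc_sdiff_of_punctured {x : ℝ} (hx : x ∈ punctured c d) : x ∈ Icc c d \ {1} :=
  ⟨Ioo_subset_Icc_self hx.1, hx.2⟩

/-- The function `G / √a`. -/
noncomputable def unweight (a G : ℝ → ℝ) (x : ℝ) : ℝ := (√(a x))⁻¹ * G x

theorem sqrt_mul_unweight (ha : IsDegenerateWeight c d a) (G : ℝ → ℝ) :
    (fun x => √(a x) * unweight a G x) =ᵐ[volume.restrict (Ioo c d)] G := by
  filter_upwards [ae_weight_pos ha] with x hx
  rw [unweight, ← mul_assoc, mul_inv_cancel₀ (Real.sqrt_pos.2 hx).ne', one_mul]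

theorem unweight_sqrt_mul (ha : IsDegenerateWeight c d a) {G g : ℝ → ℝ}
    (h : G =ᵐ[volume.restrict (Ioo c d)] fun x => √(a x) * g x) :
    unweight a G =ᵐ[volume.restrict (Ioo c d)] g := by
  filter_upwards [ae_weight_pos ha, h] with x hx hG
  rw [unweight, hG, ← mul_assoc, inv_mul_cancel₀ (Real.sqrt_pos.2 hx).ne', one_mul]

theorem memLp_sqrt_mul_unweight (ha : IsDegenerateWeight c d a) (G : L2 c d) :
    MemLp (fun x => √(a x) * unweight a G x) 2 (volume.restrict (Ioo c d)) :=
  (Lp.memLp G).ae_eq (sqrt_mul_unweight ha G).symm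

/-- The operator `G ↦ biPrimitive (G / √a)` on `L²(c,d)`; it is bounded by Hardy's inequality. -/
noncomputable def primitiveL (ha : IsDegenerateWeight c d a) : L2 c d →L[ℝ] L2 c d :=
  LinearMap.mkContinuous
    { toFun := fun G => (ha.memLp_biPrimitive (memLp_sqrt_mul_unweight ha G)).toLp _
      map_add' := fun G K => by
        refine Lp.ext ((MemLp.coeFn_toLp _).trans ?_)
        refine EventuallyEq.trans ?_ (Lp.coeFn_add _ _).symm
        have e : unweight a (G + K : L2 c d) =ᵐ[volume.restrict (Ioo c d)]
            unweight a G + unweight a K := by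
          filter_upwards [Lp.coeFn_add G K] with x hx
          simp only [unweight, hx, Pi.add_apply, mul_add]
        filter_upwards [ae_mem_punctured,
          (ha.memLp_biPrimitive (memLp_sqrt_mul_unweight ha G)).coeFn_toLp,
          (ha.memLp_biPrimitive (memLp_sqrt_mul_unweight ha K)).coeFn_toLp] with x hx h1 h2
        rw [Pi.add_apply, h1, h2, biPrimitive_congr e (Ioo_subset_Icc_self hx.1),
          biPrimitive_add (ha.integrableAwayFromOne (memLp_sqrt_mul_unweight ha G))
          (ha.integrableAwayFromOne (memLp_sqrt_mul_unweight ha K)) (Icc_sdiff_of_punctured hx)]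
      map_smul' := fun r G => by
        refine Lp.ext ((MemLp.coeFn_toLp _).trans ?_)
        refine EventuallyEq.trans ?_ (Lp.coeFn_smul _ _).symm
        have e : unweight a (r • G : L2 c d) =ᵐ[volume.restrict (Ioo c d)]
            r • unweight a G := by
          filter_upwards [Lp.coeFn_smul r G] with x hx
          simp only [unweight, hx, Pi.smul_apply, smul_eq_mul]
          ring
        filter_upwards [ae_mem_punctured,
          (ha.memLp_biPrimitive (memLp_sqrt_mul_unweight ha G)).coeFn_toLp] with x hx h1
        rw [Pi.smul_apply, RingHom.id_apply, h1, biPrimitive_congr e (Ioo_subset_Icc_self hx.1),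
          biPrimitive_smul, smul_eq_mul] }
    ha.exists_eLpNorm_biPrimitive_le.choose fun G => by
      have h := ha.exists_eLpNorm_biPrimitive_le.choose_spec _ (memLp_sqrt_mul_unweight ha G)
      rw [eLpNorm_congr_ae (sqrt_mul_unweight ha G)] at h
      have h2 := ENNReal.toReal_mono
        (ENNReal.mul_ne_top ENNReal.coe_ne_top (Lp.eLpNorm_ne_top G)) h
      rw [ENNReal.toReal_mul, ENNReal.coe_toReal] at h2
      rw [Lp.norm_def G]
      refine le_trans (le_of_eq ?_) h2
      exact Lp.norm_toLp _ (ha.memLp_biPrimitive (memLp_sqrt_mul_unweight ha G))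

theorem coeFn_primitiveL (ha : IsDegenerateWeight c d a) (G : L2 c d) :
    primitiveL ha G =ᵐ[volume.restrict (Ioo c d)] biPrimitive c d (unweight a G) :=
  (ha.memLp_biPrimitive (memLp_sqrt_mul_unweight ha G)).coeFn_toLp

theorem coeFn_primitiveL_of_ae_eq (ha : IsDegenerateWeight c d a) {G : L2 c d} {g : ℝ → ℝ}
    (h : G =ᵐ[volume.restrict (Ioo c d)] fun x => √(a x) * g x) :
    primitiveL ha G =ᵐ[volume.restrict (Ioo c d)] biPrimitive c d g := by
  refine (coeFn_primitiveL ha G).trans ?_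
  filter_upwards [ae_mem_punctured] with x hx
  exact biPrimitive_congr (unweight_sqrt_mul ha h) (Ioo_subset_Icc_self hx.1)

/-! ### The derivatives of elements of `W¹_{a,0}` -/

/-- The space of `K ∈ L²(c,d)` for which `√a K` is constant.  Under strong degeneration it is
trivial, and under weak degeneration it is spanned by `1/√a`.  Its orthogonal complement consists
of the functions `√a u_x` with `u ∈ W¹_{a,0}`. -/
def constFlux (c d : ℝ) (a : ℝ → ℝ) : Submodule ℝ (L2 c d) where
  carrier := {K | ∃ k : ℝ, ∀ᵐ x ∂volume.restrict (Ioo c d), √(a x) * K x = k}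
  add_mem' := by
    rintro K L ⟨k, hk⟩ ⟨l, hl⟩
    refine ⟨k + l, ?_⟩
    filter_upwards [hk, hl, Lp.coeFn_add K L] with x h1 h2 h3
    rw [h3, Pi.add_apply, mul_add, h1, h2]
  zero_mem' := by
    refine ⟨0, ?_⟩
    filter_upwards [Lp.coeFn_zero ℝ 2 (volume.restrict (Ioo c d))] with x hx
    rw [hx, Pi.zero_apply, mul_zero]
  smul_mem' := by
    rintro r K ⟨k, hk⟩
    refine ⟨r * k, ?_⟩
    filter_upwards [hk, Lp.coeFn_smul r K] with x h1 h2
    rw [h2, Pi.smul_apply, smul_eq_mul, ← h1]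
    ring

theorem L2_inner_eq (F G : L2 c d) : inner ℝ F G = ∫ x in Ioo c d, F x * G x := by
  rw [L2.inner_def]
  refine integral_congr_ae (Eventually.of_forall fun x => ?_)
  simp [mul_comm]

theorem memLp_inv_sqrt (ha : IsDegenerateWeight c d a) (hw : WeaklyDegenerate c d a) :
    MemLp (fun x => (√(a x))⁻¹) 2 (volume.restrict (Ioo c d)) := by
  have hm : AEStronglyMeasurable (fun x => (√(a x))⁻¹) (volume.restrict (Ioo c d)) :=
    ha.aestronglyMeasurable_sqrt.aemeasurable.inv.aestronglyMeasurable
  rw [memLp_two_iff_integrable_sq hm]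
  refine hw.congr ?_
  filter_upwards [ae_weight_pos ha] with x hx
  rw [inv_pow, Real.sq_sqrt hx.le, one_div]

/-- Under weak degeneration, `√a g ∈ L²` makes `g` integrable across `1`. -/
theorem intervalIntegrable_of_weak (ha : IsDegenerateWeight c d a) (hw : WeaklyDegenerate c d a)
    {g : ℝ → ℝ} (hg : MemLp (fun x => √(a x) * g x) 2 (volume.restrict (Ioo c d))) :
    IntervalIntegrable g volume c d := by
  rw [intervalIntegrable_iff_Ioo (ha.c_lt.trans ha.lt_d).le]
  refine ((memLp_inv_sqrt ha hw).integrable_mul hg).congr ?_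
  filter_upwards [ae_weight_pos ha] with x hx
  rw [Pi.mul_apply, ← mul_assoc, inv_mul_cancel₀ (Real.sqrt_pos.2 hx).ne', one_mul]

/-- A nonzero constant flux occurs only under weak degeneration. -/
theorem weaklyDegenerate_of_constFlux {K : L2 c d} {k : ℝ} (ha : IsDegenerateWeight c d a)
    (hK : ∀ᵐ x ∂volume.restrict (Ioo c d), √(a x) * K x = k) (hk : k ≠ 0) :
    WeaklyDegenerate c d a := by
  refine ((Lp.memLp K).integrable_sq.const_mul ((k ^ 2)⁻¹)).congr ?_
  filter_upwards [hK, ae_weight_pos ha] with x h1 h2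
  have h3 : k ^ 2 = a x * K x ^ 2 := by rw [← h1, mul_pow, Real.sq_sqrt h2.le]
  have h4 : K x ≠ 0 := by
    rintro h0
    rw [h0, mul_zero] at h1
    exact hk h1.symm
  rw [h3]
  field_simp

theorem integral_unweight_eq_zero (ha : IsDegenerateWeight c d a) (hw : WeaklyDegenerate c d a)
    {G : L2 c d} (hG : G ∈ (constFlux c d a)ᗮ) : ∫ t in c..d, unweight a G t = 0 := by
  have hm := memLp_inv_sqrt ha hw
  have h1 : hm.toLp ∈ constFlux c d a := by
    refine ⟨1, ?_⟩
    filter_upwards [hm.coeFn_toLp, ae_weight_pos ha] with x hx h2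
    rw [hx, mul_inv_cancel₀ (Real.sqrt_pos.2 h2).ne']
  have h2 := hG _ h1
  rw [L2_inner_eq] at h2
  rw [← setIntegral_Ioo_eq_intervalIntegral (ha.c_lt.trans ha.lt_d).le, ← h2]
  refine integral_congr_ae ?_
  filter_upwards [hm.coeFn_toLp] with x hx
  rw [hx, unweight]

variable {u : ℝ → ℝ}

/-- `√a u_x` as an element of `L²(c,d)`. -/
noncomputable def weightedDeriv (hu : MemW1a c d a u) : L2 c d := hu.memLp_dx.toLp

theorem coeFn_weightedDeriv (hu : MemW1a c d a u) :
    weightedDeriv hu =ᵐ[volume.restrict (Ioo c d)] fun x => √(a x) * dx c d u x :=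
  hu.memLp_dx.coeFn_toLp

theorem MemW1a0.ae_eq_biPrimitive (ha : IsDegenerateWeight c d a) (hu : MemW1a0 c d a u) :
    u =ᵐ[volume.restrict (Ioo c d)] biPrimitive c d (dx c d u) := by
  obtain ⟨f, hf, hcont, hfc, hfd⟩ := hu.2
  exact hu.1.hasWeakDerivOn.ae_eq_biPrimitive ha.c_lt ha.lt_d
    (ha.integrableAwayFromOne hu.1.memLp_dx) hf hcont hfc hfd

theorem MemW1a0.ae_eq_primitiveL (ha : IsDegenerateWeight c d a) (hu : MemW1a0 c d a u) :
    u =ᵐ[volume.restrict (Ioo c d)] primitiveL ha (weightedDeriv hu.1) :=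
  (hu.ae_eq_biPrimitive ha).trans (coeFn_primitiveL_of_ae_eq ha (coeFn_weightedDeriv hu.1)).symm

theorem MemW1a0.weightedDeriv_mem (ha : IsDegenerateWeight c d a) (hu : MemW1a0 c d a u) :
    weightedDeriv hu.1 ∈ (constFlux c d a)ᗮ := by
  rintro K ⟨k, hK⟩
  rw [L2_inner_eq]
  have e : ∫ x in Ioo c d, K x * weightedDeriv hu.1 x = ∫ x in Ioo c d, k * dx c d u x := by
    refine integral_congr_ae ?_
    filter_upwards [hK, coeFn_weightedDeriv hu.1] with x h1 h2
    rw [h2, ← h1]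
    ring
  rw [e, integral_const_mul]
  rcases eq_or_ne k 0 with rfl | hk
  · rw [zero_mul]
  · have hw := weaklyDegenerate_of_constFlux ha hK hk
    obtain ⟨f, hf, hcont, hfc, hfd⟩ := hu.2
    obtain ⟨g, hg, hg'⟩ := hu.1.2
    have h1 := dx_eq (hg.mono (punctured_subset_derivDomain c d a))
    rw [derivDomain, if_pos hw] at hg
    rw [integral_congr_ae h1, setIntegral_Ioo_eq_intervalIntegral (ha.c_lt.trans ha.lt_d).le,
      hg.integral_eq_zero ha.c_lt ha.lt_d (intervalIntegrable_of_weak ha hw hg') hf hcont hfc hfd,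
      mul_zero]

theorem dx_biPrimitive_unweight (ha : IsDegenerateWeight c d a) (G : L2 c d) :
    dx c d (biPrimitive c d (unweight a G)) =ᵐ[volume.restrict (Ioo c d)] unweight a G :=
  dx_eq (hasWeakDerivOn_biPrimitive ha.c_lt ha.lt_d
    (ha.integrableAwayFromOne (memLp_sqrt_mul_unweight ha G)))

theorem memW1a0_biPrimitive (ha : IsDegenerateWeight c d a) {G : L2 c d}
    (hG : G ∈ (constFlux c d a)ᗮ) : MemW1a0 c d a (biPrimitive c d (unweight a G)) := by
  have hm := memLp_sqrt_mul_unweight ha G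
  have hi := ha.integrableAwayFromOne hm
  refine ⟨⟨ha.memLp_biPrimitive hm, unweight a G, ?_, hm⟩, _, ae_eq_refl _,
    continuousOn_biPrimitive hi, biPrimitive_left ha.c_lt, biPrimitive_right ha.lt_d⟩
  unfold derivDomain
  split_ifs with hw
  · exact hasWeakDerivOn_biPrimitive_of_integral_eq_zero ha.c_lt ha.lt_d
      (intervalIntegrable_of_weak ha hw hm) (integral_unweight_eq_zero ha hw hG)
  · exact hasWeakDerivOn_biPrimitive ha.c_lt ha.lt_d hi

theorem MemW1a0.congr {v : ℝ → ℝ} (hu : MemW1a0 c d a u)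
    (h : u =ᵐ[volume.restrict (Ioo c d)] v) : MemW1a0 c d a v := by
  obtain ⟨f, h1, h2⟩ := hu.2
  exact ⟨hu.1.congr h, f, h1.trans h, h2⟩

/-! ### Density of smooth functions -/

/-- The functions `√a ψ`, where `ψ` is a test function on `(c,1) ∪ (1,d)` with mean zero; these are
the weighted derivatives `√a φ_x` of the test functions `φ` that are constant near `1`. -/
def testDeriv (c d : ℝ) (a : ℝ → ℝ) : Submodule ℝ (L2 c d) where
  carrier := {K | ∃ ψ : ℝ → ℝ, ContDiff ℝ ∞ ψ ∧ HasCompactSupport ψ ∧ tsupport ψ ⊆ punctured c d ∧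
    ∫ x, ψ x = 0 ∧ K =ᵐ[volume.restrict (Ioo c d)] fun x => √(a x) * ψ x}
  add_mem' := by
    rintro K L ⟨ψ, h1, h2, h3, h4, h5⟩ ⟨χ, k1, k2, k3, k4, k5⟩
    refine ⟨ψ + χ, h1.add k1, h2.add k2, (tsupport_add ψ χ).trans (union_subset h3 k3), ?_, ?_⟩
    · simp only [Pi.add_apply]
      rw [integral_add (h1.continuous.integrable_of_hasCompactSupport h2)
        (k1.continuous.integrable_of_hasCompactSupport k2), h4, k4, add_zero]
    · filter_upwards [h5, k5, Lp.coeFn_add K L] with x e1 e2 e3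
      rw [e3, Pi.add_apply, Pi.add_apply, e1, e2, mul_add]
  zero_mem' := by
    refine ⟨0, contDiff_const, HasCompactSupport.zero, by simp, by simp, ?_⟩
    filter_upwards [Lp.coeFn_zero ℝ 2 (volume.restrict (Ioo c d))] with x hx
    rw [hx, Pi.zero_apply, mul_zero]
  smul_mem' := by
    rintro r K ⟨ψ, h1, h2, h3, h4, h5⟩
    refine ⟨r • ψ, h1.const_smul r, h2.smul_left (f := fun _ => r),
      (tsupport_smul_subset_right (fun _ => r) ψ).trans h3, ?_, ?_⟩
    · simp only [Pi.smul_apply, smul_eq_mul]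
      rw [integral_const_mul, h4, mul_zero]
    · filter_upwards [h5, Lp.coeFn_smul r K] with x e1 e2
      rw [e2, Pi.smul_apply, Pi.smul_apply, e1, smul_eq_mul, smul_eq_mul]
      ring

theorem memLp_sqrt_mul (ha : IsDegenerateWeight c d a) {ψ : ℝ → ℝ} (hψ : Continuous ψ) :
    MemLp (fun x => √(a x) * ψ x) 2 (volume.restrict (Ioo c d)) := by
  have hcont : ContinuousOn (fun x => √(a x) * ψ x) (Icc c d) := ha.cont.sqrt.mul hψ.continuousOn
  obtain ⟨C, hC⟩ := isCompact_Icc.exists_bound_of_continuousOn hcont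
  refine MemLp.of_bound ((hcont.mono Ioo_subset_Icc_self).aestronglyMeasurable measurableSet_Ioo)
    C ?_
  filter_upwards [ae_restrict_mem measurableSet_Ioo] with x hx
  exact hC x (Ioo_subset_Icc_self hx)

/-- Multiplication by the bounded function `√a` preserves `L²`. -/
theorem memLp_sqrt_mul_L2 (ha : IsDegenerateWeight c d a) {K : ℝ → ℝ}
    (hK : MemLp K 2 (volume.restrict (Ioo c d))) :
    MemLp (fun x => √(a x) * K x) 2 (volume.restrict (Ioo c d)) := by
  obtain ⟨M, hM, hle⟩ := ha.exists_le
  refine hK.of_le_mul (c := √M) (ha.aestronglyMeasurable_sqrt.mul hK.1) ?_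
  filter_upwards [ae_restrict_mem measurableSet_Ioo] with x hx
  rw [norm_mul, Real.norm_of_nonneg (Real.sqrt_nonneg _)]
  exact mul_le_mul_of_nonneg_right (Real.sqrt_le_sqrt (hle x (Ioo_subset_Icc_self hx)))
    (norm_nonneg _)

/-- A variant of the lemma of du Bois-Reymond on the punctured interval. -/
theorem ae_eq_const_of_integral_mul_test {w : ℝ → ℝ} (hd : 1 < d) (hc : c < 1)
    (hw : LocallyIntegrableOn w (punctured c d))
    (h : ∀ ψ : ℝ → ℝ, ContDiff ℝ ∞ ψ → HasCompactSupport ψ → tsupport ψ ⊆ punctured c d →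
      ∫ x, ψ x = 0 → ∫ x in Ioo c d, w x * ψ x = 0) :
    ∃ k : ℝ, ∀ᵐ x ∂volume.restrict (Ioo c d), w x = k := by
  rw [← restrict_punctured] at h ⊢
  -- a normalised bump function supported in `(1,d)`
  let b : ContDiffBump ((1 + d) / 2) :=
    { rIn := (d - 1) / 8, rOut := (d - 1) / 4, rIn_pos := by linarith, rIn_lt_rOut := by linarith }
  set η : ℝ → ℝ := b.normed volume with hη
  have e1 : ContDiff ℝ ∞ η := b.contDiff_normed
  have e2 : HasCompactSupport η := b.hasCompactSupport_normed
  have e3 : tsupport η ⊆ punctured c d := by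
    rw [hη, b.tsupport_normed_eq, Real.closedBall_eq_Icc]
    rintro x ⟨hx1, hx2⟩
    change (1 + d) / 2 - (d - 1) / 4 ≤ x at hx1
    change x ≤ (1 + d) / 2 + (d - 1) / 4 at hx2
    have hx3 : 1 < x := by linarith
    exact ⟨⟨by linarith, by linarith⟩, hx3.ne'⟩
  have e4 : ∫ x, η x = 1 := b.integral_normed
  have hηi : Integrable η := e1.continuous.integrable_of_hasCompactSupport e2
  set k : ℝ := ∫ x in punctured c d, w x * η x with hk
  refine ⟨k, ?_⟩
  have key := (isOpen_punctured c d).ae_eq_zero_of_integral_contDiff_smul_eq_zero (μ := volume)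
    (f := fun x => w x - k) (hw.sub (locallyIntegrableOn_const k)) (by
      intro ψ h1 h2 h3
      have hψi : Integrable ψ := h1.continuous.integrable_of_hasCompactSupport h2
      set m : ℝ := ∫ x, ψ x with hm
      have hts : tsupport (fun x => ψ x - m * η x) ⊆ tsupport ψ ∪ tsupport η := by
        apply closure_minimal _ ((isClosed_tsupport _).union (isClosed_tsupport _))
        intro x hx
        by_contra hh
        rw [mem_union, not_or] at hh
        exact hx (by simp [image_eq_zero_of_notMem_tsupport hh.1,
          image_eq_zero_of_notMem_tsupport hh.2])
      have i1 := integrable_mul_test h1.continuous h2 h3 hw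
      have i2 := integrable_mul_test e1.continuous e2 e3 hw
      have g1 := h (fun x => ψ x - m * η x) (h1.sub (contDiff_const.mul e1))
        (HasCompactSupport.of_support_subset_isCompact (h2.union e2)
          ((subset_tsupport _).trans hts)) (hts.trans (union_subset h3 e3))
        (by rw [integral_sub hψi (hηi.const_mul m), integral_const_mul, e4]; simp [hm])
      have g2 : ∫ x in punctured c d, w x * (ψ x - m * η x)
          = (∫ x in punctured c d, w x * ψ x) - m * k := by
        rw [hk, ← integral_const_mul, ← integral_sub i1 (i2.const_mul m)]
        congr 1
        ext x
        ring
      have g4 : ∫ x in punctured c d, (w x - k) * ψ x = 0 := by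
        simp only [sub_mul]
        rw [integral_sub i1 (integrable_mul_test h1.continuous h2 h3
          (locallyIntegrableOn_const k)), integral_const_mul]
        have : ∫ x in punctured c d, ψ x = m :=
          setIntegral_eq_integral_of_forall_compl_eq_zero fun x hx => test_eq_zero h3 hx
        rw [this]
        linarith
      rw [setIntegral_mul_test h3] at g4
      simpa [mul_comm] using g4)
  rw [ae_restrict_iff' (isOpen_punctured c d).measurableSet]
  filter_upwards [key] with x hx hxU
  linarith [hx hxU]

/-- If `K` is orthogonal to all `√a ψ`, then `√a K` is orthogonal to all test
functions `ψ` with mean zero, and hence constant. -/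
theorem testDeriv_orthogonal_le (ha : IsDegenerateWeight c d a) :
    (testDeriv c d a)ᗮ ≤ constFlux c d a := by
  intro K hK
  refine ae_eq_const_of_integral_mul_test ha.lt_d ha.c_lt
    (w := fun x => √(a x) * K x) ?_ fun ψ h1 h2 h3 h4 => ?_
  · have hi : IntegrableOn (fun x => √(a x) * K x) (Ioo c d) :=
      (memLp_sqrt_mul_L2 ha (Lp.memLp K)).integrable one_le_two
    exact hi.locallyIntegrableOn.mono_set sdiff_subset
  · have hm := memLp_sqrt_mul (c := c) (d := d) ha h1.continuous
    have h5 := hK hm.toLp ⟨ψ, h1, h2, h3, h4, hm.coeFn_toLp⟩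
    rw [L2_inner_eq] at h5
    rw [← h5]
    refine integral_congr_ae ?_
    filter_upwards [hm.coeFn_toLp] with x hx
    rw [hx]
    ring

/-- Every weighted derivative of an element of `W¹_{a,0}` is a limit of weighted derivatives of
test functions. -/
theorem orthogonal_constFlux_le (ha : IsDegenerateWeight c d a) :
    (constFlux c d a)ᗮ ≤ (testDeriv c d a).topologicalClosure := by
  rw [← Submodule.orthogonal_orthogonal_eq_closure]
  exact Submodule.orthogonal_le (testDeriv_orthogonal_le ha)

theorem biPrimitive_deriv_test {φ : ℝ → ℝ} (h1 : ContDiff ℝ 1 φ)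
    (h3 : tsupport φ ⊆ Ioo c d) (x : ℝ) : biPrimitive c d (deriv φ) x = φ x := by
  have hd : ∀ p q, ∫ t in p..q, deriv φ t = φ q - φ p := fun p q =>
    intervalIntegral.integral_deriv_eq_sub
      (fun t _ => h1.differentiable one_ne_zero t)
      ((h1.continuous_deriv le_rfl).intervalIntegrable _ _)
  unfold biPrimitive
  rw [hd, hd, test_eq_zero h3 left_notMem_Ioo, test_eq_zero h3 right_notMem_Ioo]
  simp

theorem hasWeakDerivOn_of_contDiff (hcd : c < d) {φ : ℝ → ℝ} (h1 : ContDiff ℝ 1 φ) :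
    HasWeakDerivOn (Ioo c d) φ (deriv φ) where
  locInt := h1.continuous.continuousOn.locallyIntegrableOn measurableSet_Ioo
  locInt_deriv := (h1.continuous_deriv le_rfl).continuousOn.locallyIntegrableOn measurableSet_Ioo
  integral_eq χ k1 k2 k3 := by
    rw [setIntegral_Ioo_eq_intervalIntegral hcd.le, setIntegral_Ioo_eq_intervalIntegral hcd.le,
      intervalIntegral.integral_mul_deriv_eq_deriv_mul
        (fun x _ => (h1.differentiable one_ne_zero x).hasDerivAt)
        (fun x _ => (k1.differentiable (by simp) x).hasDerivAt)
        ((h1.continuous_deriv le_rfl).intervalIntegrable _ _)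
        ((k1.continuous_deriv (by simp)).intervalIntegrable _ _),
      test_eq_zero k3 left_notMem_Ioo, test_eq_zero k3 right_notMem_Ioo]
    simp

theorem normASq_eq (ha : IsDegenerateWeight c d a) (u g : ℝ → ℝ)
    (hu : AEStronglyMeasurable u (volume.restrict (Ioo c d))) :
    normASq c d a u g = eLpNorm u 2 (volume.restrict (Ioo c d)) ^ 2 +
      eLpNorm (fun x => √(a x) * g x) 2 (volume.restrict (Ioo c d)) ^ 2 := by
  have h2 : ∀ r : ℝ, ‖r‖ₑ ^ 2 = ENNReal.ofReal (r ^ 2) := fun r => by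
    rw [← ofReal_norm, ← ENNReal.ofReal_pow (norm_nonneg r), Real.norm_eq_abs, sq_abs]
  rw [eLpNorm_two_sq, eLpNorm_two_sq, ← lintegral_add_left' (hu.enorm.pow_const 2), normASq]
  refine lintegral_congr_ae ?_
  filter_upwards [ae_weight_pos ha] with x hx
  rw [h2, h2, ENNReal.ofReal_add (sq_nonneg _) (mul_nonneg hx.le (sq_nonneg _)), mul_pow,
    Real.sq_sqrt hx.le]

/-- `W¹_{a,0} ⊆ H¹_{a,0}`: the two spaces coincide. -/
theorem MemW1a0.memH1a0 (ha : IsDegenerateWeight c d a) (hu : MemW1a0 c d a u) :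
    MemH1a0 c d a u := by
  refine ⟨hu.1.1, dx c d u, hu.1.hasWeakDerivOn, fun ε hε => ?_⟩
  set G := weightedDeriv hu.1 with hG
  have hcl : G ∈ closure (testDeriv c d a : Set (L2 c d)) :=
    orthogonal_constFlux_le ha (hu.weightedDeriv_mem ha)
  -- `K ↦ ‖primitive of K - G‖² + ‖K - G‖²` is continuous and vanishes at `G`
  have hcont : Continuous fun K : L2 c d => ‖primitiveL ha (K - G)‖ₑ ^ 2 + ‖K - G‖ₑ ^ 2 := by
    fun_prop
  have hopen : IsOpen {K : L2 c d | ‖primitiveL ha (K - G)‖ₑ ^ 2 + ‖K - G‖ₑ ^ 2 < ε} :=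
    isOpen_lt hcont continuous_const
  obtain ⟨K, hK, ψ, h1, h2, h3, h4, h5⟩ := mem_closure_iff.1 hcl _ hopen (by simpa using hε)
  obtain ⟨φ, f1, f2, f3, f4⟩ := exists_test_primitive (ha.c_lt.trans ha.lt_d) h1 h2
    (h3.trans sdiff_subset) h4
  refine ⟨φ, ⟨f1, f2, f3⟩, lt_of_eq_of_lt ?_ hK⟩
  have e1 : (fun x => φ x - u x) =ᵐ[volume.restrict (Ioo c d)] primitiveL ha (K - G) := by
    rw [map_sub]
    filter_upwards [Lp.coeFn_sub (primitiveL ha K) (primitiveL ha G), hu.ae_eq_primitiveL ha,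
      coeFn_primitiveL_of_ae_eq ha h5] with x g1 g2 g3
    rw [g1, Pi.sub_apply, g3, ← f4, biPrimitive_deriv_test (f1.of_le (by simp)) f3, g2]
  have e2 : (fun x => √(a x) * (deriv φ x - dx c d u x)) =ᵐ[volume.restrict (Ioo c d)]
      (K - G : L2 c d) := by
    filter_upwards [Lp.coeFn_sub K G, h5, coeFn_weightedDeriv hu.1] with x g1 g2 g3
    rw [g1, Pi.sub_apply, g2, hG, g3, f4]
    ring
  rw [normASq_eq ha (fun x => φ x - u x) _ (f1.continuous.aestronglyMeasurable.sub hu.1.1.1),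
    eLpNorm_congr_ae e1, eLpNorm_congr_ae e2, Lp.enorm_def, Lp.enorm_def]

/-- Test functions on `(c,d)` belong to `H¹_{a,0}`. -/
theorem memH1a0_test (ha : IsDegenerateWeight c d a) {φ : ℝ → ℝ} (h1 : ContDiff ℝ ∞ φ)
    (h2 : HasCompactSupport φ) (h3 : tsupport φ ⊆ Ioo c d)
    (hu : u =ᵐ[volume.restrict (Ioo c d)] φ) : MemH1a0 c d a u := by
  have hw := (hasWeakDerivOn_of_contDiff (ha.c_lt.trans ha.lt_d) (h1.of_le (m := 1)
    (by simp))).mono (W := punctured c d) sdiff_subset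
  refine ⟨((h1.continuous.memLp_of_hasCompactSupport h2).restrict _).ae_eq hu.symm, deriv φ,
    hw.congr (by rw [restrict_punctured]; exact hu.symm) (ae_eq_refl _),
    fun ε hε => ⟨φ, ⟨h1, h2, h3⟩, lt_of_eq_of_lt ?_ hε⟩⟩
  rw [normASq, ← lintegral_zero]
  refine lintegral_congr_ae ?_
  filter_upwards [hu] with x hx
  simp [hx]

end

section

variable {c d : ℝ} {a u h : ℝ → ℝ}

/-! ### The transmission conditions -/

theorem sq_intervalIntegral_le {p q : ℝ} {h : ℝ → ℝ} (hpq : p ≤ q)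
    (hh : MemLp h 2 (volume.restrict (Ioo p q))) :
    (∫ x in p..q, h x) ^ 2 ≤ (q - p) * ∫ x in p..q, h x ^ 2 := by
  rcases hpq.eq_or_lt with rfl | hlt
  · simp
  have h1 : IntegrableOn h (Ioo p q) := hh.integrable one_le_two
  have h2 : IntegrableOn (fun x => h x ^ 2) (Ioo p q) := hh.integrable_sq
  -- expand the integral of `(h - m)²`, where `m` is the mean of `h`
  set m : ℝ := (∫ x in Ioo p q, h x) / (q - p) with hm
  have h3 : 0 ≤ ∫ x in Ioo p q, (h x - m) ^ 2 := integral_nonneg fun x => sq_nonneg _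
  have h4 : ∫ x in Ioo p q, (h x - m) ^ 2 =
      (∫ x in Ioo p q, h x ^ 2) - 2 * m * (∫ x in Ioo p q, h x) + m ^ 2 * (q - p) := by
    have e : ∀ x, (h x - m) ^ 2 = h x ^ 2 - 2 * m * h x + m ^ 2 := fun x => by ring
    have h5 : Integrable (fun x => h x ^ 2 - 2 * m * h x) (volume.restrict (Ioo p q)) :=
      h2.sub (h1.const_mul _)
    simp only [e]
    rw [integral_add h5 (integrable_const _),
      integral_sub h2 (h1.const_mul _), integral_const_mul, integral_const]
    simp [hlt.le, mul_comm]
  rw [← setIntegral_Ioo_eq_intervalIntegral hpq, ← setIntegral_Ioo_eq_intervalIntegral hpq]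
  have hqp : 0 < q - p := sub_pos.2 hlt
  have h5 : ∫ x in Ioo p q, h x = m * (q - p) := by rw [hm, div_mul_cancel₀ _ hqp.ne']
  rw [h4, h5] at h3
  rw [h5]
  nlinarith

theorem hasLim_of_continuousOn (hc : c < 1) (hd : 1 < d) {f f' : ℝ → ℝ}
    (h : f' =ᵐ[volume.restrict (Ioo c d)] f) (hf : ContinuousOn f' (Icc c d)) :
    HasLim c d (𝓝[<] 1) f (f' 1) ∧ HasLim c d (𝓝[>] 1) f (f' 1) := by
  have h1 : ContinuousAt f' 1 := hf.continuousAt (Icc_mem_nhds hc hd)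
  have h2 : ContinuousOn f' (punctured c d) :=
    hf.mono fun x hx => Ioo_subset_Icc_self hx.1
  exact ⟨⟨f', h, h2, h1.mono_left nhdsWithin_le_nhds⟩, f', h, h2, h1.mono_left nhdsWithin_le_nhds⟩

theorem intervalIntegrable_of_memLp_two (hcd : c ≤ d) (hh : MemLp h 2 (volume.restrict (Ioo c d))) :
    IntervalIntegrable h volume c d :=
  (intervalIntegrable_iff_Ioo hcd).2 (hh.integrable one_le_two)

/-- Elements of `W^{1,2}(c,d)` are primitives of square integrable functions. -/
theorem MemW12.exists_ae_eq (hc : c < 1) (hd : 1 < d) {w : ℝ → ℝ} (hw : MemW12 c d w) :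
    ∃ (L : ℝ) (h : ℝ → ℝ), MemLp h 2 (volume.restrict (Ioo c d)) ∧
      (fun x => L + ∫ t in 1..x, h t) =ᵐ[volume.restrict (Ioo c d)] w := by
  obtain ⟨h, hwh, hh⟩ := hw.2
  have hcd := hc.trans hd
  have hi := intervalIntegrable_of_memLp_two hcd.le hh
  obtain ⟨C, hC⟩ := hwh.exists_ae_eq_primitive hcd hi
  refine ⟨C + ∫ t in c..1, h t, h, hh, ?_⟩
  filter_upwards [hC, ae_restrict_mem measurableSet_Ioo] with x hx hx'
  have hsub : ∀ p ∈ Icc c d, IntervalIntegrable h volume c p := fun p hp => hi.mono_set (by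
    rw [uIcc_of_le hcd.le, uIcc_of_le hp.1]; exact Icc_subset_Icc_right hp.2)
  have h1 := hsub 1 ⟨hc.le, hd.le⟩
  have h2 := hsub x (Ioo_subset_Icc_self hx')
  rw [hx, add_assoc, intervalIntegral.integral_add_adjacent_intervals h1 (h1.symm.trans h2)]

/-- Under strong degeneration the flux of a function of finite energy vanishes at `1`: otherwise
`1/a` would be dominated near `1` by the integrable function `(√a g)² = (a g)² / a`. -/
theorem flux_limit_eq_zero (ha : IsDegenerateWeight c d a) (hs : ¬ WeaklyDegenerate c d a)
    {g F : ℝ → ℝ} (hg : MemLp (fun x => √(a x) * g x) 2 (volume.restrict (Ioo c d)))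
    (hF : F =ᵐ[volume.restrict (Ioo c d)] fun x => a x * g x) (hFc : ContinuousOn F (Icc c d)) :
    F 1 = 0 := by
  by_contra hL
  apply hs
  obtain ⟨κ, hκ, hle⟩ := ha.exists_sq_le
  have h1 : ContinuousAt F 1 := hFc.continuousAt (Icc_mem_nhds ha.c_lt ha.lt_d)
  have h2 : ∀ᶠ x in 𝓝 1, |F 1| / 2 < |F x| :=
    h1.abs.eventually (lt_mem_nhds (half_lt_self (abs_pos.2 hL)))
  obtain ⟨ε, hε, h3⟩ := Metric.eventually_nhds_iff.1 h2
  have hL' : 0 < |F 1| := abs_pos.2 hL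
  have hint : Integrable (fun x => 4 / |F 1| ^ 2 * (√(a x) * g x) ^ 2 + 1 / (κ * ε ^ 2))
      (volume.restrict (Ioo c d)) := (hg.integrable_sq.const_mul _).add (integrable_const _)
  have hmeas : AEStronglyMeasurable (fun x => 1 / a x) (volume.restrict (Ioo c d)) :=
    ((ha.cont.mono Ioo_subset_Icc_self).aestronglyMeasurable
      measurableSet_Ioo).aemeasurable.const_div 1 |>.aestronglyMeasurable
  refine hint.mono' hmeas ?_
  filter_upwards [hF, ae_weight_pos ha, ae_restrict_mem measurableSet_Ioo] with x hx hax hx'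
  rw [Real.norm_of_nonneg (by positivity)]
  by_cases hxε : |x - 1| < ε
  · have h4 : |F 1| / 2 < |F x| := h3 (by rwa [Real.dist_eq])
    have h5 : (|F 1| / 2) ^ 2 ≤ F x ^ 2 := by
      rw [← sq_abs (F x)]
      exact pow_le_pow_left₀ (by positivity) h4.le 2
    have h6 : (√(a x) * g x) ^ 2 = F x ^ 2 / a x := by
      rw [hx, mul_pow, Real.sq_sqrt hax.le]
      field_simp
    have h7 : 1 / a x ≤ 4 / |F 1| ^ 2 * (√(a x) * g x) ^ 2 := by
      rw [h6, div_mul_div_comm, div_le_div_iff₀ hax (by positivity)]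
      nlinarith
    have h8 : 0 ≤ 1 / (κ * ε ^ 2) := by positivity
    linarith
  · have h4 : 1 / a x ≤ 1 / (κ * ε ^ 2) := by
      refine one_div_le_one_div_of_le (by positivity)
        (le_trans ?_ (hle x (Ioo_subset_Icc_self hx')))
      rw [← sq_abs (x - 1)]
      have := not_lt.1 hxε
      gcongr
    have h5 : 0 ≤ 4 / |F 1| ^ 2 * (√(a x) * g x) ^ 2 := by positivity
    linarith

/-- Elements of `H¹_a` have finite energy. -/
theorem MemH1a.memLp_dx (ha : IsDegenerateWeight c d a) {φ : ℝ → ℝ} (hφ : MemH1a c d a φ) :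
    MemLp (fun x => √(a x) * dx c d φ x) 2 (volume.restrict (Ioo c d)) := by
  obtain ⟨hL, g, hg, happ⟩ := hφ
  obtain ⟨ψ, hψ, hlt⟩ := happ 1 one_pos
  have hψ' : ContDiff ℝ ∞ ψ := hψ
  have h1 := memLp_sqrt_mul (c := c) (d := d) ha (hψ'.continuous_deriv (by simp))
  rw [normASq_eq ha (fun x => ψ x - φ x) _ (hψ'.continuous.aestronglyMeasurable.sub hL.1)] at hlt
  have h2 : MemLp (fun x => √(a x) * (deriv ψ x - g x)) 2 (volume.restrict (Ioo c d)) := by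
    refine ⟨ha.aestronglyMeasurable_sqrt.mul
      ((hψ'.continuous_deriv (by simp)).aestronglyMeasurable.sub ?_), ?_⟩
    · rw [← restrict_punctured]
      exact hg.locInt_deriv.aestronglyMeasurable
    · by_contra htop
      rw [not_lt, top_le_iff] at htop
      rw [htop] at hlt
      simp at hlt
  refine (h1.sub h2).ae_eq ?_
  filter_upwards [dx_eq hg] with x hx
  simp only [Pi.sub_apply, hx]
  ring

theorem memLp_flux (ha : IsDegenerateWeight c d a)
    (hu : MemLp (fun x => √(a x) * dx c d u x) 2 (volume.restrict (Ioo c d))) :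
    MemLp (flux c d a u) 2 (volume.restrict (Ioo c d)) := by
  refine (memLp_sqrt_mul_L2 ha hu).ae_eq ?_
  filter_upwards [ae_weight_pos ha] with x hx
  rw [← mul_assoc, Real.mul_self_sqrt hx.le]
  rfl

/-- The product of a primitive `∫₁ˣ h` with `h ∈ L²`, which is `o(|x - 1|^(1/2))`, and a function
that is `O(|x - 1|^(-1/2))` tends to zero. -/
theorem tendsto_primitive_mul (hc : c < 1) (hd : 1 < d) {f : ℝ → ℝ}
    (hh : MemLp h 2 (volume.restrict (Ioo c d))) {K : ℝ}
    (hf : ∀ x ∈ Icc c d \ {1}, |x - 1| * f x ^ 2 ≤ K) :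
    Tendsto (fun x => (∫ t in 1..x, h t) * f x) (𝓝[≠] 1) (𝓝 0) := by
  have hcd := hc.trans hd
  have hsq : IntervalIntegrable (fun x => h x ^ 2) volume c d :=
    (intervalIntegrable_iff_Ioo hcd.le).2 hh.integrable_sq
  have h1 : Tendsto (fun x => |∫ t in 1..x, h t ^ 2| * K) (𝓝[≠] 1) (𝓝 0) := by
    have h2 : ContinuousAt (fun x => ∫ t in 1..x, h t ^ 2) 1 :=
      (continuousOn_primitive_Icc ⟨hc.le, hd.le⟩ hsq).continuousAt (Icc_mem_nhds hc hd)
    have h3 := (h2.abs.mul_const K).tendsto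
    simp only [intervalIntegral.integral_same, abs_zero, zero_mul] at h3
    exact h3.mono_left nhdsWithin_le_nhds
  have h2 : Tendsto (fun x => ((∫ t in 1..x, h t) * f x) ^ 2) (𝓝[≠] 1) (𝓝 0) := by
    refine squeeze_zero' (Eventually.of_forall fun x => sq_nonneg _) ?_ h1
    filter_upwards [self_mem_nhdsWithin, mem_nhdsWithin_of_mem_nhds (Icc_mem_nhds hc hd)]
      with x hx1 hx2
    have h3 : (∫ t in 1..x, h t) ^ 2 ≤ |x - 1| * |∫ t in 1..x, h t ^ 2| := by
      rcases le_total x 1 with hx | hx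
      · have h4 := sq_intervalIntegral_le hx
          (hh.mono_measure (Measure.restrict_mono_set _ (Ioo_subset_Ioo hx2.1 hd.le)))
        rw [intervalIntegral.integral_symm x 1, intervalIntegral.integral_symm x 1, neg_sq,
          abs_neg, abs_sub_comm, abs_of_nonneg (sub_nonneg.2 hx)]
        exact h4.trans (mul_le_mul_of_nonneg_left (le_abs_self _) (sub_nonneg.2 hx))
      · have h4 := sq_intervalIntegral_le hx
          (hh.mono_measure (Measure.restrict_mono_set _ (Ioo_subset_Ioo hc.le hx2.2)))
        rw [abs_of_nonneg (sub_nonneg.2 hx)]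
        exact h4.trans (mul_le_mul_of_nonneg_left (le_abs_self _) (sub_nonneg.2 hx))
    have h5 := hf x ⟨hx2, hx1⟩
    calc ((∫ t in 1..x, h t) * f x) ^ 2 = (∫ t in 1..x, h t) ^ 2 * f x ^ 2 := mul_pow _ _ _
      _ ≤ |x - 1| * |∫ t in 1..x, h t ^ 2| * f x ^ 2 :=
        mul_le_mul_of_nonneg_right h3 (sq_nonneg _)
      _ = |∫ t in 1..x, h t ^ 2| * (|x - 1| * f x ^ 2) := by ring
      _ ≤ _ := mul_le_mul_of_nonneg_left h5 (abs_nonneg _)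
  rw [tendsto_zero_iff_abs_tendsto_zero]
  have h3 := h2.sqrt
  simpa only [Function.comp_def, Real.sqrt_sq_eq_abs, Real.sqrt_zero] using h3

/-- An element of `W¹_{a,0}` whose flux belongs to `W^{1,2}` satisfies the transmission
conditions. -/
theorem MemW1a0.memDom (ha : IsDegenerateWeight c d a) (hu : MemW1a0 c d a u)
    (hw : MemW12 c d (flux c d a u)) : MemDom c d a u := by
  have hc := ha.c_lt
  have hd := ha.lt_d
  have hcd := hc.trans hd
  obtain ⟨L, h, hh, hLh⟩ := hw.exists_ae_eq hc hd
  have hcont : ∀ (L : ℝ) (h : ℝ → ℝ), MemLp h 2 (volume.restrict (Ioo c d)) →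
      ContinuousOn (fun x => L + ∫ t in 1..x, h t) (Icc c d) := fun L h hh =>
    continuousOn_const.add (continuousOn_primitive_Icc ⟨hc.le, hd.le⟩
      (intervalIntegrable_of_memLp_two hcd.le hh))
  have hflux := hasLim_of_continuousOn hc hd hLh (hcont L h hh)
  refine ⟨⟨hu.1, hw⟩, fun hweak => ⟨?_, _, hflux⟩, fun hs => ⟨fun φ hφ => ?_, ?_⟩⟩
  · obtain ⟨g, hg, hg'⟩ := hu.1.2
    rw [derivDomain, if_pos hweak] at hg
    have hi := intervalIntegrable_of_weak ha hweak hg'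
    obtain ⟨C, hC⟩ := hg.exists_ae_eq_primitive hcd hi
    exact ⟨_, hasLim_of_continuousOn hc hd hC.symm
      (continuousOn_const.add (continuousOn_primitive_Icc (left_mem_Icc.2 hcd.le) hi))⟩
  · obtain ⟨M, k, hk, hMk⟩ := hφ.2.exists_ae_eq hc hd
    have hM := flux_limit_eq_zero ha hs (MemH1a.memLp_dx ha hφ.1) hMk (hcont M k hk)
    simp only [intervalIntegral.integral_same, add_zero] at hM
    subst hM
    simp only [zero_add] at hMk
    obtain ⟨K, hK⟩ := ha.exists_sq_biPrimitive_le hu.1.memLp_dx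
    have hlim := tendsto_primitive_mul hc hd hk hK
    have hae : (fun x => (∫ t in 1..x, k t) * biPrimitive c d (dx c d u) x)
        =ᵐ[volume.restrict (Ioo c d)] fun x => flux c d a φ x * u x := by
      filter_upwards [hMk, hu.ae_eq_biPrimitive ha] with x h1 h2
      rw [h1, h2]
    have hco : ContinuousOn (fun x => (∫ t in 1..x, k t) * biPrimitive c d (dx c d u) x)
        (punctured c d) :=
      ((continuousOn_primitive_Icc ⟨hc.le, hd.le⟩ (intervalIntegrable_of_memLp_two hcd.le hk)).mono
        fun x hx => Ioo_subset_Icc_self hx.1).mul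
      ((continuousOn_biPrimitive (ha.integrableAwayFromOne hu.1.memLp_dx)).mono
        fun x hx => Icc_sdiff_of_punctured hx)
    exact ⟨⟨_, hae, hco, hlim.mono_left (nhdsWithin_mono _ fun x hx => ne_of_lt hx)⟩,
      ⟨_, hae, hco, hlim.mono_left (nhdsWithin_mono _ fun x hx => ne_of_gt hx)⟩⟩
  · have hL := flux_limit_eq_zero ha hs hu.1.memLp_dx hLh (hcont L h hh)
    rwa [hL] at hflux

end

/-! ### The energy space and the inverse of the wave operator -/

section

variable {c d : ℝ} {a : ℝ → ℝ} {ha : IsDegenerateWeight c d a}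
  {V : Submodule ℝ (L2 c d)} {hV : ∀ u ∈ V, MemW1a0 c d a u}

theorem EnergySpace.inner_eq (u v : EnergySpace ha V hV) :
    inner ℝ u v = ∫ x in Ioo c d, a x * dx c d (EnergySpace.toL2 ha V hV u) x *
      dx c d (EnergySpace.toL2 ha V hV v) x := rfl

theorem inner_weightedDeriv {u v : ℝ → ℝ} (ha : IsDegenerateWeight c d a) (hu : MemW1a c d a u)
    (hv : MemW1a c d a v) : inner ℝ (weightedDeriv hu) (weightedDeriv hv) =
      ∫ x in Ioo c d, a x * dx c d u x * dx c d v x := by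
  rw [L2_inner_eq]
  refine integral_congr_ae ?_
  filter_upwards [coeFn_weightedDeriv hu, coeFn_weightedDeriv hv, ae_weight_pos ha] with x h1 h2 h3
  rw [h1, h2]
  linear_combination (dx c d u x * dx c d v x) * Real.mul_self_sqrt h3.le

variable (ha V hV)

/-- The isometry `u ↦ √a u_x` of the energy space into `L²(c,d)`. -/
noncomputable def EnergySpace.weightedDerivₗᵢ : EnergySpace ha V hV →ₗᵢ[ℝ] L2 c d :=
  LinearMap.isometryOfInner
    { toFun := fun u => weightedDeriv u.memW1a0.1
      map_add' := fun u v => by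
        refine Lp.ext ?_
        filter_upwards [coeFn_weightedDeriv (u + v).memW1a0.1, coeFn_weightedDeriv u.memW1a0.1,
          coeFn_weightedDeriv v.memW1a0.1, EnergySpace.dx_add u v,
          Lp.coeFn_add (weightedDeriv u.memW1a0.1) (weightedDeriv v.memW1a0.1)]
          with x h1 h2 h3 h4 h5
        rw [h1, h5, Pi.add_apply, h2, h3, h4, Pi.add_apply, mul_add]
      map_smul' := fun r u => by
        refine Lp.ext ?_
        filter_upwards [coeFn_weightedDeriv (r • u).memW1a0.1, coeFn_weightedDeriv u.memW1a0.1,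
          EnergySpace.dx_smul r u, Lp.coeFn_smul r (weightedDeriv u.memW1a0.1)] with x h1 h2 h3 h4
        rw [h1, RingHom.id_apply, h4, Pi.smul_apply, h2, h3, Pi.smul_apply, smul_eq_mul,
          smul_eq_mul]
        ring }
    fun u v => inner_weightedDeriv ha u.memW1a0.1 v.memW1a0.1

theorem EnergySpace.weightedDerivₗᵢ_apply (u : EnergySpace ha V hV) :
    EnergySpace.weightedDerivₗᵢ ha V hV u = weightedDeriv u.memW1a0.1 := rfl

theorem EnergySpace.primitiveL_weightedDeriv (u : EnergySpace ha V hV) :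
    primitiveL ha (EnergySpace.weightedDerivₗᵢ ha V hV u) = EnergySpace.toL2 ha V hV u :=
  Lp.ext (u.memW1a0.ae_eq_primitiveL ha).symm

/-- The bounded inclusion of the energy space into `L²(c,d)`. -/
noncomputable def EnergySpace.inclusion : EnergySpace ha V hV →L[ℝ] L2 c d :=
  (primitiveL ha).comp (EnergySpace.weightedDerivₗᵢ ha V hV).toContinuousLinearMap

theorem EnergySpace.inclusion_apply (u : EnergySpace ha V hV) :
    EnergySpace.inclusion ha V hV u = EnergySpace.toL2 ha V hV u :=
  EnergySpace.primitiveL_weightedDeriv ha V hV u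

variable {ha V}

/-- Every `G ∈ constFluxᗮ` occurs as `√a u_x`, because `W¹_{a,0} ⊆ H¹_{a,0} ⊆ V`. -/
theorem EnergySpace.range_weightedDerivₗᵢ (hHV : ∀ u : L2 c d, MemH1a0 c d a u → u ∈ V) :
    range (EnergySpace.weightedDerivₗᵢ ha V hV) = ((constFlux c d a)ᗮ : Submodule ℝ (L2 c d)) := by
  refine Subset.antisymm ?_ fun G hG => ?_
  · rintro _ ⟨u, rfl⟩
    exact u.memW1a0.weightedDeriv_mem ha
  · have h1 : MemW1a0 c d a (primitiveL ha G) :=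
      (memW1a0_biPrimitive ha hG).congr (coeFn_primitiveL ha G).symm
    refine ⟨EnergySpace.mk ha V hV (primitiveL ha G) (hHV _ (h1.memH1a0 ha)), ?_⟩
    rw [EnergySpace.weightedDerivₗᵢ_apply]
    refine Lp.ext ((coeFn_weightedDeriv _).trans ?_)
    have h2 := dx_congr (memW1a0_biPrimitive ha hG).1 (coeFn_primitiveL ha G).symm
    filter_upwards [h2, dx_biPrimitive_unweight ha G, sqrt_mul_unweight ha G] with x e1 e2 e3
    rw [← e3, ← e2, ← e1]
    rfl

theorem EnergySpace.completeSpace (hHV : ∀ u : L2 c d, MemH1a0 c d a u → u ∈ V) :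
    CompleteSpace (EnergySpace ha V hV) := by
  rw [completeSpace_iff_isComplete_range
    (EnergySpace.weightedDerivₗᵢ ha V hV).isometry.isUniformInducing,
    EnergySpace.range_weightedDerivₗᵢ hV hHV]
  exact (Submodule.isClosed_orthogonal _).isComplete

/-- Green's formula: no boundary terms arise at `1`, because `√a v_x` is a limit of weighted
derivatives of test functions on all of `(c,d)`. -/
theorem EnergySpace.inner_eq_neg_inner (u v : EnergySpace ha V hV) {h : L2 c d}
    (hw : HasWeakDerivOn (Ioo c d) (flux c d a (EnergySpace.toL2 ha V hV u)) h) :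
    inner ℝ u v = -inner ℝ h (EnergySpace.toL2 ha V hV v) := by
  set D := EnergySpace.weightedDerivₗᵢ ha V hV with hD
  have key : ∀ K ∈ (testDeriv c d a).topologicalClosure,
      inner ℝ (D u) K + inner ℝ h (primitiveL ha K) = 0 := by
    intro K hK
    refine closure_minimal (s := (testDeriv c d a : Set (L2 c d)))
      (t := {K : L2 c d | inner ℝ (D u) K + inner ℝ h (primitiveL ha K) = 0}) ?_
      (isClosed_eq (by fun_prop) continuous_const) hK
    rintro K ⟨ψ, h1, h2, h3, h4, h5⟩
    obtain ⟨φ, f1, f2, f3, f4⟩ := exists_test_primitive (ha.c_lt.trans ha.lt_d) h1 h2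
      (h3.trans sdiff_subset) h4
    have e1 := hw.integral_eq φ f1 f2 f3
    have e2 : inner ℝ (D u) K =
        ∫ x in Ioo c d, flux c d a (EnergySpace.toL2 ha V hV u) x * deriv φ x := by
      rw [L2_inner_eq]
      refine integral_congr_ae ?_
      filter_upwards [h5, coeFn_weightedDeriv u.memW1a0.1, ae_weight_pos ha] with x g1 g2 g3
      rw [hD, EnergySpace.weightedDerivₗᵢ_apply, g1, g2, f4, flux]
      linear_combination (dx c d (EnergySpace.toL2 ha V hV u) x * ψ x) * Real.mul_self_sqrt g3.le
    have e3 : inner ℝ h (primitiveL ha K) = ∫ x in Ioo c d, h x * φ x := by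
      rw [L2_inner_eq]
      refine integral_congr_ae ?_
      filter_upwards [coeFn_primitiveL_of_ae_eq ha h5] with x g1
      rw [g1, ← f4, biPrimitive_deriv_test (f1.of_le (by simp)) f3]
    rw [mem_ofPred_eq, e2, e3, e1]
    ring
  have h1 := key (D v) (orthogonal_constFlux_le ha (v.memW1a0.weightedDeriv_mem ha))
  rw [hD, LinearIsometry.inner_map_map, EnergySpace.primitiveL_weightedDeriv] at h1
  linarith

/-- The weak form of `(a u_x)_x = h`, tested with smooth functions supported in `(c,d)`, gives
a weak derivative of the flux across `1`. -/
theorem EnergySpace.hasWeakDerivOn_flux (hHV : ∀ u : L2 c d, MemH1a0 c d a u → u ∈ V)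
    (u : EnergySpace ha V hV) {h : L2 c d}
    (H : ∀ v : EnergySpace ha V hV, inner ℝ u v = -inner ℝ h (EnergySpace.toL2 ha V hV v)) :
    HasWeakDerivOn (Ioo c d) (flux c d a (EnergySpace.toL2 ha V hV u)) h where
  locInt := by
    have : IntegrableOn (flux c d a (EnergySpace.toL2 ha V hV u)) (Ioo c d) :=
      (memLp_flux ha u.memW1a0.1.memLp_dx).integrable one_le_two
    exact this.locallyIntegrableOn
  locInt_deriv := by
    have : IntegrableOn h (Ioo c d) := (Lp.memLp h).integrable one_le_two
    exact this.locallyIntegrableOn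
  integral_eq φ h1 h2 h3 := by
    have hm : MemLp φ 2 (volume.restrict (Ioo c d)) :=
      (h1.continuous.memLp_of_hasCompactSupport h2).restrict _
    have hH := memH1a0_test ha h1 h2 h3 hm.coeFn_toLp
    have e := H (EnergySpace.mk ha V hV hm.toLp (hHV _ hH))
    have hdx : dx c d hm.toLp =ᵐ[volume.restrict (Ioo c d)] deriv φ :=
      dx_eq (((hasWeakDerivOn_of_contDiff (ha.c_lt.trans ha.lt_d) (h1.of_le (m := 1)
        (by simp))).mono (W := punctured c d) sdiff_subset).congr
        (by rw [restrict_punctured]; exact hm.coeFn_toLp.symm) (ae_eq_refl _))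
    rw [EnergySpace.inner_eq, L2_inner_eq] at e
    have e1 : ∫ x in Ioo c d, flux c d a (EnergySpace.toL2 ha V hV u) x * deriv φ x =
        ∫ x in Ioo c d, a x * dx c d (EnergySpace.toL2 ha V hV u) x * dx c d hm.toLp x := by
      refine integral_congr_ae ?_
      filter_upwards [hdx] with x hx
      rw [hx, flux]
    have e2 : ∫ x in Ioo c d, h x * φ x = ∫ x in Ioo c d, h x * hm.toLp φ x := by
      refine integral_congr_ae ?_
      filter_upwards [hm.coeFn_toLp] with x hx
      rw [hx]
    rw [e1, e2]
    exact e

/-- The bounded operator `(f, h) ↦ (-ι* h, ι f)`, where `ι` is the inclusion of the energy space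
into `L²(c,d)`; it is the inverse of the wave operator. -/
noncomputable def waveInverse [CompleteSpace (EnergySpace ha V hV)] :
    StateSpace ha V hV →L[ℝ] StateSpace ha V hV :=
  let e := WithLp.prodContinuousLinearEquiv 2 ℝ (EnergySpace ha V hV) (L2 c d)
  (e.symm : EnergySpace ha V hV × L2 c d →L[ℝ] StateSpace ha V hV).comp
    ((((-(EnergySpace.inclusion ha V hV).adjoint).comp (ContinuousLinearMap.snd ℝ _ _)).prod
      ((EnergySpace.inclusion ha V hV).comp (ContinuousLinearMap.fst ℝ _ _))).comp
      (e : StateSpace ha V hV →L[ℝ] EnergySpace ha V hV × L2 c d))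

section

variable [CompleteSpace (EnergySpace ha V hV)]

theorem waveInverse_fst (U : StateSpace ha V hV) :
    (waveInverse hV U).fst = -(EnergySpace.inclusion ha V hV).adjoint U.snd := rfl

theorem waveInverse_snd (U : StateSpace ha V hV) :
    (waveInverse hV U).snd = EnergySpace.toL2 ha V hV U.fst :=
  EnergySpace.inclusion_apply ha V hV U.fst

theorem waveInverse_skew (U W : StateSpace ha V hV) :
    inner ℝ (waveInverse hV U) W = -inner ℝ U (waveInverse hV W) := by
  rw [WithLp.prod_inner_apply, WithLp.prod_inner_apply]
  change inner ℝ (waveInverse hV U).fst W.fst + inner ℝ (waveInverse hV U).snd W.snd =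
    -(inner ℝ U.fst (waveInverse hV W).fst + inner ℝ U.snd (waveInverse hV W).snd)
  rw [waveInverse_fst, waveInverse_fst, waveInverse_snd, waveInverse_snd, inner_neg_left,
    inner_neg_right, ContinuousLinearMap.adjoint_inner_left,
    ContinuousLinearMap.adjoint_inner_right, EnergySpace.inclusion_apply,
    EnergySpace.inclusion_apply]
  ring

/-- The equation `u = -ι* h` is the weak form of `(a u_x)_x = h`. -/
theorem neg_adjoint_inclusion_eq_iff (u : EnergySpace ha V hV) (h : L2 c d) :
    -(EnergySpace.inclusion ha V hV).adjoint h = u ↔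
      ∀ v : EnergySpace ha V hV, inner ℝ u v = -inner ℝ h (EnergySpace.toL2 ha V hV v) := by
  constructor
  · rintro rfl v
    rw [inner_neg_left, ContinuousLinearMap.adjoint_inner_left, EnergySpace.inclusion_apply]
  · intro H
    refine ext_inner_right ℝ fun v => ?_
    rw [H, inner_neg_left, ContinuousLinearMap.adjoint_inner_left, EnergySpace.inclusion_apply]

/-- The wave operator is the inverse of `waveInverse`. -/
theorem waveOperator_eq_iff (hHV : ∀ u : L2 c d, MemH1a0 c d a u → u ∈ V)
    (U W : StateSpace ha V hV) :
    (∃ hU : U ∈ (waveOperator ha V hV).domain, waveOperator ha V hV ⟨U, hU⟩ = W) ↔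
      waveInverse hV W = U := by
  constructor
  · rintro ⟨hU, rfl⟩
    refine WithLp.ofLp_injective 2 (Prod.ext ?_ ?_)
    · exact (neg_adjoint_inclusion_eq_iff hV U.fst (divFlux ⟨U, hU⟩)).2 fun v =>
        EnergySpace.inner_eq_neg_inner hV U.fst v (hasWeakDerivOn_divFlux ⟨U, hU⟩)
    · exact waveInverse_snd hV _
  · rintro rfl
    have hw := EnergySpace.hasWeakDerivOn_flux hV hHV (waveInverse hV W).fst (h := W.snd)
      ((neg_adjoint_inclusion_eq_iff hV _ _).1 rfl)
    have hu := (waveInverse hV W).fst.memW1a0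
    have hW12 : MemW12 c d (flux c d a (EnergySpace.toL2 ha V hV (waveInverse hV W).fst)) :=
      ⟨memLp_flux ha hu.1.memLp_dx, _, hw, Lp.memLp _⟩
    have hU : waveInverse hV W ∈ (waveOperator ha V hV).domain := by
      refine ⟨hu.memDom ha hW12, ?_⟩
      rw [waveInverse_snd]
      exact W.fst.2
    refine ⟨hU, WithLp.ofLp_injective 2 (Prod.ext ?_ ?_)⟩
    · exact Subtype.ext (waveInverse_snd hV W)
    · exact Lp.ext (divFlux_eq ⟨_, hU⟩ hw)

end

end

end DegenerateWave

theorem lemma2p1p2 (c d : ℝ) (a : ℝ → ℝ) (ha : IsDegenerateWeight c d a)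
    (V : Submodule ℝ (L2 c d))
    (hHV : ∀ u : L2 c d, MemH1a0 c d a u → u ∈ V)
    (hVW : ∀ u ∈ V, MemW1a0 c d a u) :
    CompleteSpace (StateSpace ha V hVW) ∧
    Dense ((waveOperator ha V hVW).domain : Set (StateSpace ha V hVW)) ∧
    Dissipative (waveOperator ha V hVW) ∧
    AdjointDissipative (waveOperator ha V hVW) ∧
    ∃ T : ℝ≥0 → StateSpace ha V hVW →L[ℝ] StateSpace ha V hVW,
      IsContractionSemigroup T ∧ IsGenerator (waveOperator ha V hVW) T := by
  have : CompleteSpace (EnergySpace ha V hVW) := EnergySpace.completeSpace hVW hHV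
  have hS : CompleteSpace (StateSpace ha V hVW) := inferInstance
  exact ⟨hS, generates_of_inverse_skew (waveInverse_skew hVW) _ (waveOperator_eq_iff hVW hHV)⟩
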